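/- Let $d,M,L\in\mathbb N$, $T>0$, let $K_1,K_2\in\mathcal C_b^2(\mathbb R^d,\mathbb R^d)$ (bounded with bounded derivatives up to order two), and for a probability measure $\mu$ on $\mathbb R^d$ and $u=(u^1,\dots,u^M)\in\mathbb R^{dM}$ put $$v(\mu,u)(x)=-\int K_1(x-y)\,d\mu(y)-\sum_{m=1}^M K_2(x-u^m).$$ Let $\mathcal P_2(\mathbb R^d)$ be the Borel probability measures with finite second moment, with the 2-Wasserstein distance. Fix $\hat\mu\in\mathcal P_2(\mathbb R^d)$ with a Lebesgue density and $\hat u\in\mathbb R^{dM}$, and let $\mathcal U_{ad}=\{u\in H^1((0,T),\mathbb R^{dM}): u_0=\hat u\}$. A pair $(\mu,u)$ with $\mu\in\mathcal C([0,T],\mathcal P_2(\mathbb R^d))$, $\mu_0=\hat\mu$ and $u\in\mathcal U_{ad}$ is called admissible if $$\int\varphi_T\,d\mu_T-\int\varphi_0\,d\hat\mu-\int_0^T\!\!\int\big(\partial_t\varphi_t+v(\mu_t,u_t)\cdot\nabla\varphi_t\big)\,d\mu_t\,dt=0\qquad\text{for all }\varphi\in\mathcal C_c^1([0,T]\times\mathbb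 R^d).$$ Let $J_1(\mu)=j(\langle g_1,\mu\rangle,\dots,\langle g_L,\mu\rangle)$, where $\langle g,\mu\rangle=\int g\,d\mu$, $j\in\mathcal C^1(\mathbb R^L)$, $g_\ell\in\mathcal C^1(\mathbb R^d)$ and $|\nabla g_\ell(x)|\le C_g(1+|x|)$ for all $x$ and $\ell$ and some constant $C_g$. Let $J_2$ be a real functional on $\mathcal U_{ad}$. Let $(\bar\mu,\bar u)$ be an optimal pair, i.e. a minimizer of $\int_0^T J_1(\mu_t)\,dt+J_2(u)$ among all admissible pairs, and suppose that $J_2$ is Gâteaux differentiable at $\bar u$, i.e. has a directional derivative $dJ_2(\bar u)[k]=\frac{d}{d\delta}\big|_{\delta=0}J_2(\bar u+\delta k)$ for every $k\in H^1((0,T),\mathbb R^{dM})$ with $k_0=0$. Let $h\in\mathcal C_c^\infty((0,T),\mathbb R^{dM})$, and write $$\mathcal K_t[\psi](x)=Dv(\bar\mu_t,\bar u_t)(x)\,\psi(x)+\int DK_1(x-y)\,\psi(y)\,d\bar\mu_t(y)+\sum_{m=1}^M DK_2(x-\bar u_t^m)\,h_t^m,$$ $$\delta_\mu J_1(\mu)(x)=\sum_{\ell=1}^L(\partial_\ell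 j)(\langle g_1,\mu\rangle,\dots,\langle g_L,\mu\rangle)\,\nabla g_\ell(x).$$ Consider the linearized equation $$\partial_t\psi_t+D\psi_t\,v(\bar\mu_t,\bar u_t)=\mathcal K_t[\psi_t]\quad \bar\mu_t\,dt\text{-a.e. in }(0,T)\times\mathbb R^d,\qquad \psi_0=0,$$ where a solution is a map $\psi:[0,T)\times\mathbb R^d\to\mathbb R^d$ that is continuous, is $\mathcal C^1$ on $(0,T)\times\mathbb R^d$, and satisfies $\int_0^T\!\int|\psi_t|^2\,d\bar\mu_t\,dt<\infty$. Then this equation has a solution $\psi$ that is bounded with bounded first derivatives on $(0,T)\times\mathbb R^d$. Moreover, for every solution $\psi$, the function $\langle\delta_\mu J_1(\bar\mu_t),\psi_t\rangle$ is $\bar\mu_t$-integrable for a.e. $t\in(0,T)$, its integral against $\bar\mu_t$ is integrable in $t$ over $(0,T)$, and $$dJ_2(\bar u)[h]+\int_0^T\!\!\int\langle\delta_\mu J_1(\bar\mu_t),\psi_t\rangle\,d\bar\mu_t\,dt=0 .$$ -/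

import Mathlib

open MeasureTheory Set Filter Topology
open scoped ENNReal Distributions Gradient

noncomputable section

namespace MFControl

/-- The state space `ℝ^d` with its Euclidean structure. -/
abbrev Sp (d : ℕ) : Type := EuclideanSpace ℝ (Fin d)

/-- The space `ℝ^{dM}` of values of `M` controls, with its Euclidean structure. -/
abbrev Ctrl (d M : ℕ) : Type := PiLp 2 (fun _ : Fin M => Sp d)

/-! ### The 2-Wasserstein space -/

/-- `μ ∈ P₂(ℝ^d)`: a Borel probability measure with finite second moment. -/
structure IsP2 {d : ℕ} (μ : Measure (Sp d)) : Prop where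
  isProbabilityMeasure : IsProbabilityMeasure μ
  secondMoment_lt_top : ∫⁻ x, ‖x‖ₑ ^ 2 ∂μ < ∞

/-- The set `Π(μ, ν)` of couplings of `μ` and `ν`. -/
def couplings {d : ℕ} (μ ν : Measure (Sp d)) : Set (Measure (Sp d × Sp d)) :=
  {π | π.map Prod.fst = μ ∧ π.map Prod.snd = ν}

/-- The 2-Wasserstein distance `W₂(μ, ν)`. -/
def W2 {d : ℕ} (μ ν : Measure (Sp d)) : ℝ≥0∞ :=
  (⨅ π ∈ couplings μ ν, ∫⁻ p, ‖p.1 - p.2‖ₑ ^ 2 ∂π) ^ (1 / 2 : ℝ)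

/-- `μ ∈ C([0,T], P₂(ℝ^d))`; the values of `μ` outside `[0,T]` are irrelevant. -/
structure IsContinuousP2Curve {d : ℕ} (T : ℝ) (μ : ℝ → Measure (Sp d)) : Prop where
  mem_P2 : ∀ t ∈ Icc 0 T, IsP2 (μ t)
  continuous : ∀ s ∈ Icc 0 T, Tendsto (fun t => W2 (μ t) (μ s)) (𝓝[Icc 0 T] s) (𝓝 0)

/-! ### The Sobolev space of controls -/

/-- The open interval `(0,T)`. -/
def timeInterval (T : ℝ) : TopologicalSpace.Opens ℝ := ⟨Ioo 0 T, isOpen_Ioo⟩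

/-- The value at time `t` of a continuous function on `[0,T]` (and `0` for `t ∉ [0,T]`). -/
def evalAt {F : Type*} [TopologicalSpace F] [Zero F] {T : ℝ} (u : C(Icc (0 : ℝ) T, F)) (t : ℝ) :
    F :=
  open Classical in if ht : t ∈ Icc 0 T then u ⟨t, ht⟩ else 0

/-- `w ∈ L²(0,T)` is the weak derivative of `u` on `(0,T)`. -/
def IsWeakDeriv {F : Type*} [NormedAddCommGroup F] [NormedSpace ℝ F] {T : ℝ}
    (u : C(Icc (0 : ℝ) T, F)) (w : ℝ → F) : Prop :=
  MemLp w 2 (volume.restrict (Ioo 0 T)) ∧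
    ∀ φ : 𝓓(timeInterval T, ℝ),
      ∫ t in Ioo 0 T, deriv φ t • evalAt u t = -∫ t in Ioo 0 T, φ t • w t

lemma integrableOn_smul_evalAt {F : Type*} [NormedAddCommGroup F] [NormedSpace ℝ F] {T : ℝ}
    (u : C(Icc (0 : ℝ) T, F)) {f : ℝ → ℝ} (hf : Continuous f) :
    IntegrableOn (fun t => f t • evalAt u t) (Ioo 0 T) := by
  have hc : ContinuousOn (evalAt u) (Icc 0 T) := by
    rw [continuousOn_iff_continuous_domRestrict]
    refine u.continuous.congr fun t => ?_
    simp only [evalAt, domRestrict_apply, dif_pos t.2]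
  exact ((hf.continuousOn.smul hc).integrableOn_compact isCompact_Icc).mono_set Ioo_subset_Icc_self

lemma integrableOn_smul_of_memLp {F : Type*} [NormedAddCommGroup F] [NormedSpace ℝ F] {T : ℝ}
    (φ : 𝓓(timeInterval T, ℝ)) {w : ℝ → F} (hw : MemLp w 2 (volume.restrict (Ioo 0 T))) :
    IntegrableOn (fun t => φ t • w t) (Ioo 0 T) := by
  have h1 : Integrable w (volume.restrict (Ioo 0 T)) := hw.integrable (by norm_num)
  obtain ⟨C, hC⟩ := φ.continuous.bounded_above_of_compact_support φ.hasCompactSupport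
  exact h1.bdd_smul C φ.continuous.aestronglyMeasurable (Eventually.of_forall hC)

/-- The Sobolev space `H¹((0,T), F)`. Each class is represented by its continuous
representative on `[0,T]`. -/
def H1 (T : ℝ) (F : Type*) [NormedAddCommGroup F] [NormedSpace ℝ F] :
    Submodule ℝ C(Icc (0 : ℝ) T, F) where
  carrier := {u | ∃ w : ℝ → F, IsWeakDeriv u w}
  zero_mem' := ⟨0, MemLp.zero, fun φ => by simp [evalAt]⟩
  add_mem' := by
    rintro u v ⟨w, hw, hu⟩ ⟨z, hz, hv⟩
    refine ⟨w + z, hw.add hz, fun φ => ?_⟩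
    have hd : Continuous (deriv φ) := φ.contDiff.continuous_deriv (by simp)
    have e : ∀ t, evalAt (u + v) t = evalAt u t + evalAt v t := fun t => by
      unfold evalAt; split_ifs <;> simp
    simp only [e, smul_add, Pi.add_apply]
    rw [integral_add (integrableOn_smul_evalAt u hd) (integrableOn_smul_evalAt v hd),
      integral_add (integrableOn_smul_of_memLp φ hw) (integrableOn_smul_of_memLp φ hz),
      hu φ, hv φ, neg_add]
  smul_mem' := by
    rintro c u ⟨w, hw, hu⟩
    refine ⟨c • w, hw.const_smul c, fun φ => ?_⟩
    have e : ∀ t, evalAt (c • u) t = c • evalAt u t := fun t => by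
      unfold evalAt; split_ifs <;> simp
    simp only [e, Pi.smul_apply, smul_comm _ c, integral_smul, hu φ, smul_neg]

/-- A test function `h ∈ C_c^∞((0,T), F)` as an element of `H¹((0,T), F)`. -/
def testToH1 {F : Type*} [NormedAddCommGroup F] [NormedSpace ℝ F] [CompleteSpace F] {T : ℝ}
    (h : 𝓓(timeInterval T, F)) : H1 T F :=
  ⟨⟨fun t => h t, h.continuous.comp continuous_subtype_val⟩, deriv h, by
    have hd : Continuous (deriv h) := h.contDiff.continuous_deriv (by simp)
    refine ⟨(hd.memLp_of_hasCompactSupport h.hasCompactSupport.deriv).restrict _, fun φ => ?_⟩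
    have hφ : Continuous (deriv φ) := φ.contDiff.continuous_deriv (by simp)
    have e1 : ∫ t in Ioo 0 T, φ t • deriv h t = ∫ t, φ t • deriv h t := by
      refine setIntegral_eq_integral_of_forall_compl_eq_zero fun t ht => ?_
      rw [image_eq_zero_of_notMem_tsupport fun hx => ht (φ.tsupport_subset hx), zero_smul]
    have e2 : ∫ t in Ioo 0 T, deriv φ t • h t = ∫ t, deriv φ t • h t := by
      refine setIntegral_eq_integral_of_forall_compl_eq_zero fun t ht => ?_
      rw [image_eq_zero_of_notMem_tsupport fun hx => ht (h.tsupport_subset hx), smul_zero]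
    have e3 : ∫ t in Ioo 0 T, deriv φ t • evalAt (T := T)
        ⟨fun t => h t, h.continuous.comp continuous_subtype_val⟩ t =
        ∫ t in Ioo 0 T, deriv φ t • h t := by
      refine setIntegral_congr_fun measurableSet_Ioo fun t ht => ?_
      simp only [evalAt, dif_pos (Ioo_subset_Icc_self ht), ContinuousMap.coe_mk]
    have i1 : Integrable fun t => φ t • deriv h t :=
      (φ.continuous.smul hd).integrable_of_hasCompactSupport φ.hasCompactSupport.smul_right
    have i2 : Integrable fun t => deriv φ t • h t :=
      (hφ.smul h.continuous).integrable_of_hasCompactSupport h.hasCompactSupport.smul_left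
    have i3 : Integrable fun t => φ t • h t :=
      (φ.continuous.smul h.continuous).integrable_of_hasCompactSupport h.hasCompactSupport.smul_left
    have key := integral_bilinear_hasDerivAt_right_eq_neg_left_of_integrable
      (L := ContinuousLinearMap.lsmul ℝ ℝ)
      (fun t _ => ((φ.contDiff.differentiable (by simp)) t).hasDerivAt)
      (fun t _ => ((h.contDiff.differentiable (by simp)) t).hasDerivAt) i1 i2 i3
    simp only [ContinuousLinearMap.lsmul_apply] at key
    rw [e3, e1, e2, key, neg_neg]⟩

/-- The admissible controls `U_ad`: those `u ∈ H¹((0,T), ℝ^{dM})` with `u₀ = û`. -/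
def Uad {d M : ℕ} (T : ℝ) (uhat : Ctrl d M) : Set (H1 T (Ctrl d M)) :=
  {u | evalAt u.1 0 = uhat}

/-- `J₂` is Gâteaux differentiable at `u` as a functional on the affine space `U_ad`: it has a
directional derivative at `u` along each `k ∈ H¹` with `k₀ = 0`, the directions of `U_ad`.
(`J₂` is a total function on `H¹` here, but only its values on `U_ad` matter.) -/
def GateauxDifferentiableAt {d M : ℕ} {T : ℝ} (J2 : H1 T (Ctrl d M) → ℝ)
    (u : H1 T (Ctrl d M)) : Prop :=
  ∀ k : H1 T (Ctrl d M), evalAt k.1 0 = 0 → LineDifferentiableAt ℝ J2 u k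

/-! ### The velocity field, the state equation and the cost -/

/-- `f ∈ C_b^n`: `f` is `n` times continuously differentiable, and `f` and its derivatives up to
order `n` are bounded. -/
def IsCb {E F : Type*} [NormedAddCommGroup E] [NormedSpace ℝ E] [NormedAddCommGroup F]
    [NormedSpace ℝ F] (n : ℕ) (f : E → F) : Prop :=
  ContDiff ℝ n f ∧ ∀ k ≤ n, ∃ C : ℝ, ∀ x, ‖iteratedFDeriv ℝ k f x‖ ≤ C

/-- `v(μ, u)(x) = -(K₁ * μ)(x) - ∑ₘ K₂(x - uᵐ)`. -/
def velocity {d M : ℕ} (K1 K2 : Sp d → Sp d) (μ : Measure (Sp d)) (u : Ctrl d M) (x : Sp d) :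
    Sp d :=
  -(∫ y, K1 (x - y) ∂μ) - ∑ m, K2 (x - u m)

/-- `E(μ, u)[φ] = ⟨φ_T, μ_T⟩ - ⟨φ₀, μ̂⟩ - ∫₀ᵀ ⟨∂ₜφ + v(μₜ, uₜ)·∇φₜ, μₜ⟩ dt`. -/
def stateResidual {d M : ℕ} (T : ℝ) (K1 K2 : Sp d → Sp d) (μhat : Measure (Sp d))
    (μ : ℝ → Measure (Sp d)) (u : H1 T (Ctrl d M)) (φ : ℝ → Sp d → ℝ) : ℝ :=
  (∫ x, φ T x ∂(μ T)) - (∫ x, φ 0 x ∂μhat) -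
    ∫ t in (0)..T, ∫ x, (deriv (fun s => φ s x) t +
      inner ℝ (velocity K1 K2 (μ t) (evalAt u.1 t) x) (∇ (φ t) x)) ∂(μ t)

/-- `(μ, u)` is an admissible pair: `μ ∈ C([0,T], P₂)`, `μ₀ = μ̂`, `u ∈ U_ad`, and
`E(μ, u)[φ] = 0` for all `φ ∈ C_c^1([0,T] × ℝ^d)`, i.e. for all restrictions to
`[0,T] × ℝ^d` of functions in `C_c^1(ℝ × ℝ^d)`. -/
structure IsAdmissible {d M : ℕ} (T : ℝ) (K1 K2 : Sp d → Sp d) (μhat : Measure (Sp d))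
    (uhat : Ctrl d M) (μ : ℝ → Measure (Sp d)) (u : H1 T (Ctrl d M)) : Prop where
  curve : IsContinuousP2Curve T μ
  initial : μ 0 = μhat
  control : u ∈ Uad T uhat
  state : ∀ φ : ℝ → Sp d → ℝ, ContDiff ℝ 1 (Function.uncurry φ) →
    HasCompactSupport (Function.uncurry φ) → stateResidual T K1 K2 μhat μ u φ = 0

/-- The requirements on the data `j`, `g₁, …, g_L` of a cylindrical function. -/
structure IsCylindricalData {d L : ℕ} (j : (Fin L → ℝ) → ℝ) (g : Fin L → Sp d → ℝ) : Prop where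
  contDiff_outer : ContDiff ℝ 1 j
  contDiff_inner : ∀ l, ContDiff ℝ 1 (g l)
  growth : ∃ C : ℝ, ∀ l x, ‖∇ (g l) x‖ ≤ C * (1 + ‖x‖)

/-- The cylindrical function `J₁(μ) = j(⟨g₁, μ⟩, …, ⟨g_L, μ⟩)`. -/
def cylindrical {d L : ℕ} (j : (Fin L → ℝ) → ℝ) (g : Fin L → Sp d → ℝ) (μ : Measure (Sp d)) : ℝ :=
  j (fun l => ∫ x, g l x ∂μ)

/-- `δ_μ J₁(μ)(x) = ∑_ℓ (∂_ℓ j)(⟨g₁, μ⟩, …, ⟨g_L, μ⟩) ∇g_ℓ(x)`. -/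
def cylindricalGrad {d L : ℕ} (j : (Fin L → ℝ) → ℝ) (g : Fin L → Sp d → ℝ) (μ : Measure (Sp d))
    (x : Sp d) : Sp d :=
  ∑ l, fderiv ℝ j (fun l' => ∫ y, g l' y ∂μ) (Pi.single l 1) • ∇ (g l) x

/-- The cost `J(μ, u) = ∫₀ᵀ J₁(μₜ) dt + J₂(u)`. -/
def cost {d M L : ℕ} {T : ℝ} (j : (Fin L → ℝ) → ℝ) (g : Fin L → Sp d → ℝ)
    (J2 : H1 T (Ctrl d M) → ℝ) (μ : ℝ → Measure (Sp d)) (u : H1 T (Ctrl d M)) : ℝ :=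
  (∫ t in (0)..T, cylindrical j g (μ t)) + J2 u

/-- `(μ, u)` is an optimal pair: it minimises the cost among all admissible pairs. -/
structure IsOptimal {d M L : ℕ} (T : ℝ) (K1 K2 : Sp d → Sp d) (μhat : Measure (Sp d))
    (uhat : Ctrl d M) (j : (Fin L → ℝ) → ℝ) (g : Fin L → Sp d → ℝ)
    (J2 : H1 T (Ctrl d M) → ℝ) (μ : ℝ → Measure (Sp d)) (u : H1 T (Ctrl d M)) : Prop where
  admissible : IsAdmissible T K1 K2 μhat uhat μ u
  minimal : ∀ (μ' : ℝ → Measure (Sp d)) (u' : H1 T (Ctrl d M)),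
    IsAdmissible T K1 K2 μhat uhat μ' u' → cost j g J2 μ u ≤ cost j g J2 μ' u'

/-! ### The linearized equation -/

/-- `𝒦(μ, u)[ψ, h] = Dv(μ, u) ψ + ∫ DK₁(· - y) ψ(y) dμ(y) + ∑ₘ DK₂(· - uᵐ) hᵐ`. -/
def linearizedForce {d M : ℕ} (K1 K2 : Sp d → Sp d) (μ : Measure (Sp d)) (u : Ctrl d M)
    (ψ : Sp d → Sp d) (h : Ctrl d M) (x : Sp d) : Sp d :=
  fderiv ℝ (velocity K1 K2 μ u) x (ψ x) + (∫ y, fderiv ℝ K1 (x - y) (ψ y) ∂μ) +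
    ∑ m, fderiv ℝ K2 (x - u m) (h m)

/-- `ψ` solves `∂ₜψ + Dψ v(μₜ, uₜ) = 𝒦(μₜ, uₜ)[ψₜ, hₜ]`, `ψ₀ = 0`: it is `C¹` on `(0,T) × ℝ^d` and
continuous up to `t = 0`, it lies in `L²(μₜ dt)`, and the equation holds `μₜ dt`-almost
everywhere. -/
structure SolvesLinearization {d M : ℕ} {T : ℝ} (K1 K2 : Sp d → Sp d) (μ : ℝ → Measure (Sp d))
    (u : H1 T (Ctrl d M)) (h : 𝓓(timeInterval T, Ctrl d M)) (ψ : ℝ → Sp d → Sp d) : Prop where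
  contDiffOn : ContDiffOn ℝ 1 (Function.uncurry ψ) (Ioo 0 T ×ˢ univ)
  continuousOn : ContinuousOn (Function.uncurry ψ) (Ico 0 T ×ˢ univ)
  initial : ∀ x, ψ 0 x = 0
  square_integrable : ∫⁻ t in Ioo 0 T, ∫⁻ x, ‖ψ t x‖ₑ ^ 2 ∂(μ t) < ∞
  equation : ∀ᵐ t ∂(volume.restrict (Ioo 0 T)), ∀ᵐ x ∂(μ t),
    deriv (fun s => ψ s x) t + fderiv ℝ (ψ t) x (velocity K1 K2 (μ t) (evalAt u.1 t) x) =
      linearizedForce K1 K2 (μ t) (evalAt u.1 t) (ψ t) (h t) x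

/-- `ψ` and its first derivatives are bounded on `(0,T) × ℝ^d`. -/
def IsC1Bounded {d : ℕ} (T : ℝ) (ψ : ℝ → Sp d → Sp d) : Prop :=
  ∃ C : ℝ, ∀ t ∈ Ioo 0 T, ∀ x, ‖ψ t x‖ ≤ C ∧ ‖fderiv ℝ (Function.uncurry ψ) (t, x)‖ ≤ C

end MFControl

end

/-!
The optimality condition is the Euler-Lagrange equation of the control problem, derived in
Lagrangian coordinates, where the state is a flow acting on labels distributed according to `μhat`,
rather than a curve of measures.

*Admissible curves are transported.* If `(μ, u)` is admissible, then `v(μ_t, u_t)` is a bounded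
field which is Lipschitz in space and, by Wasserstein continuity of `μ`, continuous in time. It has
a `C¹` flow `Z_t = id + ζ_t`, and the weak continuity equation tested with `η(t) f(Z_t⁻¹ x)` gives
`μ_t = (Z_t)_* μhat` (`IsAdmissible.eq_map`). Conversely, for every control the mean-field equation
`ζ' = v((id + ζ)_* μhat, u) ∘ (id + ζ)` is an ordinary differential equation with globally Lipschitz
right-hand side in the Banach space of bounded continuous displacements, and its solution gives an
admissible pair (`exists_meanField_flow`, `isAdmissible_of_meanField_flow`).

*Variation of the control.* Let `ξ^δ` be the mean-field flow for the control `ubar + δ h` and `φ`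
the solution of the linearized mean-field equation, again an equation in the Banach space of
displacements. Grönwall's inequality gives `‖ξ^δ - ζ - δ φ‖ ≤ A δ²` uniformly on `[0, T]`
(`exists_meanField_expansion`). Differentiating the cost along this family at its minimum `δ = 0`
yields the asserted identity with `⟨δ_μ J₁(μbar_t) ∘ Z_t, φ_t⟩` integrated against `μhat`
(`IsOptimal.lineDeriv_add_integral_eq_zero`).

*Back to Eulerian coordinates.* The function `ψ_t = φ_t ∘ Z_t⁻¹` is a bounded solution of the
linearized equation with bounded derivatives: `φ` is jointly `C¹` because it is part of the flow of
a `C¹` field on pairs (label, displacement) (`contDiff_linMeanField_flow`), and it is Lipschitz by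
Grönwall's inequality (`exists_solvesLinearization`). If `ψ` is an arbitrary solution, then
`w = ψ ∘ Z - φ` satisfies `|∂_t w| ≤ c (|w| + ∫ |w_t| dμhat)` almost everywhere, so that
`n(t) = ∫ |w_t| dμhat` satisfies `n(t) ≤ 2 c ∫₀ᵗ n`; hence `ψ_t ∘ Z_t = φ_t` holds `μhat`-almost
everywhere for almost every `t` (`SolvesLinearization.ae_eq`), and the identity for `φ` is the
identity for `ψ`.
-/

open scoped NNReal BoundedContinuousFunction

namespace MFControl

/-! ### Ordinary differential equations in Banach spaces -/

section ODE

variable {X : Type*} [NormedAddCommGroup X] [NormedSpace ℝ X]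

lemma gronwallBound_le {δ K ε x : ℝ} (hK : 0 ≤ K) (hε : 0 ≤ ε) :
    gronwallBound δ K ε x ≤ (δ + ε * x) * Real.exp (K * x) := by
  rcases hK.eq_or_lt with rfl | hK
  · simp [gronwallBound_K0]
  · rw [gronwallBound_of_K_ne_0 hK.ne', add_mul, mul_assoc ε]
    dsimp only
    rw [div_mul_eq_mul_div, mul_div_assoc]
    gcongr
    rw [div_le_iff₀ hK]
    have h1 : 1 - K * x ≤ Real.exp (-(K * x)) := by
      linarith [Real.add_one_le_exp (-(K * x))]
    have h2 : Real.exp (-(K * x)) * Real.exp (K * x) = 1 := by rw [← Real.exp_add]; simp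
    nlinarith [Real.exp_pos (K * x)]

/-- An explicit form of Grönwall's inequality on `[0, T]`. -/
theorem norm_le_of_norm_deriv_le {f f' : ℝ → X} {K ε T : ℝ} (hK : 0 ≤ K) (hε : 0 ≤ ε)
    (hf : ∀ t ∈ Icc 0 T, HasDerivAt f (f' t) t)
    (hb : ∀ t ∈ Icc 0 T, ‖f' t‖ ≤ K * ‖f t‖ + ε) {t : ℝ} (ht : t ∈ Icc 0 T) :
    ‖f t‖ ≤ (‖f 0‖ + ε * T) * Real.exp (K * T) := by
  have h := norm_le_gronwallBound_of_norm_deriv_right_le (f := f) (f' := f') (δ := ‖f 0‖) (K := K)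
    (ε := ε) (a := 0) (b := T) (fun t ht => (hf t ht).continuousAt.continuousWithinAt)
    (fun t ht => (hf t (Ico_subset_Icc_self ht)).hasDerivWithinAt) le_rfl
    (fun t ht => hb t (Ico_subset_Icc_self ht)) t ht
  rw [sub_zero] at h
  refine h.trans ((gronwallBound_le hK hε).trans ?_)
  have h1 := ht.1
  have h2 := ht.2
  have h3 : 0 ≤ ‖f 0‖ + ε * T := by have := h1.trans h2; positivity
  gcongr

/-- Grönwall's inequality forward and backward in time. -/
theorem norm_le_of_norm_deriv_le_symm {f f' : ℝ → X} {K ε T : ℝ} (hK : 0 ≤ K) (hε : 0 ≤ ε)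
    (hf : ∀ t ∈ Icc (-T) T, HasDerivAt f (f' t) t)
    (hb : ∀ t ∈ Icc (-T) T, ‖f' t‖ ≤ K * ‖f t‖ + ε) {t : ℝ} (ht : t ∈ Icc (-T) T) :
    ‖f t‖ ≤ (‖f 0‖ + ε * T) * Real.exp (K * T) := by
  have hT : 0 ≤ T := by linarith [ht.1, ht.2]
  rcases le_total 0 t with h | h
  · exact norm_le_of_norm_deriv_le hK hε (fun s hs => hf s ⟨by linarith [hs.1], hs.2⟩)
      (fun s hs => hb s ⟨by linarith [hs.1], hs.2⟩) ⟨h, ht.2⟩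
  · have := norm_le_of_norm_deriv_le (f := fun s => f (-s)) (f' := fun s => -f' (-s)) (T := T)
      hK hε (fun s hs => by
        have := (hf (-s) ⟨by linarith [hs.2], by linarith [hs.1]⟩).scomp s (hasDerivAt_neg s)
        simpa [Function.comp_def] using this)
      (fun s hs => by
        rw [norm_neg]
        exact hb (-s) ⟨by linarith [hs.2], by linarith [hs.1]⟩) (t := -t)
      ⟨by linarith, by linarith [ht.1]⟩
    simpa using this

/-- Two trajectories of a linear equation with the same initial value coincide. -/
theorem eq_of_linear_ode {f g : ℝ → X} {A : ℝ → X →L[ℝ] X} {R : ℝ}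
    (hA : ContinuousOn A (Icc (-R) R))
    (hf : ∀ t ∈ Icc (-R) R, HasDerivAt f (A t (f t)) t)
    (hg : ∀ t ∈ Icc (-R) R, HasDerivAt g (A t (g t)) t) (h0 : f 0 = g 0) {t : ℝ}
    (ht : t ∈ Icc (-R) R) : f t = g t := by
  obtain ⟨K, hK⟩ := isCompact_Icc.exists_bound_of_continuousOn hA
  have hK0 : 0 ≤ K := (norm_nonneg _).trans (hK t ht)
  have := norm_le_of_norm_deriv_le_symm (f := fun t => f t - g t) (K := K) (ε := 0) hK0 le_rfl
    (fun s hs => (hf s hs).sub (hg s hs)) (fun s hs => by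
      rw [← map_sub, add_zero]
      exact (A s).le_of_opNorm_le (hK s hs) _) ht
  simp only [h0, sub_self, norm_zero, zero_mul, add_zero] at this
  exact sub_eq_zero.1 (norm_le_zero_iff.1 this)

/-- A pointwise bound by an even function bounds the primitive on both sides of `0`. -/
lemma norm_integral_le_comp_abs {f : ℝ → X} (hf : Continuous f) {φ φ' : ℝ → ℝ}
    (hφ : ∀ s, HasDerivAt φ (φ' s) s) (hφ' : Continuous φ') (h0 : 0 ≤ φ 0)
    (hb : ∀ s, ‖f s‖ ≤ φ' |s|) (t : ℝ) :
    ‖∫ s in (0)..t, f s‖ ≤ φ |t| := by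
  have key : ∀ g : ℝ → X, Continuous g → (∀ s, ‖g s‖ ≤ φ' |s|) → ∀ t, 0 ≤ t →
      ‖∫ s in (0)..t, g s‖ ≤ φ t := by
    intro g hg hb t ht
    have h1 : ‖∫ s in (0)..t, g s‖ ≤ ∫ s in (0)..t, ‖g s‖ :=
      intervalIntegral.norm_integral_le_integral_norm ht
    have h2 : ∫ s in (0)..t, ‖g s‖ ≤ ∫ s in (0)..t, φ' s := by
      refine intervalIntegral.integral_mono_on ht (hg.norm.intervalIntegrable _ _)
        (hφ'.intervalIntegrable _ _) fun s hs => ?_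
      have := hb s
      rwa [abs_of_nonneg hs.1] at this
    rw [intervalIntegral.integral_eq_sub_of_hasDerivAt (fun s _ => hφ s)
      (hφ'.intervalIntegrable _ _)] at h2
    linarith
  rcases le_total 0 t with ht | ht
  · rw [abs_of_nonneg ht]
    exact key f hf hb t ht
  · rw [abs_of_nonpos ht]
    have := key (fun s => f (-s)) (hf.comp continuous_neg) (fun s => by simpa using hb (-s)) (-t)
      (by linarith)
    rw [intervalIntegral.integral_comp_neg, neg_neg, neg_zero, intervalIntegral.integral_symm,
      norm_neg] at this
    exact this

/-- A globally Lipschitz, time-dependent vector field on a Banach space that is bounded at the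
origin has a solution on all of `ℝ`. The Picard map is a contraction for the weighted norm
`sup_t exp(-2 (K + 1) |t|) ‖y t‖`. -/
theorem exists_forall_hasDerivAt [CompleteSpace X] {F : ℝ → X → X} {K : ℝ≥0} {B : ℝ}
    (hF : Continuous (Function.uncurry F)) (hlip : ∀ t, LipschitzWith K (F t))
    (hB : ∀ t, ‖F t 0‖ ≤ B) (x₀ : X) :
    ∃ y : ℝ → X, y 0 = x₀ ∧ ∀ t, HasDerivAt y (F t (y t)) t := by
  have hB0 : 0 ≤ B := (norm_nonneg _).trans (hB 0)
  -- the weight `exp (c |t|)` turns the Lipschitz constant of the Picard map into `K / c ≤ 1 / 2`;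
  -- the unknown is `z t = exp (-c |t|) • y t`, which is bounded
  set c : ℝ := 2 * (K + 1) with hc
  have hc2 : 2 ≤ c := by have := K.2; simp only [NNReal.val_eq_coe] at this; linarith
  let w : ℝ → ℝ := fun s => Real.exp (c * |s|)
  have hw : Continuous w := by fun_prop
  have hw0 : ∀ s, 0 < w s := fun s => Real.exp_pos _
  have hw1 : ∀ s, 1 ≤ w s := fun s => Real.one_le_exp (by positivity)
  have hint : ∀ z : ℝ →ᵇ X, Continuous fun s => F s (w s • z s) := fun z =>
    hF.comp (continuous_id.prodMk (hw.smul z.continuous))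
  let P : (ℝ →ᵇ X) → ℝ → X := fun z t =>
    (w t)⁻¹ • (x₀ + ∫ s in (0)..t, F s (w s • z s))
  have hexp : ∀ s, HasDerivAt (fun s : ℝ => Real.exp (c * s)) (Real.exp (c * s) * c) s := fun s =>
    ((hasDerivAt_id s).const_mul c).exp.congr_deriv (by simp)
  have hPc : ∀ z, Continuous (P z) := fun z => by
    refine (hw.inv₀ fun s => (hw0 s).ne').smul (continuous_const.add ?_)
    exact intervalIntegral.continuous_primitive (fun a b => (hint z).intervalIntegrable a b) 0
  have hPb : ∀ z t, ‖P z t‖ ≤ ‖x₀‖ + B + K * ‖z‖ := by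
    intro z t
    have h1 := norm_integral_le_comp_abs (hint z) (φ := fun s => B * s + K * ‖z‖ *
      (Real.exp (c * s) / c)) (φ' := fun s => B + K * ‖z‖ * Real.exp (c * s))
      (fun s => by
        refine (((hasDerivAt_id s).const_mul B).add
          (((hexp s).div_const c).const_mul (K * ‖z‖))).congr_deriv ?_
        field_simp) (by fun_prop) (by positivity)
      (fun s => by
        have h2 := (hlip s).norm_sub_le (w s • z s) 0
        have h3 : ‖F s (w s • z s)‖ ≤ ‖F s (w s • z s) - F s 0‖ + ‖F s 0‖ := by
          simpa using norm_add_le (F s (w s • z s) - F s 0) (F s 0)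
        have h4 : ‖w s • z s‖ ≤ w s * ‖z‖ := by
          rw [norm_smul, Real.norm_of_nonneg (hw0 s).le]
          exact mul_le_mul_of_nonneg_left (z.norm_coe_le_norm s) (hw0 s).le
        rw [sub_zero] at h2
        have h5 := mul_le_mul_of_nonneg_left h4 K.2
        have h6 := hB s
        simp only [NNReal.val_eq_coe] at h5
        calc _ ≤ K * (w s * ‖z‖) + B := by linarith
          _ = _ := by ring) t
    rw [norm_smul, norm_inv, Real.norm_of_nonneg (hw0 t).le, inv_mul_le_iff₀ (hw0 t)]
    refine (norm_add_le _ _).trans ?_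
    have h2 : |t| ≤ w t := by
      have := Real.add_one_le_exp (c * |t|)
      have := abs_nonneg t
      change |t| ≤ Real.exp (c * |t|)
      nlinarith
    have h3 : Real.exp (c * |t|) / c ≤ w t := div_le_self (hw0 t).le (by linarith)
    have h4 : ‖x₀‖ ≤ w t * ‖x₀‖ := le_mul_of_one_le_left (norm_nonneg _) (hw1 t)
    have h5 : B * |t| ≤ B * w t := by gcongr
    have h6 : K * ‖z‖ * (Real.exp (c * |t|) / c) ≤ K * ‖z‖ * w t := by gcongr
    calc _ ≤ w t * ‖x₀‖ + (B * w t + K * ‖z‖ * w t) := by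
          refine add_le_add h4 (h1.trans (add_le_add h5 h6))
      _ = _ := by ring
  let Φ : (ℝ →ᵇ X) → (ℝ →ᵇ X) := fun z =>
    BoundedContinuousFunction.ofNormedAddCommGroup (P z) (hPc z) _ (hPb z)
  have hΦ : ContractingWith (1 / 2) Φ := by
    refine ⟨by rw [← NNReal.coe_lt_coe]; norm_num, LipschitzWith.of_dist_le_mul fun z z' => ?_⟩
    refine (BoundedContinuousFunction.dist_le (by positivity)).2 fun t => ?_
    rw [dist_eq_norm]
    change ‖P z t - P z' t‖ ≤ _
    have h1 := norm_integral_le_comp_abs ((hint z).sub (hint z'))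
      (φ := fun s => K * dist z z' * (Real.exp (c * s) / c))
      (φ' := fun s => K * dist z z' * Real.exp (c * s))
      (fun s => (((hexp s).div_const c).const_mul (K * dist z z')).congr_deriv (by field_simp))
      (by fun_prop) (by positivity)
      (fun s => by
        have h2 := (hlip s).norm_sub_le (w s • z s) (w s • z' s)
        rw [← smul_sub, norm_smul, Real.norm_of_nonneg (hw0 s).le, ← dist_eq_norm (z s)] at h2
        refine h2.trans ?_
        rw [mul_assoc, mul_comm (dist z z')]
        gcongr
        exact z.dist_coe_le_dist s) t
    simp only [Pi.sub_apply] at h1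
    rw [intervalIntegral.integral_sub ((hint z).intervalIntegrable _ _)
      ((hint z').intervalIntegrable _ _)] at h1
    have h2 : P z t - P z' t = (w t)⁻¹ • ((∫ s in (0)..t, F s (w s • z s)) -
        ∫ s in (0)..t, F s (w s • z' s)) := by
      simp only [P, ← smul_sub, add_sub_add_left_eq_sub]
    rw [h2, norm_smul, norm_inv, Real.norm_of_nonneg (hw0 t).le, inv_mul_le_iff₀ (hw0 t)]
    refine h1.trans ?_
    have h3 : (K : ℝ) / c ≤ 1 / 2 := by rw [div_le_iff₀ (by linarith)]; linarith
    calc _ = (K / c) * dist z z' * w t := by simp only [w]; ring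
      _ ≤ (1 / 2) * dist z z' * w t := by gcongr
      _ = _ := by push_cast; ring
  let z := hΦ.fixedPoint Φ
  have hz : ∀ t, w t • z t = x₀ + ∫ s in (0)..t, F s (w s • z s) := fun t => by
    have h1 : P z t = z t := DFunLike.congr_fun hΦ.fixedPoint_isFixedPt t
    rw [← h1]
    exact smul_inv_smul₀ (hw0 t).ne' _
  refine ⟨fun t => w t • z t, (hz 0).trans
    (by rw [intervalIntegral.integral_same, add_zero]), fun t => ?_⟩
  have h1 : HasDerivAt (fun t => x₀ + ∫ s in (0)..t, F s (w s • z s)) (F t (w t • z t)) t :=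
    (intervalIntegral.integral_hasDerivAt_right ((hint z).intervalIntegrable _ _)
      (hint z).aestronglyMeasurable.stronglyMeasurableAtFilter
      (hint z).continuousAt).const_add x₀
  exact h1.congr_of_eventuallyEq (Eventually.of_forall hz)

/-- The resolvent of a linear equation whose coefficient depends continuously on a parameter. -/
theorem exists_resolvent [CompleteSpace X] {Q : Type*} [TopologicalSpace Q]
    {A : ℝ → Q → X →L[ℝ] X} (hA : Continuous (Function.uncurry A)) {R : ℝ} (hR : 0 ≤ R) :
    ∃ U : ℝ → Q → X →L[ℝ] X, Continuous (Function.uncurry U) ∧ (∀ q, U 0 q = 1) ∧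
      ∀ q, ∀ t ∈ Icc (-R) R, HasDerivAt (fun t => U t q) ((A t q).comp (U t q)) t := by
  -- outside `[-R, R]` the coefficient is frozen, which makes it bounded for each fixed parameter
  let cl : ℝ → ℝ := fun t => max (-R) (min t R)
  have hcl : Continuous cl := by fun_prop
  have hclm : ∀ t, cl t ∈ Icc (-R) R := fun t =>
    ⟨le_max_left _ _, max_le (by linarith) (min_le_right _ _)⟩
  have hcle : ∀ t ∈ Icc (-R) R, cl t = t := fun t ht => by
    simp only [cl, min_eq_left ht.2, max_eq_right ht.1]
  have hAt : ∀ q, Continuous fun t => A (cl t) q := fun q =>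
    hA.comp (hcl.prodMk continuous_const)
  have hbd : ∀ q, ∃ K, ∀ t, ‖A (cl t) q‖ ≤ K := fun q => by
    obtain ⟨K, hK⟩ := (isCompact_Icc (a := -R) (b := R)).exists_bound_of_continuousOn
      (f := fun t => A t q) (hA.comp (continuous_id.prodMk continuous_const)).continuousOn
    exact ⟨K, fun t => hK _ (hclm t)⟩
  have hex : ∀ q, ∃ y : ℝ → X →L[ℝ] X, y 0 = 1 ∧
      ∀ t, HasDerivAt y ((A (cl t) q).comp (y t)) t := fun q => by
    obtain ⟨K, hK⟩ := hbd q
    refine exists_forall_hasDerivAt (F := fun t y => (A (cl t) q).comp y) (K := K.toNNReal)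
      (B := 0) ?_ (fun t => ?_) (by simp) 1
    · exact ((hAt q).comp continuous_fst).clm_comp continuous_snd
    · refine LipschitzWith.of_dist_le_mul fun y y' => ?_
      rw [dist_eq_norm, dist_eq_norm, ← ContinuousLinearMap.comp_sub]
      refine (ContinuousLinearMap.opNorm_comp_le _ _).trans ?_
      gcongr
      exact (hK t).trans (Real.le_coe_toNNReal K)
  choose U hU0 hU using hex
  refine ⟨fun t q => U q t, ?_, hU0, fun q t ht => by
    have := hU q t
    rwa [hcle t ht] at this⟩
  rw [continuous_iff_continuousAt]
  rintro ⟨t₀, q₀⟩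
  set R' := |t₀| + 1 with hR'
  obtain ⟨K, hK⟩ := hbd q₀
  have hK0 : 0 ≤ K := (norm_nonneg _).trans (hK 0)
  have hUc : Continuous (U q₀) :=
    continuous_iff_continuousAt.2 fun t => (hU q₀ t).continuousAt
  obtain ⟨N, hN⟩ := (isCompact_Icc (a := -R') (b := R')).exists_bound_of_continuousOn
    (f := U q₀) hUc.continuousOn
  have hR'0 : 0 ≤ R' := by positivity
  have hN0 : 0 ≤ N := (norm_nonneg _).trans (hN 0 ⟨by linarith, hR'0⟩)
  rw [ContinuousAt, Metric.tendsto_nhds]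
  intro ε hε
  -- `η * D` is the Grönwall bound for `U q - U q₀` when the coefficients differ by at most `η ≤ 1`
  set D := R' * Real.exp ((K + 1) * R') * (N + 1) with hD
  have hDpos : 0 < D := by positivity
  set η := min 1 (ε / 2 / D) with hη
  have hηpos : 0 < η := lt_min one_pos (by positivity)
  have hnear : ∀ᶠ q in 𝓝 q₀, ∀ t ∈ Icc (-R) R, ‖A t q - A t q₀‖ < η := by
    refine isCompact_Icc.eventually_forall_of_forall_eventually fun t _ => ?_
    have : ContinuousAt (fun p : Q × ℝ => ‖A p.2 p.1 - A p.2 q₀‖) (q₀, t) :=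
      ((hA.comp continuous_swap).sub
        (hA.comp (continuous_snd.prodMk continuous_const))).norm.continuousAt
    exact this.eventually (gt_mem_nhds (by simpa using hηpos))
  have hdiff : ∀ᶠ q in 𝓝 q₀, ∀ t ∈ Icc (-R') R', ‖U q t - U q₀ t‖ ≤ ε / 2 := by
    filter_upwards [hnear] with q hq t ht
    have h1 := norm_le_of_norm_deriv_le_symm (f := fun t => U q t - U q₀ t) (T := R')
      (K := K + 1) (ε := η * (N + 1)) (by positivity) (by positivity)
      (fun s hs => (hU q s).sub (hU q₀ s)) (fun s hs => by
        have e : (A (cl s) q).comp (U q s) - (A (cl s) q₀).comp (U q₀ s) =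
            (A (cl s) q).comp (U q s - U q₀ s) + (A (cl s) q - A (cl s) q₀).comp (U q₀ s) := by
          rw [ContinuousLinearMap.comp_sub, ContinuousLinearMap.sub_comp]; abel
        have h2 := hq (cl s) (hclm s)
        have h3 : ‖A (cl s) q‖ ≤ K + 1 := by
          have h4 : ‖A (cl s) q‖ ≤ ‖A (cl s) q - A (cl s) q₀‖ + ‖A (cl s) q₀‖ := by
            simpa using norm_add_le (A (cl s) q - A (cl s) q₀) (A (cl s) q₀)
          have := hK s
          have : η ≤ 1 := min_le_left _ _
          linarith
        rw [e]
        refine (norm_add_le _ _).trans (add_le_add ?_ ?_)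
        · exact (ContinuousLinearMap.opNorm_comp_le _ _).trans (by gcongr)
        · refine (ContinuousLinearMap.opNorm_comp_le _ _).trans ?_
          have := hN s hs
          gcongr
          linarith) ht
    simp only [hU0, sub_self, norm_zero, zero_add] at h1
    refine h1.trans ?_
    have h2 : η ≤ ε / 2 / D := min_le_right _ _
    calc _ = η * D := by rw [hD]; ring
      _ ≤ ε / 2 / D * D := by gcongr
      _ = ε / 2 := by field_simp
  have hc : ∀ᶠ t in 𝓝 t₀, ‖U q₀ t - U q₀ t₀‖ < ε / 2 :=
    ((hUc.sub continuous_const).norm.continuousAt (x := t₀)).eventually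
      (gt_mem_nhds (by simpa using half_pos hε))
  have ht : ∀ᶠ t in 𝓝 t₀, t ∈ Icc (-R') R' := by
    refine Icc_mem_nhds ?_ ?_
    · have := neg_abs_le t₀; linarith
    · have := le_abs_self t₀; linarith
  filter_upwards [(hc.and ht).prod_nhds hdiff] with p hp
  rw [dist_eq_norm]
  change ‖U p.2 p.1 - U q₀ t₀‖ < ε
  have h1 := hp.2 p.1 hp.1.2
  have h2 := norm_add_le (U p.2 p.1 - U q₀ p.1) (U q₀ p.1 - U q₀ t₀)
  rw [sub_add_sub_cancel] at h2
  linarith [hp.1.1]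

/-- `C¹` dependence of a flow on time and parameters. With
`B(t, p, p') = ∫₀¹ D V_t (Y_t(p) + s (Y_t(p') - Y_t(p))) ds` the difference `Y(p') - Y(p)` solves a
linear equation, so it is the resolvent of `B` applied to the difference of the initial values, and
the resolvent is continuous in `(t, p, p')`. -/
theorem contDiff_of_flow {E P : Type*} [NormedAddCommGroup E] [NormedSpace ℝ E] [CompleteSpace E]
    [NormedAddCommGroup P] [NormedSpace ℝ P] {V : ℝ → E → E} {V' : ℝ → E → E →L[ℝ] E}
    (hV : Continuous (Function.uncurry V)) (hV' : Continuous (Function.uncurry V'))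
    (hd : ∀ t y, HasFDerivAt (V t) (V' t y) y) {Y : ℝ → P → E}
    (hY : Continuous (Function.uncurry Y))
    (hYt : ∀ t p, HasDerivAt (fun t => Y t p) (V t (Y t p)) t) (ℓ : P →L[ℝ] E)
    (h0 : ∀ p p', Y 0 p' - Y 0 p = ℓ (p' - p)) :
    ContDiff ℝ 1 (Function.uncurry Y) := by
  rw [contDiff_iff_contDiffAt]
  rintro ⟨t₀, p₀⟩
  set R := |t₀| + 1 with hR
  have hR0 : 0 ≤ R := by positivity
  let B : ℝ → P × P → E →L[ℝ] E := fun t q =>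
    ∫ s in (0 : ℝ)..1, V' t (Y t q.1 + s • (Y t q.2 - Y t q.1))
  have hseg : Continuous fun z : (ℝ × P × P) × ℝ =>
      Y z.1.1 z.1.2.1 + z.2 • (Y z.1.1 z.1.2.2 - Y z.1.1 z.1.2.1) := by
    have h1 : Continuous fun z : (ℝ × P × P) × ℝ => Y z.1.1 z.1.2.1 :=
      hY.comp (by fun_prop : Continuous fun z : (ℝ × P × P) × ℝ => (z.1.1, z.1.2.1))
    have h2 : Continuous fun z : (ℝ × P × P) × ℝ => Y z.1.1 z.1.2.2 :=
      hY.comp (by fun_prop : Continuous fun z : (ℝ × P × P) × ℝ => (z.1.1, z.1.2.2))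
    fun_prop
  have hB : Continuous (Function.uncurry B) := by
    refine intervalIntegral.continuous_parametric_intervalIntegral_of_continuous
      (f := fun (q : ℝ × P × P) s => V' q.1 (Y q.1 q.2.1 + s • (Y q.1 q.2.2 - Y q.1 q.2.1)))
      ?_ continuous_const
    exact hV'.comp ((continuous_fst.comp continuous_fst).prodMk hseg)
  -- Hadamard's formula for the increment of the field between two trajectories
  have hHad : ∀ t q, V t (Y t q.2) - V t (Y t q.1) = B t q (Y t q.2 - Y t q.1) := by
    intro t q
    have hc : Continuous fun s : ℝ => V' t (Y t q.1 + s • (Y t q.2 - Y t q.1)) :=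
      hV'.comp (continuous_const.prodMk (by fun_prop))
    have h1 := intervalIntegral.integral_eq_sub_of_hasDerivAt (a := 0) (b := 1)
      (f := fun s : ℝ => V t (Y t q.1 + s • (Y t q.2 - Y t q.1)))
      (f' := fun s : ℝ => V' t (Y t q.1 + s • (Y t q.2 - Y t q.1)) (Y t q.2 - Y t q.1))
      (fun s _ => by
        have h2 : HasDerivAt (fun s : ℝ => Y t q.1 + s • (Y t q.2 - Y t q.1))
            (Y t q.2 - Y t q.1) s := by
          simpa using ((hasDerivAt_id s).smul_const (Y t q.2 - Y t q.1)).const_add (Y t q.1)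
        exact (hd t _).comp_hasDerivAt s h2)
      ((hc.clm_apply continuous_const).intervalIntegrable _ _)
    simp only [one_smul, zero_smul, add_zero, add_sub_cancel] at h1
    rw [← h1]
    exact (ContinuousLinearMap.intervalIntegral_apply (μ := volume)
      (hc.intervalIntegrable (μ := volume) 0 1) (Y t q.2 - Y t q.1)).symm
  obtain ⟨U, hUc, hU0, hU⟩ := exists_resolvent hB hR0
  have hdiff : ∀ t ∈ Icc (-R) R, ∀ p p', Y t p' - Y t p = U t (p, p') (ℓ (p' - p)) := by
    intro t ht p p'
    refine eq_of_linear_ode (f := fun t => Y t p' - Y t p)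
      (g := fun t => U t (p, p') (ℓ (p' - p))) (A := fun t => B t (p, p')) (R := R)
      (hB.comp (continuous_id.prodMk continuous_const)).continuousOn (fun s hs => ?_)
      (fun s hs => ?_) (by simp [h0, hU0]) ht
    · have := (hYt s p').sub (hYt s p)
      rwa [hHad s (p, p')] at this
    · simpa using (hU (p, p') s hs).clm_apply (hasDerivAt_const s (ℓ (p' - p)))
  -- letting `p' → p` in the increment formula gives the derivative in the parameter
  have hfd : ∀ t ∈ Icc (-R) R, ∀ p, HasFDerivAt (Y t) ((U t (p, p)).comp ℓ) p := by
    intro t ht p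
    rw [hasFDerivAt_iff_isLittleO]
    have h1 : ∀ p', Y t p' - Y t p - ((U t (p, p)).comp ℓ) (p' - p) =
        (U t (p, p') - U t (p, p)) (ℓ (p' - p)) := fun p' => by
      rw [hdiff t ht]; simp
    simp only [h1]
    have h2 : (fun p' => U t (p, p') - U t (p, p)) =o[𝓝 p] fun _ => (1 : ℝ) := by
      rw [Asymptotics.isLittleO_one_iff]
      have : Continuous fun p' => U t (p, p') - U t (p, p) :=
        (hUc.comp (continuous_const.prodMk (continuous_const.prodMk continuous_id))).sub
          continuous_const
      simpa using this.tendsto p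
    have h3 : (fun p' => ℓ (p' - p)) =O[𝓝 p] fun p' => p' - p := ℓ.isBigO_comp _ _
    have h4 : (fun p' => (U t (p, p') - U t (p, p)) (ℓ (p' - p))) =O[𝓝 p]
        fun p' => ‖U t (p, p') - U t (p, p)‖ * ‖ℓ (p' - p)‖ :=
      Asymptotics.isBigO_of_le _ fun p' => by
        rw [norm_mul, norm_norm, norm_norm]
        exact ContinuousLinearMap.le_opNorm _ _
    refine h4.trans_isLittleO ?_
    have h5 := (h2.norm_left.mul_isBigO h3.norm_norm)
    simp only [one_mul] at h5
    exact h5.of_norm_right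
  have ht : Ioo (-R) R ∈ 𝓝 t₀ := by
    refine Ioo_mem_nhds ?_ ?_
    · have := neg_abs_le t₀; linarith
    · have := le_abs_self t₀; linarith
  -- both partial derivatives are jointly continuous, so the map is jointly `C¹`
  let f₁ : ℝ → P → ℝ →L[ℝ] E := fun t p => ContinuousLinearMap.toSpanSingleton ℝ (V t (Y t p))
  let f₂ : ℝ → P → P →L[ℝ] E := fun t p => (U t (p, p)).comp ℓ
  have hf₁ : Continuous (Function.uncurry f₁) :=
    (ContinuousLinearMap.toSpanSingletonCLE (𝕜 := ℝ) (E := E)).continuous.comp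
      (hV.comp (continuous_fst.prodMk hY))
  have hf₂ : Continuous (Function.uncurry f₂) :=
    (hUc.comp (continuous_fst.prodMk (continuous_snd.prodMk continuous_snd))).clm_comp
      continuous_const
  have hmem : ∀ᶠ v : ℝ × P in 𝓝 (t₀, p₀), v.1 ∈ Ioo (-R) R :=
    continuousAt_fst.eventually ht
  have hder : ∀ v : ℝ × P, v.1 ∈ Ioo (-R) R → HasFDerivAt (Function.uncurry Y)
      ((f₁ v.1 v.2).coprod (f₂ v.1 v.2)) v := by
    intro v hv
    have hm : ∀ᶠ w : ℝ × P in 𝓝 v, w.1 ∈ Ioo (-R) R :=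
      continuousAt_fst.eventually (isOpen_Ioo.mem_nhds hv)
    exact (hasStrictFDerivAt_uncurry_coprod (f := Y) (f₁ := f₁) (f₂ := f₂) (u := v)
      (hm.mono fun w _ => (hYt w.1 w.2).hasFDerivAt)
      (hm.mono fun w hw => hfd w.1 (Ioo_subset_Icc_self hw) w.2)
      hf₁.continuousAt hf₂.continuousAt).hasFDerivAt
  rw [contDiffAt_one_iff]
  refine ⟨fun v => (f₁ v.1 v.2).coprod (f₂ v.1 v.2), _, hmem, ?_, fun v hv => hder v hv⟩
  have e : (fun v : ℝ × P => (f₁ v.1 v.2).coprod (f₂ v.1 v.2)) = fun v : ℝ × P =>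
      (f₁ v.1 v.2).comp (ContinuousLinearMap.fst ℝ ℝ P) +
        (f₂ v.1 v.2).comp (ContinuousLinearMap.snd ℝ ℝ P) := by
    funext v
    ext <;> simp
  rw [e]
  exact ((hf₁.clm_comp continuous_const).add (hf₂.clm_comp continuous_const)).continuousOn

end ODE

/-! ### The flow of a bounded vector field -/

section Flow

variable {E : Type*} [NormedAddCommGroup E]

/-- The map `id + ζ` for a bounded continuous displacement `ζ`. -/
def shift (ζ : E →ᵇ E) : C(E, E) := ⟨fun x => x + ζ x, continuous_id.add ζ.continuous⟩

@[simp] lemma shift_apply (ζ : E →ᵇ E) (x : E) : shift ζ x = x + ζ x := rfl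

lemma continuous_uncurry_shift {ζ : ℝ → E →ᵇ E} (h : Continuous ζ) :
    Continuous fun p : ℝ × E => shift (ζ p.1) p.2 := by
  have : Continuous fun p : ℝ × E => ζ p.1 p.2 := by fun_prop
  exact continuous_snd.add this

variable [NormedSpace ℝ E]

/-- Along a differentiable curve of displacements each point moves differentiably. -/
lemma hasDerivAt_shift {ζ : ℝ → E →ᵇ E} {η : E →ᵇ E} {t : ℝ} (h : HasDerivAt ζ η t) (x : E) :
    HasDerivAt (fun t => shift (ζ t) x) (η x) t :=
  (((BoundedContinuousFunction.evalCLM ℝ x : (E →ᵇ E) →L[ℝ] E).hasFDerivAt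
    (x := ζ t)).comp_hasDerivAt t h).const_add x

/-- `ζ` is the displacement of the flow of `V`, a curve in the space of bounded continuous maps, and
`inv t` is the inverse of the time-`t` map `id + ζ t`; both are `C¹` in time and space. -/
structure IsFlow (V : ℝ → E →ᵇ E) (ζ : ℝ → E →ᵇ E) (inv : ℝ → E → E) : Prop where
  zero : ζ 0 = 0
  hasDerivAt : ∀ t, HasDerivAt ζ ((V t).compContinuous (shift (ζ t))) t
  contDiff : ContDiff ℝ 1 fun p : ℝ × E => shift (ζ p.1) p.2
  inv_shift : ∀ t x, inv t (shift (ζ t) x) = x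
  shift_inv : ∀ t x, shift (ζ t) (inv t x) = x
  contDiff_inv : ContDiff ℝ 1 (Function.uncurry inv)

lemma IsFlow.hasDerivAt_apply {V : ℝ → E →ᵇ E} {ζ : ℝ → E →ᵇ E} {inv : ℝ → E → E}
    (h : IsFlow V ζ inv) (t : ℝ) (x : E) :
    HasDerivAt (fun t => shift (ζ t) x) (V t (shift (ζ t) x)) t :=
  hasDerivAt_shift (h.hasDerivAt t) x

lemma IsFlow.continuous_disp {V : ℝ → E →ᵇ E} {ζ : ℝ → E →ᵇ E} {inv : ℝ → E → E}
    (h : IsFlow V ζ inv) : Continuous ζ :=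
  continuous_iff_continuousAt.2 fun t => (h.hasDerivAt t).continuousAt

/-- Trajectories of a Lipschitz field separate at most exponentially backward in time. -/
lemma norm_sub_le_of_trajectories {V : ℝ → E → E} {K : ℝ≥0} (hV : ∀ t, LipschitzWith K (V t))
    {y z : ℝ → E} (hy : ∀ t, HasDerivAt y (V t (y t)) t) (hz : ∀ t, HasDerivAt z (V t (z t)) t)
    {R t : ℝ} (ht : t ∈ Icc (-R) R) : ‖y 0 - z 0‖ ≤ ‖y t - z t‖ * Real.exp (K * R) := by
  have h := norm_le_of_norm_deriv_le_symm (f := fun s => y (t + s) - z (t + s)) (K := K) (ε := 0)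
    (T := R) K.2 le_rfl
    (fun s _ => ((hy (t + s)).comp_const_add t s).sub ((hz (t + s)).comp_const_add t s))
    (fun s _ => by simpa using (hV (t + s)).norm_sub_le _ _) (t := -t)
    ⟨by linarith [ht.2], by linarith [ht.1]⟩
  simpa using h

/-- A map that expands distances near a point has an injective derivative there. -/
lemma norm_le_of_antilipschitz {F : Type*} [NormedAddCommGroup F] [NormedSpace ℝ F] {f : E → F}
    {f' : E →L[ℝ] F} {a : E} {C : ℝ} (hf : HasFDerivAt f f' a)
    (h : ∀ᶠ b in 𝓝 a, ‖b - a‖ ≤ C * ‖f b - f a‖) (v : E) : ‖v‖ ≤ C * ‖f' v‖ := by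
  have h1 : HasDerivAt (fun s : ℝ => a + s • v) v 0 := by
    simpa using ((hasDerivAt_id (0 : ℝ)).smul_const v).const_add a
  have h2 : HasDerivAt (fun s : ℝ => f (a + s • v)) (f' v) 0 :=
    HasFDerivAt.comp_hasDerivAt (0 : ℝ) (by simpa using hf) h1
  rw [hasDerivAt_iff_tendsto_slope_zero] at h2
  have h3 : Tendsto (fun s : ℝ => a + s • v) (𝓝[≠] 0) (𝓝 a) := by
    have := h1.continuousAt.tendsto
    simp only [zero_smul, add_zero] at this
    exact this.mono_left nhdsWithin_le_nhds
  refine ge_of_tendsto (h2.norm.const_mul C) ?_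
  filter_upwards [h3.eventually h, self_mem_nhdsWithin] with s hs hs0
  simp only [add_sub_cancel_left, zero_add, zero_smul, add_zero, norm_smul, norm_inv] at hs ⊢
  have : 0 < ‖s‖ := norm_pos_iff.2 hs0
  rw [mul_left_comm, ← div_eq_inv_mul, le_div_iff₀ this, mul_comm]
  exact hs

variable {V : ℝ → E →ᵇ E} {V' : ℝ → E → E →L[ℝ] E} {K : ℝ≥0} {B : ℝ}

/-- Trajectories of a field bounded by `B` move with speed at most `B`. -/
lemma norm_shift_sub_le {ζ : ℝ → E →ᵇ E}
    (hζ : ∀ t x, HasDerivAt (fun t => shift (ζ t) x) (V t (shift (ζ t) x)) t)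
    (hB : ∀ t, ‖V t‖ ≤ B) (s t : ℝ) (x : E) :
    ‖shift (ζ t) x - shift (ζ s) x‖ ≤ B * |t - s| :=
  Convex.norm_image_sub_le_of_norm_hasDerivWithin_le (s := univ)
    (fun r _ => (hζ r x).hasDerivWithinAt)
    (fun r _ => ((V r).norm_coe_le_norm _).trans (hB r)) convex_univ (mem_univ s) (mem_univ t)

/-- The inverse flow is Lipschitz in time and space. -/
lemma norm_inv_sub_le {ζ : ℝ → E →ᵇ E} {inv : ℝ → E → E}
    (hζ : ∀ t x, HasDerivAt (fun t => shift (ζ t) x) (V t (shift (ζ t) x)) t) (h0 : ζ 0 = 0)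
    (hinv : ∀ t x, shift (ζ t) (inv t x) = x)
    (hK : ∀ t, LipschitzWith K (V t)) (hB : ∀ t, ‖V t‖ ≤ B) {R s t : ℝ} (ht : t ∈ Icc (-R) R)
    (x y : E) :
    ‖inv t x - inv s y‖ ≤ (‖x - y‖ + B * |t - s|) * Real.exp (K * R) := by
  have h1 := norm_sub_le_of_trajectories (V := fun t => V t) hK
    (y := fun r => shift (ζ r) (inv t x)) (z := fun r => shift (ζ r) (inv s y))
    (fun r => hζ r (inv t x)) (fun r => hζ r (inv s y)) ht
  have h2 := norm_shift_sub_le hζ hB s t (inv s y)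
  simp only [h0, hinv] at h1 h2
  simp only [shift_apply, BoundedContinuousFunction.coe_zero, Pi.zero_apply, add_zero] at h1
  refine h1.trans (mul_le_mul_of_nonneg_right ?_ (Real.exp_pos _).le)
  have h3 := norm_sub_le_norm_sub_add_norm_sub x y ((shift (ζ t)) (inv s y))
  rw [norm_sub_rev y] at h3
  exact h3.trans (add_le_add_right h2 _)

/-- A bounded, continuous vector field with bounded continuous space derivative has a `C¹` flow. -/
theorem exists_isFlow [FiniteDimensional ℝ E] (hV : Continuous V) (hB : ∀ t, ‖V t‖ ≤ B)
    (hV' : Continuous (Function.uncurry V')) (hd : ∀ t x, HasFDerivAt (V t) (V' t x) x)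
    (hK : ∀ t x, ‖V' t x‖ ≤ K) : ∃ ζ inv, IsFlow V ζ inv := by
  have : CompleteSpace E := FiniteDimensional.complete ℝ E
  have hlip : ∀ t, LipschitzWith K (V t) := fun t =>
    lipschitzWith_of_nnnorm_fderiv_le (𝕜 := ℝ) (fun x => (hd t x).differentiableAt) fun x => by
      rw [(hd t x).fderiv]; exact hK t x
  have hB0 : 0 ≤ B := (norm_nonneg _).trans (hB 0)
  have hVc : Continuous (Function.uncurry fun t x => V t x) := by
    change Continuous fun p : ℝ × E => V p.1 p.2
    fun_prop
  obtain ⟨ζ, hζ0, hζ⟩ := exists_forall_hasDerivAt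
    (F := fun t (ζ : E →ᵇ E) => (V t).compContinuous (shift ζ)) (K := K) (B := B)
    (continuous_prod_of_continuous_lipschitzWith' _ K
      (fun t => LipschitzWith.of_dist_le_mul fun ζ ζ' =>
        (BoundedContinuousFunction.dist_le (by positivity)).2 fun x => by
          refine ((hlip t).dist_le_mul _ _).trans ?_
          gcongr
          simpa using ζ.dist_coe_le_dist x)
      (fun ζ => (BoundedContinuousFunction.continuous_compContinuous (shift ζ)).comp hV))
    (fun t => LipschitzWith.of_dist_le_mul fun ζ ζ' =>
        (BoundedContinuousFunction.dist_le (by positivity)).2 fun x => by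
          refine ((hlip t).dist_le_mul _ _).trans ?_
          gcongr
          simpa using ζ.dist_coe_le_dist x)
    (fun t => (BoundedContinuousFunction.norm_le hB0).2 fun x =>
      ((V t).norm_coe_le_norm _).trans (hB t)) 0
  have hζc : Continuous ζ := continuous_iff_continuousAt.2 fun t => (hζ t).continuousAt
  have hp : ∀ t x, HasDerivAt (fun t => shift (ζ t) x) (V t (shift (ζ t) x)) t := fun t x =>
    hasDerivAt_shift (hζ t) x
  have hC1 : ContDiff ℝ 1 fun p : ℝ × E => shift (ζ p.1) p.2 :=
    contDiff_of_flow (V := fun t x => V t x) (Y := fun t x => shift (ζ t) x) hVc hV' hd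
      (continuous_uncurry_shift hζc) hp (ContinuousLinearMap.id ℝ E) (by simp [hζ0])
  -- a point is reached by following the trajectory through it backward in time
  have hsurj : ∀ t x, ∃ a, shift (ζ t) a = x := by
    intro t x
    obtain ⟨y, hy0, hy⟩ := exists_forall_hasDerivAt (F := fun s x => V (t + s) x) (K := K) (B := B)
      (hVc.comp ((continuous_const.add continuous_fst).prodMk continuous_snd))
      (fun s => hlip (t + s)) (fun s => ((V (t + s)).norm_coe_le_norm 0).trans (hB _)) x
    have h1 := ODE_solution_unique_univ (v := fun t x => V t x) (s := fun _ => univ) (t₀ := 0)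
      (f := fun r => shift (ζ r) (y (-t))) (g := fun r => y (r - t)) (K := K)
      (fun t => (hlip t).lipschitzOnWith) (fun r => ⟨hp r _, mem_univ _⟩)
      (fun r => ⟨by
        have h2 := (hy (r - t)).comp_sub_const r t
        simpa using h2, mem_univ _⟩) (by simp [hζ0])
    exact ⟨y (-t), by simpa [hy0] using congrFun h1 t⟩
  choose inv hinv using hsurj
  have hinj : ∀ t a b, shift (ζ t) a = shift (ζ t) b → a = b := by
    intro t a b hab
    have h1 := ODE_solution_unique_univ (v := fun t x => V t x) (s := fun _ => univ) (t₀ := t)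
      (f := fun r => shift (ζ r) a) (g := fun r => shift (ζ r) b) (K := K)
      (fun t => (hlip t).lipschitzOnWith) (fun r => ⟨hp r _, mem_univ _⟩)
      (fun r => ⟨hp r _, mem_univ _⟩) hab
    simpa [hζ0] using congrFun h1 0
  have hinv' : ∀ t x, inv t (shift (ζ t) x) = x := fun t x => hinj t _ _ (hinv t _)
  -- the space-time inverse is Lipschitz on bounded time intervals; this yields its continuity, and the
  -- invertibility of the derivative of the space-time flow `Θ`
  have hest : ∀ R : ℝ, ∀ p q : ℝ × E, p.1 ∈ Icc (-R) R →
      ‖(p.1, inv p.1 p.2) - (q.1, inv q.1 q.2)‖ ≤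
        (1 + B) * (1 + Real.exp (K * R)) * ‖p - q‖ := by
    intro R p q hp1
    have h1 := norm_inv_sub_le hp hζ0 hinv hlip hB hp1 p.2 q.2 (s := q.1)
    have h2 : ‖p.2 - q.2‖ ≤ ‖p - q‖ := norm_snd_le (p - q)
    have h3 : |p.1 - q.1| ≤ ‖p - q‖ := norm_fst_le (p - q)
    have h4 : ‖inv p.1 p.2 - inv q.1 q.2‖ ≤ (1 + B) * Real.exp (K * R) * ‖p - q‖ := by
      calc _ ≤ (‖p - q‖ + B * ‖p - q‖) * Real.exp (K * R) := h1.trans (by gcongr)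
        _ = _ := by ring
    have h5 := Real.exp_pos (K * R)
    have h6 := norm_nonneg (p - q)
    refine max_le ?_ ?_
    · change |p.1 - q.1| ≤ _
      refine h3.trans (le_mul_of_one_le_left h6 ?_)
      nlinarith
    · refine h4.trans ?_
      gcongr
      linarith
  have hRm : ∀ p : ℝ × E, ∀ᶠ q : ℝ × E in 𝓝 p, q.1 ∈ Icc (-(|p.1| + 1)) (|p.1| + 1) := by
    intro p
    refine continuousAt_fst.eventually (Icc_mem_nhds ?_ ?_)
    · have := neg_abs_le p.1; linarith
    · have := le_abs_self p.1; linarith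
  have hcinv : Continuous fun p : ℝ × E => (p.1, inv p.1 p.2) := by
    rw [continuous_iff_continuousAt]
    intro p
    rw [ContinuousAt, tendsto_iff_norm_sub_tendsto_zero]
    refine squeeze_zero' (Eventually.of_forall fun _ => norm_nonneg _)
      ((hRm p).mono fun q hq => hest _ q p hq) ?_
    have : Tendsto (fun q : ℝ × E => ‖q - p‖) (𝓝 p) (𝓝 0) :=
      tendsto_iff_norm_sub_tendsto_zero.1 tendsto_id
    simpa using this.const_mul ((1 + B) * (1 + Real.exp (K * (|p.1| + 1))))
  have hcsh := continuous_uncurry_shift hζc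
  let Θ : (ℝ × E) ≃ₜ (ℝ × E) :=
    { toFun := fun p => (p.1, shift (ζ p.1) p.2)
      invFun := fun p => (p.1, inv p.1 p.2)
      left_inv := fun p => by simp only [hinv']
      right_inv := fun p => by simp only [hinv]
      continuous_toFun := continuous_fst.prodMk hcsh
      continuous_invFun := hcinv }
  have hΘ : ContDiff ℝ 1 Θ := contDiff_fst.prodMk hC1
  have hΘd : ∀ p, HasFDerivAt Θ (fderiv ℝ Θ p) p := fun p =>
    (hΘ.differentiable one_ne_zero p).hasFDerivAt
  have hΘinj : ∀ p, Function.Injective (fderiv ℝ Θ p : (ℝ × E) →ₗ[ℝ] (ℝ × E)) := by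
    intro p
    rw [← LinearMap.ker_eq_bot, LinearMap.ker_eq_bot']
    intro v hv
    have h1 := norm_le_of_antilipschitz (hΘd p) (C := (1 + B) * (1 + Real.exp (K * (|p.1| + 1))))
      ((hRm p).mono fun q hq => by
        have e : ∀ q : ℝ × E, ((Θ q).1, inv (Θ q).1 (Θ q).2) = q := Θ.left_inv
        have h3 := hest (|p.1| + 1) (Θ q) (Θ p) hq
        rwa [e, e] at h3) v
    have h2 : (fderiv ℝ Θ p) v = 0 := hv
    rw [h2, norm_zero, mul_zero] at h1
    exact norm_le_zero_iff.1 h1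
  have hsymm : ContDiff ℝ 1 Θ.symm := Θ.contDiff_symm
    (f₀' := fun p => (LinearEquiv.ofInjectiveEndo _ (hΘinj p)).toContinuousLinearEquiv)
    (fun p => by
      have e : ((LinearEquiv.ofInjectiveEndo _ (hΘinj p)).toContinuousLinearEquiv :
          (ℝ × E) →L[ℝ] (ℝ × E)) = fderiv ℝ Θ p := by
        refine ContinuousLinearMap.ext fun v => ?_
        exact congrFun (LinearEquiv.coe_ofInjectiveEndo _ (hΘinj p)) v
      rw [e]
      exact hΘd p) hΘ
  exact ⟨ζ, inv, hζ0, hζ, hC1, hinv', hinv, hsymm.snd⟩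

end Flow

/-! ### Integration of Lipschitz functions against Wasserstein-close measures -/

section Measure

/-- Finite measures are determined by the integrals of compactly supported `C¹` functions: the
densities of both with respect to their sum coincide. -/
theorem measure_ext_of_integral_contDiff {E : Type*} [NormedAddCommGroup E] [NormedSpace ℝ E]
    [FiniteDimensional ℝ E] [MeasurableSpace E] [BorelSpace E] {μ ν : Measure E}
    [IsFiniteMeasure μ] [IsFiniteMeasure ν]
    (h : ∀ f : E → ℝ, ContDiff ℝ 1 f → HasCompactSupport f → ∫ x, f x ∂μ = ∫ x, f x ∂ν) :
    μ = ν := by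
  set κ := μ + ν
  have hμ : μ ≪ κ := Measure.absolutelyContinuous_of_le (Measure.le_add_right le_rfl)
  have hν : ν ≪ κ := Measure.absolutelyContinuous_of_le (Measure.le_add_left le_rfl)
  have h1 : ∀ᵐ x ∂κ, (μ.rnDeriv κ x).toReal = (ν.rnDeriv κ x).toReal := by
    refine ae_eq_of_integral_contDiff_smul_eq Measure.integrable_toReal_rnDeriv.locallyIntegrable
      Measure.integrable_toReal_rnDeriv.locallyIntegrable fun g hg hgc => ?_
    have e1 := integral_rnDeriv_smul hμ (f := g)
    have e2 := integral_rnDeriv_smul hν (f := g)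
    simp only [smul_eq_mul] at e1 e2 ⊢
    simp only [mul_comm (g _), e1, e2]
    exact h g (hg.of_le (mod_cast le_top)) hgc
  rw [← Measure.withDensity_rnDeriv_eq μ κ hμ, ← Measure.withDensity_rnDeriv_eq ν κ hν]
  refine withDensity_congr_ae ?_
  filter_upwards [h1, Measure.rnDeriv_ne_top μ κ, Measure.rnDeriv_ne_top ν κ] with x hx h2 h3
  exact (ENNReal.toReal_eq_toReal_iff' h2 h3).1 hx

variable {d : ℕ} {F : Type*} [NormedAddCommGroup F]

/-- `k` is bounded by `C` and `C`-Lipschitz. -/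
structure IsBLip (C : ℝ≥0) (k : Sp d → F) : Prop where
  bound : ∀ x, ‖k x‖ ≤ C
  lip : LipschitzWith C k

lemma IsBLip.continuous {C : ℝ≥0} {k : Sp d → F} (h : IsBLip C k) : Continuous k := h.lip.continuous

lemma integrable_of_bound {X : Type*} [TopologicalSpace X] [MeasurableSpace X] [BorelSpace X]
    [SecondCountableTopology X] {μ : Measure X} [IsFiniteMeasure μ] {f : X → F} (hf : Continuous f)
    {C : ℝ} (hC : ∀ x, ‖f x‖ ≤ C) : Integrable f μ :=
  Integrable.of_bound hf.aestronglyMeasurable C (Eventually.of_forall hC)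

variable [NormedSpace ℝ F]

/-- The difference of the integrals of a bounded Lipschitz function against two measures is
controlled by their Wasserstein distance. -/
theorem norm_integral_sub_le_W2 {C : ℝ≥0} (hC : C ≠ 0) {B : ℝ} {f : Sp d → F}
    (hf : LipschitzWith C f) (hB : ∀ x, ‖f x‖ ≤ B) {μ ν : Measure (Sp d)} [IsProbabilityMeasure μ]
    (hW : W2 μ ν ≠ ∞) : ‖(∫ x, f x ∂μ) - ∫ x, f x ∂ν‖ ≤ C * (W2 μ ν).toReal := by
  have key : ∀ π ∈ couplings μ ν, (‖(∫ x, f x ∂μ) - ∫ x, f x ∂ν‖ₑ / C) ^ (2 : ℝ) ≤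
      ∫⁻ p, ‖p.1 - p.2‖ₑ ^ 2 ∂π := by
    rintro π ⟨h1, h2⟩
    have hπ : IsProbabilityMeasure π := by
      refine ⟨?_⟩
      rw [← preimage_univ (f := Prod.fst), ← Measure.map_apply measurable_fst MeasurableSet.univ, h1]
      exact measure_univ
    have e1 : ∫ x, f x ∂μ = ∫ p, f p.1 ∂π := by
      rw [← h1, integral_map measurable_fst.aemeasurable hf.continuous.aestronglyMeasurable]
    have e2 : ∫ x, f x ∂ν = ∫ p, f p.2 ∂π := by
      rw [← h2, integral_map measurable_snd.aemeasurable hf.continuous.aestronglyMeasurable]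
    have hc1 : Continuous fun p : Sp d × Sp d => f p.1 := hf.continuous.comp continuous_fst
    have hc2 : Continuous fun p : Sp d × Sp d => f p.2 := hf.continuous.comp continuous_snd
    rw [e1, e2, ← integral_sub (integrable_of_bound hc1 fun p => hB p.1)
      (integrable_of_bound hc2 fun p => hB p.2)]
    have h3 : ‖∫ p, (f p.1 - f p.2) ∂π‖ₑ ≤ C * ∫⁻ p, ‖p.1 - p.2‖ₑ ∂π := by
      refine (enorm_integral_le_lintegral_enorm _).trans ?_
      rw [← lintegral_const_mul' _ _ ENNReal.coe_ne_top]
      refine lintegral_mono fun p => ?_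
      rw [← edist_eq_enorm_sub, ← edist_eq_enorm_sub]
      exact hf p.1 p.2
    have h4 : ∫⁻ p, ‖p.1 - p.2‖ₑ ∂π ≤ (∫⁻ p, ‖p.1 - p.2‖ₑ ^ 2 ∂π) ^ (1 / 2 : ℝ) := by
      have h5 := ENNReal.lintegral_mul_le_Lp_mul_Lq π
        (Real.HolderConjugate.two_two) (f := fun p => ‖p.1 - p.2‖ₑ)
        (g := fun _ => 1) (by fun_prop) aemeasurable_const
      simpa using h5
    have h5 : ‖∫ p, (f p.1 - f p.2) ∂π‖ₑ / C ≤ (∫⁻ p, ‖p.1 - p.2‖ₑ ^ 2 ∂π) ^ (1 / 2 : ℝ) :=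
      ENNReal.div_le_of_le_mul' (h3.trans (by gcongr))
    calc _ ≤ ((∫⁻ p, ‖p.1 - p.2‖ₑ ^ 2 ∂π) ^ (1 / 2 : ℝ)) ^ (2 : ℝ) := by gcongr
      _ = _ := by rw [← ENNReal.rpow_mul]; simp
  -- squares on the left allow passing to the infimum over couplings inside `W2`
  have h6 : (‖(∫ x, f x ∂μ) - ∫ x, f x ∂ν‖ₑ / C) ^ (2 : ℝ) ≤
      ⨅ π ∈ couplings μ ν, ∫⁻ p, ‖p.1 - p.2‖ₑ ^ 2 ∂π := le_iInf₂ key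
  have h7 : ‖(∫ x, f x ∂μ) - ∫ x, f x ∂ν‖ₑ / C ≤ W2 μ ν := by
    calc _ = ((‖(∫ x, f x ∂μ) - ∫ x, f x ∂ν‖ₑ / C) ^ (2 : ℝ)) ^ (1 / 2 : ℝ) := by
          rw [← ENNReal.rpow_mul]; simp
      _ ≤ _ := by unfold W2; gcongr
  have h8 : ‖(∫ x, f x ∂μ) - ∫ x, f x ∂ν‖ₑ ≤ C * W2 μ ν := by
    rw [mul_comm]
    exact (ENNReal.div_le_iff_le_mul (Or.inl (by simpa using hC)) (Or.inl ENNReal.coe_ne_top)).1 h7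
  have h9 := ENNReal.toReal_mono (ENNReal.mul_ne_top ENNReal.coe_ne_top hW) h8
  simpa using h9

/-- A transport map bounds the Wasserstein distance. -/
lemma W2_map_le {μ : Measure (Sp d)} [IsProbabilityMeasure μ] {f g : Sp d → Sp d}
    (hf : Continuous f) (hg : Continuous g) {D : ℝ} (h : ∀ x, ‖f x - g x‖ ≤ D) :
    W2 (μ.map f) (μ.map g) ≤ ENNReal.ofReal D := by
  have hm : Measurable fun x => (f x, g x) := (hf.prodMk hg).measurable
  have h1 : (μ.map fun x => (f x, g x)) ∈ couplings (μ.map f) (μ.map g) :=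
    ⟨by rw [Measure.map_map measurable_fst hm]; rfl,
      by rw [Measure.map_map measurable_snd hm]; rfl⟩
  have h2 : ⨅ π ∈ couplings (μ.map f) (μ.map g), ∫⁻ p, ‖p.1 - p.2‖ₑ ^ 2 ∂π ≤
      ENNReal.ofReal D ^ (2 : ℝ) := by
    refine (iInf₂_le _ h1).trans ?_
    rw [lintegral_map (by fun_prop) hm]
    calc _ ≤ ∫⁻ _, ENNReal.ofReal D ^ (2 : ℝ) ∂μ := lintegral_mono fun x => by
          have := h x
          rw [← ENNReal.rpow_two]
          gcongr
          rw [← ofReal_norm]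
          exact ENNReal.ofReal_le_ofReal this
      _ = _ := by simp
  calc W2 (μ.map f) (μ.map g) ≤ (ENNReal.ofReal D ^ (2 : ℝ)) ^ (1 / 2 : ℝ) := by
        unfold W2; gcongr
    _ = _ := by rw [← ENNReal.rpow_mul]; simp

end Measure

/-! ### Interaction fields -/

section Interaction

variable {d M : ℕ} {F : Type*} [NormedAddCommGroup F] [NormedSpace ℝ F]

/-- The field `x ↦ -(k₁ * μ)(x) - ∑ₘ k₂(x - uᵐ)` generated by kernels `k₁`, `k₂` with values in any
normed space. For `k₁ = K₁`, `k₂ = K₂` this is `velocity`; its derivatives are the fields generated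
by the derivatives of the kernels. -/
noncomputable def interaction (k1 k2 : Sp d → F) (μ : Measure (Sp d)) (u : Ctrl d M) (x : Sp d) :
    F :=
  -(∫ y, k1 (x - y) ∂μ) - ∑ m, k2 (x - u m)

lemma velocity_eq_interaction (K1 K2 : Sp d → Sp d) (μ : Measure (Sp d)) (u : Ctrl d M) :
    velocity K1 K2 μ u = interaction K1 K2 μ u := rfl

lemma norm_interaction_le {C : ℝ} {k1 k2 : Sp d → F} (h1 : ∀ x, ‖k1 x‖ ≤ C) (h2 : ∀ x, ‖k2 x‖ ≤ C)
    (μ : Measure (Sp d)) [IsProbabilityMeasure μ] (u : Ctrl d M) (x : Sp d) :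
    ‖interaction k1 k2 μ u x‖ ≤ (M + 1) * C := by
  have h3 : ‖∫ y, k1 (x - y) ∂μ‖ ≤ C := by
    simpa using norm_integral_le_of_norm_le_const (μ := μ) (Eventually.of_forall fun y => h1 (x - y))
  have h4 : ‖∑ m, k2 (x - u m)‖ ≤ M * C := by
    simpa using norm_sum_le_of_le (Finset.univ : Finset (Fin M)) (fun m _ => h2 (x - u m))
  refine (norm_sub_le _ _).trans ?_
  rw [norm_neg]
  linarith

lemma norm_interaction_sub_le {C : ℝ≥0} {k1 k2 : Sp d → F} (h1 : IsBLip C k1) (h2 : IsBLip C k2)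
    (μ ν : Measure (Sp d)) [IsProbabilityMeasure μ] (u w : Ctrl d M) (x y : Sp d) :
    ‖interaction k1 k2 μ u x - interaction k1 k2 ν w y‖ ≤
      (M + 1) * C * ‖x - y‖ + M * C * ‖u - w‖ +
        ‖(∫ z, k1 (y - z) ∂μ) - ∫ z, k1 (y - z) ∂ν‖ := by
  have hc : ∀ x, Continuous fun z => k1 (x - z) := fun x => h1.continuous.comp (by fun_prop)
  have h3 : ‖(∫ z, k1 (x - z) ∂μ) - ∫ z, k1 (y - z) ∂μ‖ ≤ C * ‖x - y‖ := by
    rw [← integral_sub (integrable_of_bound (hc x) fun z => h1.bound _)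
      (integrable_of_bound (hc y) fun z => h1.bound _)]
    have := norm_integral_le_of_norm_le_const (μ := μ) (f := fun z => k1 (x - z) - k1 (y - z))
      (C := C * ‖x - y‖) (Eventually.of_forall fun z => by
        simpa using h1.lip.norm_sub_le (x - z) (y - z))
    simpa using this
  have h4 : ‖(∑ m, k2 (x - u m)) - ∑ m, k2 (y - w m)‖ ≤ M * (C * (‖x - y‖ + ‖u - w‖)) := by
    rw [← Finset.sum_sub_distrib]
    have := norm_sum_le_of_le (Finset.univ : Finset (Fin M)) (f := fun m => k2 (x - u m) - k2 (y - w m))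
      (n := fun _ => C * (‖x - y‖ + ‖u - w‖)) (fun m _ => by
        refine (h2.lip.norm_sub_le _ _).trans ?_
        gcongr
        have e : x - u m - (y - w m) = (x - y) - (u - w) m := by
          rw [PiLp.sub_apply]; abel
        rw [e]
        exact (norm_sub_le _ _).trans (by gcongr; exact PiLp.norm_apply_le _ _))
    simpa using this
  have e : interaction k1 k2 μ u x - interaction k1 k2 ν w y =
      -((∫ z, k1 (x - z) ∂μ) - ∫ z, k1 (y - z) ∂μ) -
        ((∫ z, k1 (y - z) ∂μ) - ∫ z, k1 (y - z) ∂ν) -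
        ((∑ m, k2 (x - u m)) - ∑ m, k2 (y - w m)) := by
    unfold interaction; abel
  rw [e]
  refine (norm_sub_le _ _).trans ?_
  have h5 := norm_sub_le (-((∫ z, k1 (x - z) ∂μ) - ∫ z, k1 (y - z) ∂μ))
    ((∫ z, k1 (y - z) ∂μ) - ∫ z, k1 (y - z) ∂ν)
  rw [norm_neg] at h5
  linarith

lemma lipschitzWith_interaction {C : ℝ≥0} {k1 k2 : Sp d → F} (h1 : IsBLip C k1) (h2 : IsBLip C k2)
    (μ : Measure (Sp d)) [IsProbabilityMeasure μ] (u : Ctrl d M) :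
    LipschitzWith ((M + 1) * C) (interaction k1 k2 μ u) :=
  LipschitzWith.of_dist_le_mul fun x y => by
    simpa [dist_eq_norm] using norm_interaction_sub_le h1 h2 μ μ u u x y

lemma hasFDerivAt_interaction {C : ℝ} {k1 k2 : Sp d → F} {k1' k2' : Sp d → Sp d →L[ℝ] F}
    (hk1 : ∀ x, HasFDerivAt k1 (k1' x) x) (hk2 : ∀ x, HasFDerivAt k2 (k2' x) x)
    (hc1 : Continuous k1') (hb : ∀ x, ‖k1 x‖ ≤ C) (hb' : ∀ x, ‖k1' x‖ ≤ C)
    (μ : Measure (Sp d)) [IsProbabilityMeasure μ] (u : Ctrl d M) (x : Sp d) :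
    HasFDerivAt (interaction k1 k2 μ u) (interaction k1' k2' μ u x) x := by
  have hk1c : Continuous k1 := continuous_iff_continuousAt.2 fun x => (hk1 x).continuousAt
  have hs : ∀ y x : Sp d, HasFDerivAt (fun x => x - y) (ContinuousLinearMap.id ℝ (Sp d)) x :=
    fun y x => (hasFDerivAt_id x).sub_const y
  have h1 : HasFDerivAt (fun x => ∫ y, k1 (x - y) ∂μ) (∫ y, k1' (x - y) ∂μ) x := by
    refine hasFDerivAt_integral_of_dominated_of_fderiv_le (s := univ) (bound := fun _ => C)
      (F' := fun z y => k1' (z - y))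
      univ_mem (Eventually.of_forall fun z => ?_) ?_ ?_ (Eventually.of_forall fun y z _ => hb' _)
      (integrable_const C) (Eventually.of_forall fun y z _ => ?_)
    · exact (hk1c.comp (by fun_prop : Continuous fun y => z - y)).aestronglyMeasurable
    · exact integrable_of_bound (hk1c.comp (by fun_prop : Continuous fun y => x - y)) fun y => hb _
    · exact (hc1.comp (by fun_prop : Continuous fun y => x - y)).aestronglyMeasurable
    · exact (hk1 (z - y)).comp z (hs y z)
  have h2 : HasFDerivAt (fun x => ∑ m, k2 (x - u m)) (∑ m, k2' (x - u m)) x :=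
    HasFDerivAt.fun_sum fun m _ => (hk2 (x - u m)).comp x (hs (u m) x)
  exact h1.neg.sub h2

lemma interaction_map {k1 k2 : Sp d → F} (hk1 : Continuous k1) (μ : Measure (Sp d))
    {f : Sp d → Sp d} (hf : Continuous f) (u : Ctrl d M) (x : Sp d) :
    interaction k1 k2 (μ.map f) u x = -(∫ y, k1 (x - f y) ∂μ) - ∑ m, k2 (x - u m) := by
  have hc : Continuous fun y => k1 (x - y) := hk1.comp (by fun_prop)
  rw [interaction, integral_map hf.aemeasurable hc.aestronglyMeasurable]

/-- `K ∈ C_b²` with all bounds given by one constant. -/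
structure IsKernel (C : ℝ≥0) (K : Sp d → Sp d) : Prop where
  contDiff : ContDiff ℝ 2 K
  blip : IsBLip C K
  blip_fderiv : IsBLip C (fderiv ℝ K)
  bound_fderiv₂ : ∀ x, ‖fderiv ℝ (fderiv ℝ K) x‖ ≤ C

lemma IsKernel.contDiff_fderiv {C : ℝ≥0} {K : Sp d → Sp d} (h : IsKernel C K) :
    ContDiff ℝ 1 (fderiv ℝ K) := h.contDiff.fderiv_right (by norm_num)

lemma IsKernel.hasFDerivAt {C : ℝ≥0} {K : Sp d → Sp d} (h : IsKernel C K) (x : Sp d) :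
    HasFDerivAt K (fderiv ℝ K x) x := (h.contDiff.differentiable (by norm_num) x).hasFDerivAt

lemma IsKernel.hasFDerivAt_fderiv {C : ℝ≥0} {K : Sp d → Sp d} (h : IsKernel C K) (x : Sp d) :
    HasFDerivAt (fderiv ℝ K) (fderiv ℝ (fderiv ℝ K) x) x :=
  (h.contDiff_fderiv.differentiable (by norm_num) x).hasFDerivAt

/-- The second-order Taylor estimate. -/
lemma IsKernel.taylor {C : ℝ≥0} {K : Sp d → Sp d} (h : IsKernel C K) (x y : Sp d) :
    ‖K y - K x - fderiv ℝ K x (y - x)‖ ≤ C * ‖y - x‖ ^ 2 := by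
  have h1 := Convex.norm_image_sub_le_of_norm_hasFDerivWithin_le' (s := segment ℝ x y) (f := K)
    (f' := fderiv ℝ K) (φ := fderiv ℝ K x) (C := C * ‖y - x‖)
    (fun z _ => (h.hasFDerivAt z).hasFDerivWithinAt)
    (fun z hz => (h.blip_fderiv.lip.norm_sub_le z x).trans (by
      gcongr
      simpa using norm_sub_le_of_mem_segment hz))
    (convex_segment x y) (left_mem_segment ℝ x y) (right_mem_segment ℝ x y)
  calc _ ≤ _ := h1
    _ = _ := by ring

/-- All sufficiently large constants serve, so that two kernels can share one. -/
lemma exists_isKernel {K : Sp d → Sp d} (h : IsCb 2 K) :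
    ∃ C₀ : ℝ≥0, ∀ C, C₀ ≤ C → IsKernel C K := by
  obtain ⟨hc, hb⟩ := h
  obtain ⟨c0, h0⟩ := hb 0 (by norm_num)
  obtain ⟨c1, h1⟩ := hb 1 (by norm_num)
  obtain ⟨c2, h2⟩ := hb 2 (by norm_num)
  have hc : ContDiff ℝ 2 K := hc
  refine ⟨(max c0 (max c1 c2)).toNNReal, fun C hC => ?_⟩
  have hC' : max c0 (max c1 c2) ≤ C := Real.toNNReal_le_iff_le_coe.1 hC
  have e0 : ∀ x, ‖K x‖ ≤ C := fun x => by
    have := h0 x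
    rw [norm_iteratedFDeriv_zero] at this
    exact this.trans ((le_max_left _ _).trans hC')
  have e1 : ∀ x, ‖fderiv ℝ K x‖ ≤ C := fun x => by
    have := h1 x
    rw [norm_iteratedFDeriv_one] at this
    exact this.trans (((le_max_left _ _).trans (le_max_right _ _)).trans hC')
  have e2 : ∀ x, ‖fderiv ℝ (fderiv ℝ K) x‖ ≤ C := fun x => by
    have := h2 x
    rw [← norm_iteratedFDeriv_fderiv, norm_iteratedFDeriv_one] at this
    exact this.trans (((le_max_right _ _).trans (le_max_right _ _)).trans hC')
  have hc1 : ContDiff ℝ 1 (fderiv ℝ K) := hc.fderiv_right (by norm_num)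
  exact ⟨hc, ⟨e0, lipschitzWith_of_nnnorm_fderiv_le (𝕜 := ℝ) (hc.differentiable (by norm_num)) e1⟩,
    ⟨e1, lipschitzWith_of_nnnorm_fderiv_le (𝕜 := ℝ) (hc1.differentiable (by norm_num)) e2⟩, e2⟩

end Interaction

/-! ### Admissible curves are transported by their own flow -/

section Identification

variable {d M : ℕ} {T : ℝ}

/-- The retraction of `ℝ` onto `[0, T]`; it extends data on `[0, T]` to all times. -/
noncomputable def clamp (T t : ℝ) : ℝ := max 0 (min t T)

@[fun_prop] lemma continuous_clamp : Continuous (clamp T) := by unfold clamp; fun_prop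

lemma clamp_mem (hT : 0 ≤ T) (t : ℝ) : clamp T t ∈ Icc 0 T :=
  ⟨le_max_left _ _, max_le hT (min_le_right _ _)⟩

lemma clamp_of_mem {t : ℝ} (ht : t ∈ Icc 0 T) : clamp T t = t := by
  rw [clamp, min_eq_left ht.2, max_eq_right ht.1]

lemma continuous_evalAt_clamp {F : Type*} [TopologicalSpace F] [Zero F] (hT : 0 ≤ T)
    (u : C(Icc (0 : ℝ) T, F)) : Continuous fun t => evalAt u (clamp T t) := by
  have e : (fun t => evalAt u (clamp T t)) = fun t => u ⟨clamp T t, clamp_mem hT t⟩ := by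
    funext t
    rw [evalAt, dif_pos (clamp_mem hT t)]
  rw [e]
  exact u.continuous.comp (continuous_clamp.subtype_mk _)

/-- The integrand of the weak continuity equation is a directional derivative in space-time. -/
lemma deriv_add_inner_gradient {φ : ℝ → Sp d → ℝ} (hφ : ContDiff ℝ 1 (Function.uncurry φ))
    (t : ℝ) (x w : Sp d) : deriv (fun s => φ s x) t + inner ℝ w (∇ (φ t) x) =
      fderiv ℝ (Function.uncurry φ) (t, x) (1, w) := by
  have hF := (hφ.differentiable one_ne_zero (t, x)).hasFDerivAt
  have h2 : HasDerivAt (fun s => φ s x) (fderiv ℝ (Function.uncurry φ) (t, x) (1, 0)) t :=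
    HasFDerivAt.comp_hasDerivAt (f := fun s => (s, x)) t hF
      ((hasDerivAt_id' t).prodMk (hasDerivAt_const t x))
  have h3 := hF.comp x (hasFDerivAt_prodMk_right t x)
  change HasFDerivAt (φ t) _ x at h3
  rw [h2.deriv, inner_gradient_right, h3.fderiv]
  simp only [ContinuousLinearMap.coe_comp, Function.comp_apply, ContinuousLinearMap.inr_apply,
    conj_trivial, ← map_add, Prod.mk_add_mk, add_zero, zero_add]

/-- The chain rule along a curve, in the form of the weak continuity equation. -/
lemma hasDerivAt_along {φ : ℝ → Sp d → ℝ} (hφ : ContDiff ℝ 1 (Function.uncurry φ))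
    {γ : ℝ → Sp d} {w : Sp d} {t : ℝ} (hγ : HasDerivAt γ w t) :
    HasDerivAt (fun s => φ s (γ s))
      (deriv (fun s => φ s (γ t)) t + inner ℝ w (∇ (φ t) (γ t))) t := by
  rw [deriv_add_inner_gradient hφ]
  exact HasFDerivAt.comp_hasDerivAt (f := fun s => (s, γ s)) t
    (hφ.differentiable one_ne_zero (t, γ t)).hasFDerivAt ((hasDerivAt_id' t).prodMk hγ)

lemma tendsto_W2_clamp (hT : 0 ≤ T) {μ : ℝ → Measure (Sp d)} (hμ : IsContinuousP2Curve T μ)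
    (t : ℝ) : Tendsto (fun s => (W2 (μ (clamp T s)) (μ (clamp T t))).toReal) (𝓝 t) (𝓝 0) ∧
      ∀ᶠ s in 𝓝 t, W2 (μ (clamp T s)) (μ (clamp T t)) ≠ ∞ := by
  have h1 : Tendsto (clamp T) (𝓝 t) (𝓝[Icc 0 T] (clamp T t)) :=
    tendsto_nhdsWithin_iff.2 ⟨continuous_clamp.tendsto t, Eventually.of_forall (clamp_mem hT)⟩
  have h2 := (hμ.continuous _ (clamp_mem hT t)).comp h1
  refine ⟨(ENNReal.tendsto_toReal ENNReal.zero_ne_top).comp h2, ?_⟩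
  filter_upwards [h2.eventually (gt_mem_nhds ENNReal.zero_lt_top)] with s hs
  exact hs.ne

/-- The modulus of continuity in time of a field generated by a Wasserstein-continuous curve. -/
lemma exists_modulus_interaction {F : Type*} [NormedAddCommGroup F] [NormedSpace ℝ F]
    (hT : 0 ≤ T) {C : ℝ≥0} (hC : C ≠ 0) {k1 k2 : Sp d → F}
    (h1 : IsBLip C k1) (h2 : IsBLip C k2) {μ : ℝ → Measure (Sp d)} (hμ : IsContinuousP2Curve T μ)
    {u : ℝ → Ctrl d M} (hu : Continuous u) (t : ℝ) :
    ∃ b : ℝ → ℝ, Tendsto b (𝓝 t) (𝓝 0) ∧ ∀ᶠ s in 𝓝 t, ∀ x y,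
      ‖interaction k1 k2 (μ (clamp T s)) (u s) x - interaction k1 k2 (μ (clamp T t)) (u t) y‖ ≤
        (M + 1) * C * ‖x - y‖ + b s := by
  obtain ⟨hw, hw'⟩ := tendsto_W2_clamp hT hμ t
  refine ⟨fun s => M * C * ‖u s - u t‖ + C * (W2 (μ (clamp T s)) (μ (clamp T t))).toReal, ?_, ?_⟩
  · have h3 : Tendsto (fun s => ‖u s - u t‖) (𝓝 t) (𝓝 0) :=
      tendsto_iff_norm_sub_tendsto_zero.1 (hu.tendsto t)
    simpa using (h3.const_mul (M * C : ℝ)).add (hw.const_mul (C : ℝ))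
  · filter_upwards [hw'] with s hs x y
    have := (hμ.mem_P2 _ (clamp_mem hT s)).isProbabilityMeasure
    refine (norm_interaction_sub_le h1 h2 _ _ _ _ x y).trans ?_
    rw [add_assoc]
    gcongr
    refine norm_integral_sub_le_W2 hC (B := C) ?_ (fun z => h1.bound _) hs
    exact LipschitzWith.of_dist_le_mul fun z z' => by
      refine (h1.lip.dist_le_mul _ _).trans_eq ?_
      rw [dist_sub_left]

/-- The velocity field of a Wasserstein-continuous curve, extended to all times, has a flow. -/
theorem exists_isFlow_velocity (hT : 0 ≤ T) {C : ℝ≥0} (hC : C ≠ 0) {K1 K2 : Sp d → Sp d}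
    (h1 : IsKernel C K1) (h2 : IsKernel C K2) {μ : ℝ → Measure (Sp d)}
    (hμ : IsContinuousP2Curve T μ) {u : ℝ → Ctrl d M} (hu : Continuous u) :
    ∃ (V ζ : ℝ → Sp d →ᵇ Sp d) (inv : ℝ → Sp d → Sp d),
      (∀ t x, V t x = velocity K1 K2 (μ (clamp T t)) (u t) x) ∧ IsFlow V ζ inv := by
  have hp := fun t => (hμ.mem_P2 _ (clamp_mem hT t)).isProbabilityMeasure
  let V : ℝ → Sp d →ᵇ Sp d := fun t => BoundedContinuousFunction.ofNormedAddCommGroup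
    (velocity K1 K2 (μ (clamp T t)) (u t))
    (have := hp t; (lipschitzWith_interaction h1.blip h2.blip _ _).continuous) ((M + 1) * C)
    (have := hp t; norm_interaction_le h1.blip.bound h2.blip.bound _ _)
  have hVB : ∀ t, ‖V t‖ ≤ (M + 1) * C := fun t =>
    BoundedContinuousFunction.norm_ofNormedAddCommGroup_le _ (by positivity) _
  have hVc : Continuous V := by
    rw [continuous_iff_continuousAt]
    intro t
    obtain ⟨b, hb, hb'⟩ := exists_modulus_interaction hT hC h1.blip h2.blip hμ hu t
    rw [ContinuousAt, tendsto_iff_norm_sub_tendsto_zero]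
    refine squeeze_zero' (Eventually.of_forall fun _ => norm_nonneg _) (hb'.mono fun s hs => ?_) hb
    have hs0 : 0 ≤ b s := by simpa using (norm_nonneg _).trans (hs 0 0)
    refine (BoundedContinuousFunction.norm_le hs0).2 fun x => ?_
    have h3 := hs x x
    rw [sub_self, norm_zero, mul_zero, zero_add] at h3
    exact h3
  have hDc : Continuous (Function.uncurry fun t x =>
      interaction (fderiv ℝ K1) (fderiv ℝ K2) (μ (clamp T t)) (u t) x) := by
    rw [continuous_iff_continuousAt]
    rintro ⟨t, x⟩
    obtain ⟨b, hb, hb'⟩ := exists_modulus_interaction hT hC h1.blip_fderiv h2.blip_fderiv hμ hu t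
    rw [ContinuousAt, tendsto_iff_norm_sub_tendsto_zero]
    refine squeeze_zero' (Eventually.of_forall fun _ => norm_nonneg _)
      ((continuousAt_fst.eventually hb').mono fun p hp => hp p.2 x) ?_
    have h3 : Tendsto (fun p : ℝ × Sp d => ‖p.2 - x‖) (𝓝 (t, x)) (𝓝 0) :=
      tendsto_iff_norm_sub_tendsto_zero.1 (continuous_snd.tendsto (t, x))
    simpa using (h3.const_mul ((M + 1) * C : ℝ)).add (hb.comp (continuous_fst.tendsto (t, x)))
  obtain ⟨ζ, inv, hζ⟩ := exists_isFlow (V := V) (K := (M + 1) * C) hVc hVB hDc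
    (fun t x => by
      have := hp t
      exact hasFDerivAt_interaction (C := C) h1.hasFDerivAt h2.hasFDerivAt
        h1.blip_fderiv.continuous h1.blip.bound h1.blip_fderiv.bound _ _ x)
    (fun t x => by
      have := hp t
      exact_mod_cast norm_interaction_le h1.blip_fderiv.bound h2.blip_fderiv.bound _ _ x)
  exact ⟨V, ζ, inv, fun _ _ => rfl, hζ⟩

/-- A weak form of `M' = 0`: testing with the primitive of `M - M 0` gives `∫ (M - M 0)² = 0`. -/
lemma eq_of_forall_integral_deriv_mul {T : ℝ} (hT : 0 < T) {m : ℝ → ℝ} (hm : Continuous m)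
    (h : ∀ η : ℝ → ℝ, ContDiff ℝ 1 η → HasCompactSupport η →
      η T * m T - η 0 * m 0 - ∫ t in (0)..T, deriv η t * m t = 0) :
    ∀ t ∈ Icc 0 T, m t = m 0 := by
  -- a cutoff equal to `1` near `[0, T]` makes the test functions compactly supported
  let b : ContDiffBump (0 : ℝ) := ⟨T + 1, T + 2, by linarith, by linarith⟩
  have hb1 : ∀ t ∈ Ioo (-1) (T + 1), b t = 1 := fun t ht => b.one_of_mem_closedBall (by
    change dist t 0 ≤ T + 1
    rw [dist_zero_right, Real.norm_eq_abs, abs_le]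
    constructor <;> linarith [ht.1, ht.2])
  have hbc : ContDiff ℝ 1 b := b.contDiff
  let χ : ℝ → ℝ := fun t => ∫ s in (0)..t, (m s - m 0)
  have hc : Continuous fun s => m s - m 0 := hm.sub continuous_const
  have hχ : ∀ t, HasDerivAt χ (m t - m 0) t := fun t =>
    intervalIntegral.integral_hasDerivAt_right (hc.intervalIntegrable _ _)
      hc.aestronglyMeasurable.stronglyMeasurableAtFilter hc.continuousAt
  have hχc : ContDiff ℝ 1 χ := by
    rw [contDiff_one_iff_deriv]
    refine ⟨fun t => (hχ t).differentiableAt, ?_⟩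
    rw [funext fun t => (hχ t).deriv]
    exact hc
  have hloc : ∀ ψ : ℝ → ℝ, ∀ t ∈ Icc 0 T, deriv (fun t => b t * ψ t) t = deriv ψ t := by
    intro ψ t ht
    refine Filter.EventuallyEq.deriv_eq ?_
    filter_upwards [Ioo_mem_nhds (show -1 < t by linarith [ht.1]) (show t < T + 1 by linarith [ht.2])]
      with s hs
    rw [hb1 s hs, one_mul]
  have h0T : (0 : ℝ) ∈ Ioo (-1) (T + 1) := by constructor <;> linarith
  have hTT : T ∈ Ioo (-1) (T + 1) := by constructor <;> linarith
  have key : ∀ ψ ψ' : ℝ → ℝ, ContDiff ℝ 1 ψ → (∀ t, deriv ψ t = ψ' t) →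
      ψ T * m T - ψ 0 * m 0 - ∫ t in (0)..T, ψ' t * m t = 0 := by
    intro ψ ψ' hψ hψ'
    have h1 := h (fun t => b t * ψ t) (hbc.mul hψ) b.hasCompactSupport.mul_right
    rw [hb1 T hTT, hb1 0 h0T, one_mul, one_mul] at h1
    refine Eq.trans ?_ h1
    congr 1
    refine intervalIntegral.integral_congr fun t ht => ?_
    rw [uIcc_of_le hT.le] at ht
    simp only [hloc ψ t ht, hψ']
  -- testing with `1` gives `m T = m 0`; testing with `χ` gives the integral of the square
  have e1 := key (fun _ => 1) (fun _ => 0) contDiff_const (by simp)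
  have e2 := key χ (fun t => m t - m 0) hχc fun t => (hχ t).deriv
  have e3 : χ 0 = 0 := by simp only [χ, intervalIntegral.integral_same]
  have e4 : m T = m 0 := by simpa [sub_eq_zero] using e1
  have e5 : ∫ t in (0)..T, (m t - m 0) ^ 2 = 0 := by
    have e6 : ∫ t in (0)..T, (m t - m 0) ^ 2 =
        (∫ t in (0)..T, (m t - m 0) * m t) - (∫ t in (0)..T, (m t - m 0)) * m 0 := by
      rw [← intervalIntegral.integral_mul_const, ← intervalIntegral.integral_sub
        (Continuous.intervalIntegrable (by fun_prop) _ _)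
        (Continuous.intervalIntegrable (by fun_prop) _ _)]
      refine intervalIntegral.integral_congr fun t _ => ?_
      ring
    change (∫ t in (0)..T, (m t - m 0)) * m T - χ 0 * m 0 - _ = 0 at e2
    rw [e3, e4] at e2
    rw [e6]
    linarith
  rw [intervalIntegral.integral_of_le hT.le, ← integral_Icc_eq_integral_Ioc,
    integral_eq_zero_iff_of_nonneg (fun t => sq_nonneg _)
      ((hc.pow 2).continuousOn.integrableOn_compact isCompact_Icc)] at e5
  have e7 := Measure.eqOn_Icc_of_ae_eq volume hT.ne e5 (hc.pow 2).continuousOn continuousOn_const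
  intro t ht
  have := e7 ht
  simpa [sub_eq_zero] using this

/-- An admissible curve is the transport of the initial measure by the flow of its velocity
field: for a test function `f`, the function `f ∘ Z_t⁻¹` is constant along trajectories, so
`∫ f ∘ Z_t⁻¹ dμ_t` does not depend on `t`. -/
theorem IsAdmissible.eq_map (hT : 0 < T) {C : ℝ≥0} (hC : C ≠ 0) {K1 K2 : Sp d → Sp d}
    (h1 : IsKernel C K1) (h2 : IsKernel C K2) {μhat : Measure (Sp d)} {uhat : Ctrl d M}
    {μ : ℝ → Measure (Sp d)} {u : H1 T (Ctrl d M)} (hadm : IsAdmissible T K1 K2 μhat uhat μ u)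
    {V ζ : ℝ → Sp d →ᵇ Sp d} {inv : ℝ → Sp d → Sp d}
    (hV : ∀ t x, V t x = velocity K1 K2 (μ (clamp T t)) (evalAt u.1 (clamp T t)) x)
    (hζ : IsFlow V ζ inv) {t : ℝ} (ht : t ∈ Icc 0 T) : μ t = μhat.map (shift (ζ t)) := by
  have hμ := hadm.curve
  have hp := fun t => (hμ.mem_P2 _ (clamp_mem hT.le t)).isProbabilityMeasure
  have hp0 : IsProbabilityMeasure μhat := by
    rw [← hadm.initial]; exact (hμ.mem_P2 0 ⟨le_rfl, hT.le⟩).isProbabilityMeasure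
  have hVe : ∀ t, ⇑(V t) = interaction K1 K2 (μ (clamp T t)) (evalAt u.1 (clamp T t)) :=
    fun t => funext (hV t)
  have hVl : ∀ t, LipschitzWith ((M + 1) * C) (V t) := fun t => by
    have := hp t
    rw [hVe]; exact lipschitzWith_interaction h1.blip h2.blip _ _
  have hVB : ∀ t, ‖V t‖ ≤ (M + 1) * C := fun t => by
    have := hp t
    refine (BoundedContinuousFunction.norm_le (by positivity)).2 fun x => ?_
    rw [hVe]; exact norm_interaction_le h1.blip.bound h2.blip.bound _ _ _
  have hinvc : Continuous (Function.uncurry inv) := hζ.contDiff_inv.continuous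
  have hinvt : ∀ t, Continuous (inv t) := fun t => hinvc.comp (continuous_const.prodMk continuous_id)
  -- equivalently, the pull-back of `μ t` to the labels is the initial measure
  suffices hs : (μ t).map (inv t) = μhat by
    rw [← hs, Measure.map_map (shift (ζ t)).continuous.measurable (hinvt t).measurable]
    have : (shift (ζ t)) ∘ inv t = id := funext fun x => hζ.shift_inv t x
    rw [this, Measure.map_id]
  have hpt : IsProbabilityMeasure (μ t) := (hμ.mem_P2 t ht).isProbabilityMeasure
  have hpm : IsProbabilityMeasure ((μ t).map (inv t)) :=
    Measure.isProbabilityMeasure_map (hinvt t).aemeasurable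
  refine measure_ext_of_integral_contDiff fun f hf hfc => ?_
  rw [integral_map (hinvt t).aemeasurable hf.continuous.aestronglyMeasurable]
  obtain ⟨L, hL⟩ := hf.lipschitzWith_of_hasCompactSupport hfc one_ne_zero
  obtain ⟨Bf, hBf⟩ := hf.continuous.bounded_above_of_compact_support hfc
  let m : ℝ → ℝ := fun t => ∫ x, f (inv (clamp T t) x) ∂μ (clamp T t)
  have hm : Continuous m := by
    rw [continuous_iff_continuousAt]
    intro s
    obtain ⟨hw, hw'⟩ := tendsto_W2_clamp hT.le hμ s
    set G : ℝ≥0 := (L + 1) * ⟨Real.exp (((M + 1) * C : ℝ≥0) * T), (Real.exp_pos _).le⟩ with hG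
    have hGv : (G : ℝ) = (L + 1) * Real.exp (((M + 1) * C : ℝ≥0) * T) := rfl
    have hG0 : G ≠ 0 := by
      rw [← NNReal.coe_ne_zero, hGv]; positivity
    have hest : ∀ r r' x y, ‖f (inv (clamp T r) x) - f (inv (clamp T r') y)‖ ≤
        G * (‖x - y‖ + (M + 1) * C * |clamp T r - clamp T r'|) := by
      intro r r' x y
      have h3 := norm_inv_sub_le (fun t x => hζ.hasDerivAt_apply t x) hζ.zero hζ.shift_inv hVl hVB
        (R := T) (s := clamp T r') (t := clamp T r)
        ⟨by linarith [(clamp_mem hT.le r).1], (clamp_mem hT.le r).2⟩ x y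
      refine (hL.norm_sub_le _ _).trans ?_
      rw [hGv]
      calc _ ≤ (L + 1 : ℝ) * ‖inv (clamp T r) x - inv (clamp T r') y‖ := by gcongr; simp
        _ ≤ (L + 1 : ℝ) * _ := mul_le_mul_of_nonneg_left h3 (by positivity)
        _ = _ := by ring
    rw [ContinuousAt, tendsto_iff_norm_sub_tendsto_zero]
    refine squeeze_zero' (g := fun r => G * ((M + 1) * C * |clamp T r - clamp T s|) +
      G * (W2 (μ (clamp T r)) (μ (clamp T s))).toReal)
      (Eventually.of_forall fun _ => norm_nonneg _) (hw'.mono fun r hr => ?_) ?_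
    · have := hp r
      have hcf : ∀ r, Continuous fun x => f (inv (clamp T r) x) := fun r =>
        hf.continuous.comp (hinvt _)
      have h4 := norm_integral_sub_le_W2 hG0 (f := fun x => f (inv (clamp T s) x)) (B := Bf)
        (LipschitzWith.of_dist_le_mul fun x y => by
          simpa [dist_eq_norm] using hest s s x y) (fun x => hBf _) hr
      have h5 : ‖m r - ∫ x, f (inv (clamp T s) x) ∂μ (clamp T r)‖ ≤
          G * ((M + 1) * C * |clamp T r - clamp T s|) := by
        rw [← integral_sub (integrable_of_bound (hcf r) fun x => hBf _)
          (integrable_of_bound (hcf s) fun x => hBf _)]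
        have := norm_integral_le_of_norm_le_const (μ := μ (clamp T r))
          (f := fun x => f (inv (clamp T r) x) - f (inv (clamp T s) x))
          (Eventually.of_forall fun x => by simpa using hest r s x x)
        simpa using this
      exact (norm_sub_le_norm_sub_add_norm_sub _ _ _).trans (add_le_add h5 h4)
    · have h6 : Tendsto (fun r => |clamp T r - clamp T s|) (𝓝 s) (𝓝 0) :=
        tendsto_iff_norm_sub_tendsto_zero.1 (continuous_clamp.tendsto s)
      simpa using ((h6.const_mul ((M + 1) * C : ℝ)).const_mul (G : ℝ)).add (hw.const_mul (G : ℝ))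
  have hm0 : m 0 = ∫ x, f x ∂μhat := by
    have e : ∀ x, inv 0 x = x := fun x => by simpa [hζ.zero] using hζ.inv_shift 0 x
    simp only [m, clamp_of_mem (left_mem_Icc.2 hT.le), e, hadm.initial]
  have hmt : m t = ∫ x, f (inv t x) ∂μ t := by simp only [m, clamp_of_mem ht]
  rw [← hm0, ← hmt]
  -- the test function `η(t) f(Z_t⁻¹ x)` has material derivative `η'(t) f(Z_t⁻¹ x)`
  refine eq_of_forall_integral_deriv_mul hT hm (fun η hη hηc => ?_) t ht
  let φ : ℝ → Sp d → ℝ := fun t x => η t * f (inv t x)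
  have hφ : ContDiff ℝ 1 (Function.uncurry φ) :=
    (hη.comp contDiff_fst).mul (hf.comp hζ.contDiff_inv)
  have hφc : HasCompactSupport (Function.uncurry φ) := by
    refine HasCompactSupport.intro (((hηc.isCompact.prod hfc.isCompact).image
      (continuous_fst.prodMk hζ.contDiff.continuous))) fun p hp => ?_
    by_contra hne
    have hne' : η p.1 * f (inv p.1 p.2) ≠ 0 := hne
    refine hp ⟨(p.1, inv p.1 p.2), ⟨?_, ?_⟩, ?_⟩
    · exact subset_tsupport _ (left_ne_zero_of_mul hne')
    · exact subset_tsupport _ (right_ne_zero_of_mul hne')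
    · exact Prod.ext rfl (hζ.shift_inv _ _)
  have hst := hadm.state φ hφ hφc
  rw [stateResidual] at hst
  have e1 : ∫ x, φ T x ∂μ T = η T * m T := by
    simp only [φ, m, clamp_of_mem (right_mem_Icc.2 hT.le), integral_const_mul]
  have e2 : ∫ x, φ 0 x ∂μhat = η 0 * m 0 := by
    simp only [φ, m, clamp_of_mem (left_mem_Icc.2 hT.le), integral_const_mul, hadm.initial]
  rw [e1, e2] at hst
  refine Eq.trans ?_ hst
  congr 1
  refine intervalIntegral.integral_congr fun s hs => ?_
  rw [uIcc_of_le hT.le] at hs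
  simp only [m, clamp_of_mem hs, ← integral_const_mul]
  refine integral_congr_ae (Eventually.of_forall fun x => ?_)
  have h3 := hasDerivAt_along hφ (hζ.hasDerivAt_apply s (inv s x))
  have h4 : HasDerivAt (fun r => φ r (shift (ζ r) (inv s x))) (deriv η s * f (inv s x)) s := by
    simp only [φ, hζ.inv_shift]
    exact (hη.differentiable one_ne_zero s).hasDerivAt.mul_const _
  have h5 := h4.unique h3
  rw [hζ.shift_inv, hV, clamp_of_mem hs] at h5
  exact h5

end Identification

/-! ### The mean-field flow and its linearization -/

section MeanField

variable {d M : ℕ} {C : ℝ≥0} {K1 K2 : Sp d → Sp d}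

/-- The mean-field vector field on displacements: the particle that started at `x` moves with the
velocity generated by the transported measure `(id + ζ)_* μ` and the control `w`. -/
noncomputable def meanField (h1 : IsKernel C K1) (h2 : IsKernel C K2) (μ : Measure (Sp d))
    [IsProbabilityMeasure μ] (w : Ctrl d M) (ζ : Sp d →ᵇ Sp d) : Sp d →ᵇ Sp d :=
  have := Measure.isProbabilityMeasure_map (μ := μ) (shift ζ).continuous.aemeasurable
  BoundedContinuousFunction.ofNormedAddCommGroup
    (fun x => velocity K1 K2 (μ.map (shift ζ)) w (shift ζ x))
    ((lipschitzWith_interaction h1.blip h2.blip _ _).continuous.comp (shift ζ).continuous)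
    ((M + 1) * C) fun _ => norm_interaction_le h1.blip.bound h2.blip.bound _ _ _

/-- The linearized interaction `-∫ DK₁(a - b(y)) (q - φ(y)) dμ(y) - ∑ₘ DK₂(a - wᵐ) (q - hᵐ)` felt
at `a` by a particle displaced by `q`, the other particles and the controls being displaced by
`φ` and `h`. -/
noncomputable def linInteraction (K1 K2 : Sp d → Sp d) (μ : Measure (Sp d)) (b φ : Sp d → Sp d)
    (w h : Ctrl d M) (a q : Sp d) : Sp d :=
  -(∫ y, fderiv ℝ K1 (a - b y) (q - φ y) ∂μ) - ∑ m, fderiv ℝ K2 (a - w m) (q - h m)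

lemma IsBLip.norm_apply_sub_le {k : Sp d → Sp d →L[ℝ] Sp d} (h : IsBLip C k) (p p' q q' : Sp d) :
    ‖k p q - k p' q'‖ ≤ C * (‖p - p'‖ * ‖q'‖ + ‖q - q'‖) := by
  have e : k p q - k p' q' = k p (q - q') + (k p - k p') q' := by
    rw [map_sub, sub_apply]; abel
  rw [e]
  refine (norm_add_le _ _).trans ?_
  have h3 := (k p).le_of_opNorm_le (h.bound p) (q - q')
  have h4 := (k p - k p').le_of_opNorm_le (h.lip.norm_sub_le p p') q'
  linarith

lemma integrable_fderiv_apply (h1 : IsKernel C K1) (μ : Measure (Sp d)) [IsFiniteMeasure μ]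
    {b φ : Sp d → Sp d} (hb : Continuous b) (hφ : Continuous φ) {R : ℝ} (hR : ∀ y, ‖φ y‖ ≤ R)
    (a q : Sp d) : Integrable (fun y => fderiv ℝ K1 (a - b y) (q - φ y)) μ := by
  refine integrable_of_bound (C := C * (‖q‖ + R)) ?_ fun y => ?_
  · exact (h1.blip_fderiv.continuous.comp (continuous_const.sub hb)).clm_apply
      (continuous_const.sub hφ)
  · refine ((fderiv ℝ K1 _).le_of_opNorm_le (h1.blip_fderiv.bound _) _).trans ?_
    gcongr
    exact (norm_sub_le _ _).trans (by gcongr; exact hR y)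

lemma norm_linInteraction_sub_le (h1 : IsKernel C K1) (h2 : IsKernel C K2) (μ : Measure (Sp d))
    [IsProbabilityMeasure μ] {b b' : Sp d → Sp d} (hb : Continuous b) (hb' : Continuous b')
    {D : ℝ} (hD : ∀ y, ‖b y - b' y‖ ≤ D) (φ φ' : Sp d →ᵇ Sp d) (w w' h h' : Ctrl d M)
    (a a' q q' : Sp d) :
    ‖linInteraction K1 K2 μ b φ w h a q - linInteraction K1 K2 μ b' φ' w' h' a' q'‖ ≤
      (M + 1) * C * ((‖a - a'‖ + D + ‖w - w'‖) * (‖q'‖ + ‖φ'‖ + ‖h'‖) +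
        (‖q - q'‖ + ‖φ - φ'‖ + ‖h - h'‖)) := by
  have hD0 : 0 ≤ D := (norm_nonneg _).trans (hD 0)
  set S := (‖a - a'‖ + D + ‖w - w'‖) * (‖q'‖ + ‖φ'‖ + ‖h'‖) +
        (‖q - q'‖ + ‖φ - φ'‖ + ‖h - h'‖) with hS
  have h3 : ∀ y, ‖fderiv ℝ K1 (a - b y) (q - φ y) - fderiv ℝ K1 (a' - b' y) (q' - φ' y)‖ ≤
      C * S := by
    intro y
    refine (h1.blip_fderiv.norm_apply_sub_le _ _ _ _).trans ?_
    have e1 : ‖a - b y - (a' - b' y)‖ ≤ ‖a - a'‖ + D + ‖w - w'‖ := by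
      rw [sub_sub_sub_comm]
      have := norm_sub_le (a - a') (b y - b' y)
      have := hD y
      have := norm_nonneg (w - w')
      linarith
    have e2 : ‖q' - φ' y‖ ≤ ‖q'‖ + ‖φ'‖ + ‖h'‖ := by
      have := norm_sub_le q' (φ' y)
      have := φ'.norm_coe_le_norm y
      have := norm_nonneg h'
      linarith
    have e3 : ‖q - φ y - (q' - φ' y)‖ ≤ ‖q - q'‖ + ‖φ - φ'‖ + ‖h - h'‖ := by
      rw [sub_sub_sub_comm]
      have := norm_sub_le (q - q') (φ y - φ' y)
      have := (φ - φ').norm_coe_le_norm y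
      rw [BoundedContinuousFunction.sub_apply] at this
      have := norm_nonneg (h - h')
      linarith
    rw [hS]
    gcongr
  have h4 : ∀ m, ‖fderiv ℝ K2 (a - w m) (q - h m) - fderiv ℝ K2 (a' - w' m) (q' - h' m)‖ ≤
      C * S := by
    intro m
    refine (h2.blip_fderiv.norm_apply_sub_le _ _ _ _).trans ?_
    have e1 : ‖a - w m - (a' - w' m)‖ ≤ ‖a - a'‖ + D + ‖w - w'‖ := by
      rw [sub_sub_sub_comm]
      have := norm_sub_le (a - a') (w m - w' m)
      have h5 : ‖w m - w' m‖ ≤ ‖w - w'‖ := PiLp.norm_apply_le (w - w') m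
      linarith
    have e2 : ‖q' - h' m‖ ≤ ‖q'‖ + ‖φ'‖ + ‖h'‖ := by
      have := norm_sub_le q' (h' m)
      have : ‖h' m‖ ≤ ‖h'‖ := PiLp.norm_apply_le h' m
      have := norm_nonneg φ'
      linarith
    have e3 : ‖q - h m - (q' - h' m)‖ ≤ ‖q - q'‖ + ‖φ - φ'‖ + ‖h - h'‖ := by
      rw [sub_sub_sub_comm]
      have := norm_sub_le (q - q') (h m - h' m)
      have h5 : ‖h m - h' m‖ ≤ ‖h - h'‖ := PiLp.norm_apply_le (h - h') m
      have := norm_nonneg (φ - φ')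
      linarith
    rw [hS]
    gcongr
  have h5 := norm_integral_le_of_norm_le_const (μ := μ) (Eventually.of_forall h3)
  have h6 := norm_sum_le_of_le (Finset.univ : Finset (Fin M)) (fun m _ => h4 m)
  rw [integral_sub (integrable_fderiv_apply h1 μ hb φ.continuous φ.norm_coe_le_norm a q)
    (integrable_fderiv_apply h1 μ hb' φ'.continuous φ'.norm_coe_le_norm a' q')] at h5
  rw [Finset.sum_sub_distrib] at h6
  simp only [probReal_univ, mul_one, Finset.sum_const, Finset.card_univ, Fintype.card_fin,
    nsmul_eq_mul] at h5 h6
  have e : ∀ I I' S S' : Sp d, -I - S - (-I' - S') = -(I - I') - (S - S') := by intros; abel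
  unfold linInteraction
  rw [e]
  refine (norm_sub_le _ _).trans ?_
  rw [norm_neg]
  linarith

lemma norm_linInteraction_le (h1 : IsKernel C K1) (h2 : IsKernel C K2) (μ : Measure (Sp d))
    [IsProbabilityMeasure μ] {b : Sp d → Sp d} (hb : Continuous b) (φ : Sp d →ᵇ Sp d)
    (w h : Ctrl d M) (a q : Sp d) :
    ‖linInteraction K1 K2 μ b φ w h a q‖ ≤ (M + 1) * C * (‖q‖ + ‖φ‖ + ‖h‖) := by
  have h3 := norm_linInteraction_sub_le h1 h2 μ hb hb (D := 0) (by simp) φ 0 w w h 0 a a q 0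
  simpa [linInteraction] using h3

/-- The derivative of `meanField` in the direction `(h, φ)`. -/
noncomputable def linMeanField (h1 : IsKernel C K1) (h2 : IsKernel C K2) (μ : Measure (Sp d))
    [IsProbabilityMeasure μ] (w h : Ctrl d M) (ζ φ : Sp d →ᵇ Sp d) : Sp d →ᵇ Sp d :=
  BoundedContinuousFunction.ofNormedAddCommGroup
    (fun x => linInteraction K1 K2 μ (shift ζ) φ w h (shift ζ x) (φ x))
    (by
      rw [continuous_iff_continuousAt]
      intro x
      rw [ContinuousAt, tendsto_iff_norm_sub_tendsto_zero]
      refine squeeze_zero (fun _ => norm_nonneg _) (fun y => norm_linInteraction_sub_le h1 h2 μ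
        (shift ζ).continuous (shift ζ).continuous (D := 0) (by simp) φ φ w w h h (shift ζ y)
        (shift ζ x) (φ y) (φ x)) ?_
      have e1 : Tendsto (fun y => ‖shift ζ y - shift ζ x‖) (𝓝 x) (𝓝 0) :=
        tendsto_iff_norm_sub_tendsto_zero.1 ((shift ζ).continuous.tendsto x)
      have e2 : Tendsto (fun y => ‖φ y - φ x‖) (𝓝 x) (𝓝 0) :=
        tendsto_iff_norm_sub_tendsto_zero.1 (φ.continuous.tendsto x)
      simpa using ((e1.mul_const (‖φ x‖ + ‖φ‖ + ‖h‖)).add e2).const_mul ((M + 1) * C : ℝ))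
    ((M + 1) * C * (‖φ‖ + ‖φ‖ + ‖h‖)) (fun x => by
      refine (norm_linInteraction_le h1 h2 μ (shift ζ).continuous φ w h _ _).trans ?_
      gcongr
      exact φ.norm_coe_le_norm x)

variable (h1 : IsKernel C K1) (h2 : IsKernel C K2) (μ : Measure (Sp d)) [IsProbabilityMeasure μ]

lemma norm_meanField_sub_le (w w' : Ctrl d M) (ζ ζ' : Sp d →ᵇ Sp d) :
    ‖meanField h1 h2 μ w ζ - meanField h1 h2 μ w' ζ'‖ ≤
      2 * (M + 1) * C * ‖ζ - ζ'‖ + M * C * ‖w - w'‖ := by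
  have hp : ∀ ζ : Sp d →ᵇ Sp d, IsProbabilityMeasure (μ.map (shift ζ)) := fun ζ =>
    Measure.isProbabilityMeasure_map (μ := μ) (shift ζ).continuous.aemeasurable
  have := hp ζ
  refine (BoundedContinuousFunction.norm_le (by positivity)).2 fun x => ?_
  have e : ∀ y, shift ζ y - shift ζ' y = (ζ - ζ') y := fun y => by simp
  have h3 := norm_interaction_sub_le h1.blip h2.blip (μ.map (shift ζ)) (μ.map (shift ζ')) w w'
    (shift ζ x) (shift ζ' x)
  have hc : ∀ (ζ : Sp d →ᵇ Sp d) z, Continuous fun y => K1 (z - shift ζ y) := fun ζ z =>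
    h1.blip.continuous.comp (continuous_const.sub (shift ζ).continuous)
  have hc' : ∀ z, Continuous fun y => K1 (z - y) := fun z => h1.blip.continuous.comp (by fun_prop)
  have h4 : ‖(∫ z, K1 (shift ζ' x - z) ∂μ.map (shift ζ)) -
      ∫ z, K1 (shift ζ' x - z) ∂μ.map (shift ζ')‖ ≤ C * ‖ζ - ζ'‖ := by
    rw [integral_map (shift ζ).continuous.aemeasurable (hc' _).aestronglyMeasurable,
      integral_map (shift ζ').continuous.aemeasurable (hc' _).aestronglyMeasurable,
      ← integral_sub (integrable_of_bound (hc _ _) fun z => h1.blip.bound _)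
        (integrable_of_bound (hc _ _) fun z => h1.blip.bound _)]
    have := norm_integral_le_of_norm_le_const (μ := μ)
      (f := fun y => K1 (shift ζ' x - shift ζ y) - K1 (shift ζ' x - shift ζ' y))
      (C := C * ‖ζ - ζ'‖) (Eventually.of_forall fun y => by
        refine (h1.blip.lip.norm_sub_le _ _).trans ?_
        rw [sub_sub_sub_cancel_left, norm_sub_rev, e]
        gcongr
        exact (ζ - ζ').norm_coe_le_norm y)
    simpa using this
  rw [e] at h3
  have h5 : (M + 1) * C * ‖(ζ - ζ') x‖ ≤ (M + 1) * C * ‖ζ - ζ'‖ := by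
    gcongr; exact (ζ - ζ').norm_coe_le_norm x
  have h6 : (0 : ℝ) ≤ M * C * ‖ζ - ζ'‖ := by positivity
  change ‖interaction K1 K2 (μ.map (shift ζ)) w (shift ζ x) -
    interaction K1 K2 (μ.map (shift ζ')) w' (shift ζ' x)‖ ≤ _
  linarith

lemma norm_linMeanField_sub_le (w w' h h' : Ctrl d M) (ζ ζ' φ φ' : Sp d →ᵇ Sp d) :
    ‖linMeanField h1 h2 μ w h ζ φ - linMeanField h1 h2 μ w' h' ζ' φ'‖ ≤
      (M + 1) * C * ((2 * ‖ζ - ζ'‖ + ‖w - w'‖) * (2 * ‖φ'‖ + ‖h'‖) +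
        (2 * ‖φ - φ'‖ + ‖h - h'‖)) := by
  refine (BoundedContinuousFunction.norm_le (by positivity)).2 fun x => ?_
  have e : ∀ y, shift ζ y - shift ζ' y = (ζ - ζ') y := fun y => by simp
  refine (norm_linInteraction_sub_le h1 h2 μ (shift ζ).continuous (shift ζ').continuous
    (D := ‖ζ - ζ'‖) (fun y => by rw [e]; exact (ζ - ζ').norm_coe_le_norm y) φ φ' w w' h h'
    (shift ζ x) (shift ζ' x) (φ x) (φ' x)).trans ?_
  have e1 : ‖shift ζ x - shift ζ' x‖ ≤ ‖ζ - ζ'‖ := by rw [e]; exact (ζ - ζ').norm_coe_le_norm x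
  have e2 : ‖φ x - φ' x‖ ≤ ‖φ - φ'‖ := (φ - φ').norm_coe_le_norm x
  have e3 := φ'.norm_coe_le_norm x
  have e4 := norm_nonneg (ζ - ζ')
  have e5 := norm_nonneg (φ - φ')
  gcongr <;> linarith

lemma norm_meanField_le (w : Ctrl d M) (ζ : Sp d →ᵇ Sp d) :
    ‖meanField h1 h2 μ w ζ‖ ≤ (M + 1) * C := by
  have := Measure.isProbabilityMeasure_map (μ := μ) (shift ζ).continuous.aemeasurable
  exact (BoundedContinuousFunction.norm_le (by positivity)).2 fun x =>
    norm_interaction_le h1.blip.bound h2.blip.bound _ _ _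

/-- The mean-field equation with a continuous control has a global solution. -/
theorem exists_meanField_flow {u : ℝ → Ctrl d M} (hu : Continuous u) :
    ∃ ζ : ℝ → Sp d →ᵇ Sp d, ζ 0 = 0 ∧ ∀ t, HasDerivAt ζ (meanField h1 h2 μ (u t) (ζ t)) t := by
  have hl : ∀ t, LipschitzWith (2 * (M + 1) * C) (meanField h1 h2 μ (u t)) := fun t =>
    LipschitzWith.of_dist_le_mul fun ζ ζ' => by
      simpa [dist_eq_norm] using norm_meanField_sub_le h1 h2 μ (u t) (u t) ζ ζ'
  refine exists_forall_hasDerivAt (F := fun t => meanField h1 h2 μ (u t)) (B := (M + 1) * C)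
    (continuous_prod_of_continuous_lipschitzWith' _ _ hl fun ζ => ?_) hl (fun t =>
      norm_meanField_le h1 h2 μ (u t) 0) 0
  rw [continuous_iff_continuousAt]
  intro t
  rw [ContinuousAt, tendsto_iff_norm_sub_tendsto_zero]
  refine squeeze_zero (fun _ => norm_nonneg _)
    (fun s => norm_meanField_sub_le h1 h2 μ (u s) (u t) ζ ζ) ?_
  have e1 : Tendsto (fun s => ‖u s - u t‖) (𝓝 t) (𝓝 0) :=
    tendsto_iff_norm_sub_tendsto_zero.1 (hu.tendsto t)
  simpa using e1.const_mul (M * C : ℝ)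

/-- The linearized mean-field equation has a global solution. -/
theorem exists_linMeanField_flow {u h : ℝ → Ctrl d M} (hu : Continuous u) (hh : Continuous h)
    {H : ℝ} (hH : ∀ t, ‖h t‖ ≤ H) {ζ : ℝ → Sp d →ᵇ Sp d} (hζ : Continuous ζ) :
    ∃ φ : ℝ → Sp d →ᵇ Sp d, φ 0 = 0 ∧
      ∀ t, HasDerivAt φ (linMeanField h1 h2 μ (u t) (h t) (ζ t) (φ t)) t := by
  have hl : ∀ t, LipschitzWith (2 * (M + 1) * C) (linMeanField h1 h2 μ (u t) (h t) (ζ t)) :=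
    fun t => LipschitzWith.of_dist_le_mul fun φ φ' => by
      have := norm_linMeanField_sub_le h1 h2 μ (u t) (u t) (h t) (h t) (ζ t) (ζ t) φ φ'
      simp only [sub_self, norm_zero, mul_zero, add_zero, zero_mul, zero_add] at this
      simp only [dist_eq_norm, NNReal.coe_mul, NNReal.coe_add, NNReal.coe_natCast, NNReal.coe_one,
        NNReal.coe_ofNat]
      linarith
  refine exists_forall_hasDerivAt (F := fun t => linMeanField h1 h2 μ (u t) (h t) (ζ t))
    (B := (M + 1) * C * H)
    (continuous_prod_of_continuous_lipschitzWith' _ _ hl fun φ => ?_) hl (fun t => ?_) 0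
  · rw [continuous_iff_continuousAt]
    intro t
    rw [ContinuousAt, tendsto_iff_norm_sub_tendsto_zero]
    refine squeeze_zero (fun _ => norm_nonneg _)
      (fun s => norm_linMeanField_sub_le h1 h2 μ (u s) (u t) (h s) (h t) (ζ s) (ζ t) φ φ) ?_
    have e1 : Tendsto (fun s => ‖u s - u t‖) (𝓝 t) (𝓝 0) :=
      tendsto_iff_norm_sub_tendsto_zero.1 (hu.tendsto t)
    have e2 : Tendsto (fun s => ‖h s - h t‖) (𝓝 t) (𝓝 0) :=
      tendsto_iff_norm_sub_tendsto_zero.1 (hh.tendsto t)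
    have e3 : Tendsto (fun s => ‖ζ s - ζ t‖) (𝓝 t) (𝓝 0) :=
      tendsto_iff_norm_sub_tendsto_zero.1 (hζ.tendsto t)
    simpa using ((((e3.const_mul 2).add e1).mul_const (2 * ‖φ‖ + ‖h t‖)).add e2).const_mul
      ((M + 1) * C : ℝ)
  · have h3 : ‖linMeanField h1 h2 μ (u t) (h t) (ζ t) 0‖ ≤ (M + 1) * C * ‖h t‖ := by
      refine (BoundedContinuousFunction.norm_le (by positivity)).2 fun x => ?_
      exact (norm_linInteraction_le h1 h2 μ (shift (ζ t)).continuous 0 (u t) (h t)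
        (shift (ζ t) x) 0).trans_eq (by simp)
    exact h3.trans (by gcongr; exact hH t)

lemma linMeanField_smul (δ : ℝ) (w h : Ctrl d M) (ζ φ : Sp d →ᵇ Sp d) :
    linMeanField h1 h2 μ w (δ • h) ζ (δ • φ) = δ • linMeanField h1 h2 μ w h ζ φ := by
  ext1 x
  change linInteraction K1 K2 μ (shift ζ) ⇑(δ • φ) w (δ • h) (shift ζ x) (δ • φ x) =
    δ • linInteraction K1 K2 μ (shift ζ) φ w h (shift ζ x) (φ x)
  have e : ∀ y, (δ • φ) y = δ • φ y := fun _ => rfl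
  simp only [linInteraction, e, PiLp.smul_apply, ← smul_sub, map_smul, integral_smul,
    ← Finset.smul_sum]
  rw [smul_sub, smul_neg]

/-- The second-order expansion of the mean-field vector field. -/
lemma norm_meanField_sub_sub_le (w w' : Ctrl d M) (ζ ζ' : Sp d →ᵇ Sp d) :
    ‖meanField h1 h2 μ w' ζ' - meanField h1 h2 μ w ζ -
      linMeanField h1 h2 μ w (w' - w) ζ (ζ' - ζ)‖ ≤
      (M + 1) * C * (2 * ‖ζ' - ζ‖ + ‖w' - w‖) ^ 2 := by
  refine (BoundedContinuousFunction.norm_le (by positivity)).2 fun x => ?_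
  change ‖interaction K1 K2 (μ.map (shift ζ')) w' (shift ζ' x) -
    interaction K1 K2 (μ.map (shift ζ)) w (shift ζ x) -
    linInteraction K1 K2 μ (shift ζ) ⇑(ζ' - ζ) w (w' - w) (shift ζ x) ((ζ' - ζ) x)‖ ≤ _
  rw [interaction_map h1.blip.continuous μ (shift ζ).continuous,
    interaction_map h1.blip.continuous μ (shift ζ').continuous, linInteraction]
  set S := 2 * ‖ζ' - ζ‖ + ‖w' - w‖ with hS
  have e : ∀ y, shift ζ' y - shift ζ y = (ζ' - ζ) y := fun y => by simp
  have hn : ∀ y, ‖(ζ' - ζ) y‖ ≤ ‖ζ' - ζ‖ := (ζ' - ζ).norm_coe_le_norm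
  have h3 : ∀ y, ‖K1 (shift ζ' x - shift ζ' y) - K1 (shift ζ x - shift ζ y) -
      fderiv ℝ K1 (shift ζ x - shift ζ y) ((ζ' - ζ) x - (ζ' - ζ) y)‖ ≤ C * S ^ 2 := by
    intro y
    have e1 : (ζ' - ζ) x - (ζ' - ζ) y =
        (shift ζ' x - shift ζ' y) - (shift ζ x - shift ζ y) := by rw [← e, ← e]; abel
    have h4 := h1.taylor (shift ζ x - shift ζ y) (shift ζ' x - shift ζ' y)
    rw [← e1] at h4
    refine h4.trans ?_
    gcongr
    have := norm_sub_le ((ζ' - ζ) x) ((ζ' - ζ) y)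
    have := hn x
    have := hn y
    have := norm_nonneg (w' - w)
    linarith
  have h4 : ∀ m, ‖K2 (shift ζ' x - w' m) - K2 (shift ζ x - w m) -
      fderiv ℝ K2 (shift ζ x - w m) ((ζ' - ζ) x - (w' - w) m)‖ ≤ C * S ^ 2 := by
    intro m
    have e1 : (ζ' - ζ) x - (w' - w) m = (shift ζ' x - w' m) - (shift ζ x - w m) := by
      rw [← e, PiLp.sub_apply]; abel
    have h5 := h2.taylor (shift ζ x - w m) (shift ζ' x - w' m)
    rw [← e1] at h5
    refine h5.trans ?_
    gcongr
    have := norm_sub_le ((ζ' - ζ) x) ((w' - w) m)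
    have := hn x
    have : ‖(w' - w) m‖ ≤ ‖w' - w‖ := PiLp.norm_apply_le (w' - w) m
    have := norm_nonneg (ζ' - ζ)
    linarith
  have hc : ∀ ζ : Sp d →ᵇ Sp d, Integrable (fun y => K1 (shift ζ x - shift ζ y)) μ := fun ζ =>
    integrable_of_bound (h1.blip.continuous.comp (continuous_const.sub (shift ζ).continuous))
      fun z => h1.blip.bound _
  have h5 := norm_integral_le_of_norm_le_const (μ := μ) (Eventually.of_forall h3)
  have h6 := norm_sum_le_of_le (Finset.univ : Finset (Fin M)) (fun m _ => h4 m)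
  have hl := integrable_fderiv_apply h1 μ (shift ζ).continuous (ζ' - ζ).continuous hn (shift ζ x)
    ((ζ' - ζ) x)
  have hs : Integrable (fun y => K1 (shift ζ' x - shift ζ' y) - K1 (shift ζ x - shift ζ y)) μ :=
    (hc ζ').sub (hc ζ)
  rw [integral_sub hs hl, integral_sub (hc ζ') (hc ζ)] at h5
  rw [Finset.sum_sub_distrib, Finset.sum_sub_distrib] at h6
  simp only [probReal_univ, mul_one, Finset.sum_const, Finset.card_univ, Fintype.card_fin,
    nsmul_eq_mul] at h5 h6
  rw [← norm_neg] at h5 h6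
  have h7 := norm_add_le_of_le h5 h6
  calc _ = _ := by congr 1; abel
    _ ≤ _ := h7
    _ = _ := by ring

/-- The mean-field flow is differentiable in the direction `h` of the control, with the solution
`φ` of the linearized equation as its derivative, uniformly on `[0, T]`. -/
theorem exists_meanField_expansion {T : ℝ} (hT : 0 ≤ T) {u h : ℝ → Ctrl d M} {H : ℝ}
    (hH : ∀ t, ‖h t‖ ≤ H) {ζ φ : ℝ → Sp d →ᵇ Sp d} (hζ0 : ζ 0 = 0)
    (hζ : ∀ t ∈ Icc 0 T, HasDerivAt ζ (meanField h1 h2 μ (u t) (ζ t)) t) (hφ0 : φ 0 = 0)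
    (hφ : ∀ t, HasDerivAt φ (linMeanField h1 h2 μ (u t) (h t) (ζ t) (φ t)) t) :
    ∃ A : ℝ, 0 ≤ A ∧ ∀ (δ : ℝ) (ξ : ℝ → Sp d →ᵇ Sp d), ξ 0 = 0 →
      (∀ t, HasDerivAt ξ (meanField h1 h2 μ (u t + δ • h t) (ξ t)) t) → ∀ t ∈ Icc 0 T,
        ‖ξ t - ζ t‖ ≤ A * |δ| ∧ ‖ξ t - ζ t - δ • φ t‖ ≤ A * δ ^ 2 := by
  have hH0 : 0 ≤ H := (norm_nonneg _).trans (hH 0)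
  set k : ℝ := 2 * (M + 1) * C with hk
  have hk0 : 0 ≤ k := by positivity
  set A₁ : ℝ := M * C * H * T * Real.exp (k * T) with hA₁
  set A₂ : ℝ := (M + 1) * C * (2 * A₁ + H) ^ 2 * T * Real.exp (k * T) with hA₂
  have hA₁0 : 0 ≤ A₁ := by positivity
  have hA₂0 : 0 ≤ A₂ := by positivity
  refine ⟨A₁ + A₂, by positivity, fun δ ξ hξ0 hξ => ?_⟩
  have hd : ∀ t, ‖δ • h t‖ ≤ |δ| * H := fun t => by
    rw [norm_smul, Real.norm_eq_abs]; gcongr; exact hH t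
  have hfirst : ∀ t ∈ Icc 0 T, ‖ξ t - ζ t‖ ≤ A₁ * |δ| := by
    intro t ht
    have h3 := norm_le_of_norm_deriv_le (f := fun t => ξ t - ζ t) (K := k)
      (ε := M * C * (|δ| * H)) hk0 (by positivity) (fun s hs => (hξ s).sub (hζ s hs))
      (fun s _ => by
        refine (norm_meanField_sub_le h1 h2 μ _ _ _ _).trans ?_
        rw [add_sub_cancel_left]
        gcongr
        exact hd s) ht
    simp only [hξ0, hζ0, sub_self, norm_zero, zero_add] at h3
    calc _ ≤ _ := h3
      _ = _ := by rw [hA₁]; ring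
  intro t ht
  refine ⟨(hfirst t ht).trans (by gcongr; linarith), ?_⟩
  have h3 := norm_le_of_norm_deriv_le (f := fun t => ξ t - ζ t - δ • φ t) (K := k)
    (ε := (M + 1) * C * (2 * (A₁ * |δ|) + |δ| * H) ^ 2) hk0 (by positivity)
    (fun s hs => ((hξ s).sub (hζ s hs)).sub ((hφ s).const_smul δ)) (fun s hs => by
      have h4 := norm_meanField_sub_sub_le h1 h2 μ (u s) (u s + δ • h s) (ζ s) (ξ s)
      rw [add_sub_cancel_left] at h4
      have h5 := norm_linMeanField_sub_le h1 h2 μ (u s) (u s) (δ • h s) (δ • h s) (ζ s) (ζ s)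
        (ξ s - ζ s) (δ • φ s)
      simp only [sub_self, norm_zero, mul_zero, add_zero, zero_mul, zero_add] at h5
      rw [linMeanField_smul] at h5
      have h6 := norm_add_le_of_le h4 h5
      rw [sub_add_sub_cancel] at h6
      refine h6.trans ?_
      have h7 : (M + 1) * C * (2 * ‖ξ s - ζ s‖ + ‖δ • h s‖) ^ 2 ≤
          (M + 1) * C * (2 * (A₁ * |δ|) + |δ| * H) ^ 2 := by
        have := hfirst s hs
        have := hd s
        gcongr
      rw [hk]
      linarith) ht
  have e0 : δ • (0 : Sp d →ᵇ Sp d) = 0 := by ext1 x; simp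
  simp only [hξ0, hζ0, hφ0, e0, sub_self, norm_zero, zero_add] at h3
  refine h3.trans ?_
  have e : (2 * (A₁ * |δ|) + |δ| * H) ^ 2 = (2 * A₁ + H) ^ 2 * δ ^ 2 := by
    rw [← sq_abs δ]; ring
  rw [e]
  calc _ = A₂ * δ ^ 2 := by rw [hA₂]; ring
    _ ≤ _ := by gcongr; linarith

end MeanField

/-! ### Perturbed admissible pairs -/

section Perturbation

variable {d M : ℕ} {C : ℝ≥0} {K1 K2 : Sp d → Sp d}

lemma memLp_two_iff_lintegral {X F : Type*} [MeasurableSpace X] [NormedAddCommGroup F]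
    {μ : Measure X} {f : X → F} (hf : AEStronglyMeasurable f μ) :
    MemLp f 2 μ ↔ ∫⁻ x, ‖f x‖ₑ ^ 2 ∂μ < ∞ := by
  rw [MemLp, eLpNorm_lt_top_iff_lintegral_rpow_enorm_lt_top (by norm_num) (by norm_num)]
  simp [hf]

lemma IsP2.memLp {μ : Measure (Sp d)} (h : IsP2 μ) : MemLp (fun x => x) 2 μ :=
  (memLp_two_iff_lintegral aestronglyMeasurable_id).2 h.secondMoment_lt_top

lemma IsP2.integrable_one_add_norm_sq {μ : Measure (Sp d)} (h : IsP2 μ) :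
    Integrable (fun x => (1 + ‖x‖) ^ 2) μ := by
  have := h.isProbabilityMeasure
  exact ((memLp_const (1 : ℝ)).add h.memLp.norm).integrable_sq

lemma IsP2.map_shift {μ : Measure (Sp d)} (h : IsP2 μ) (ζ : Sp d →ᵇ Sp d) :
    IsP2 (μ.map (shift ζ)) := by
  have := h.isProbabilityMeasure
  have hm : Measurable (shift ζ) := (shift ζ).continuous.measurable
  refine ⟨Measure.isProbabilityMeasure_map hm.aemeasurable, ?_⟩
  rw [lintegral_map (by fun_prop) hm,
    ← memLp_two_iff_lintegral (shift ζ).continuous.aestronglyMeasurable]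
  exact h.memLp.add (MemLp.of_bound ζ.continuous.aestronglyMeasurable ‖ζ‖
    (Eventually.of_forall ζ.norm_coe_le_norm))

lemma isContinuousP2Curve_map_shift {μ : Measure (Sp d)} (h : IsP2 μ) {ξ : ℝ → Sp d →ᵇ Sp d}
    (hξ : Continuous ξ) (T : ℝ) : IsContinuousP2Curve T fun t => μ.map (shift (ξ t)) := by
  refine ⟨fun t _ => h.map_shift _, fun s _ => ?_⟩
  have := h.isProbabilityMeasure
  have h1 : Tendsto (fun t => ENNReal.ofReal ‖ξ t - ξ s‖) (𝓝[Icc 0 T] s) (𝓝 0) := by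
    have h2 : Tendsto (fun t => ‖ξ t - ξ s‖) (𝓝 s) (𝓝 0) :=
      tendsto_iff_norm_sub_tendsto_zero.1 (hξ.tendsto s)
    simpa using (ENNReal.tendsto_ofReal h2).mono_left nhdsWithin_le_nhds
  refine tendsto_of_tendsto_of_tendsto_of_le_of_le tendsto_const_nhds h1
    (fun _ => zero_le) fun t => ?_
  refine W2_map_le (shift (ξ t)).continuous (shift (ξ s)).continuous fun x => ?_
  have e : shift (ξ t) x - shift (ξ s) x = (ξ t - ξ s) x := by simp
  rw [e]
  exact (ξ t - ξ s).norm_coe_le_norm x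

variable (h1 : IsKernel C K1) (h2 : IsKernel C K2)

/-- A mean-field flow gives an admissible pair: along each trajectory the weak equation is the
fundamental theorem of calculus, and it is integrated over the labels. -/
theorem isAdmissible_of_meanField_flow {T : ℝ} (hT : 0 < T) {μhat : Measure (Sp d)}
    (hμ : IsP2 μhat) [IsProbabilityMeasure μhat] {uhat : Ctrl d M} {u : H1 T (Ctrl d M)}
    (hu : u ∈ Uad T uhat) {w : ℝ → Ctrl d M} (hw : Continuous w)
    (hwu : ∀ t ∈ Icc 0 T, w t = evalAt u.1 t) {ξ : ℝ → Sp d →ᵇ Sp d} (hξ0 : ξ 0 = 0)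
    (hξ : ∀ t, HasDerivAt ξ (meanField h1 h2 μhat (w t) (ξ t)) t) :
    IsAdmissible T K1 K2 μhat uhat (fun t => μhat.map (shift (ξ t))) u := by
  have hξc : Continuous ξ := continuous_iff_continuousAt.2 fun t => (hξ t).continuousAt
  have hid : (shift (0 : Sp d →ᵇ Sp d) : Sp d → Sp d) = id := by ext1 x; simp
  refine ⟨isContinuousP2Curve_map_shift hμ hξc T, by simp only [hξ0, hid, Measure.map_id], hu,
    fun φ hφ hφc => ?_⟩
  let G : ℝ → Sp d → ℝ := fun t x => fderiv ℝ (Function.uncurry φ) (t, shift (ξ t) x)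
    (1, meanField h1 h2 μhat (w t) (ξ t) x)
  have hder : ∀ t x, HasDerivAt (fun s => φ s (shift (ξ s) x)) (G t x) t := fun t x => by
    have := hasDerivAt_along hφ (hasDerivAt_shift (hξ t) x)
    rwa [deriv_add_inner_gradient hφ] at this
  have hfc : Continuous (fderiv ℝ (Function.uncurry φ)) := hφ.continuous_fderiv one_ne_zero
  have hmc : Continuous fun t => meanField h1 h2 μhat (w t) (ξ t) := by
    rw [continuous_iff_continuousAt]
    intro t
    rw [ContinuousAt, tendsto_iff_norm_sub_tendsto_zero]
    refine squeeze_zero (fun _ => norm_nonneg _)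
      (fun s => norm_meanField_sub_le h1 h2 μhat (w s) (w t) (ξ s) (ξ t)) ?_
    have e1 : Tendsto (fun s => ‖w s - w t‖) (𝓝 t) (𝓝 0) :=
      tendsto_iff_norm_sub_tendsto_zero.1 (hw.tendsto t)
    have e2 : Tendsto (fun s => ‖ξ s - ξ t‖) (𝓝 t) (𝓝 0) :=
      tendsto_iff_norm_sub_tendsto_zero.1 (hξc.tendsto t)
    simpa using (e2.const_mul (2 * (M + 1) * C : ℝ)).add (e1.const_mul (M * C : ℝ))
  have hshc := continuous_uncurry_shift hξc
  have hGc : Continuous (Function.uncurry G) := by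
    have key : ∀ m : ℝ → Sp d →ᵇ Sp d, Continuous m → Continuous fun p : ℝ × Sp d => m p.1 p.2 :=
      fun m hm => by fun_prop
    have e := key _ hmc
    exact (hfc.comp (continuous_fst.prodMk hshc)).clm_apply (continuous_const.prodMk e)
  obtain ⟨B, hB⟩ := hfc.bounded_above_of_compact_support (hφc.fderiv (𝕜 := ℝ))
  have hB0 : 0 ≤ B := (norm_nonneg _).trans (hB 0)
  have hGb : ∀ t x, ‖G t x‖ ≤ B * max 1 ((M + 1) * C) := fun t x => by
    refine (ContinuousLinearMap.le_of_opNorm_le _ (hB _) _).trans ?_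
    gcongr
    refine max_le_max (by simp) ?_
    exact ((meanField h1 h2 μhat (w t) (ξ t)).norm_coe_le_norm x).trans
      (norm_meanField_le h1 h2 μhat (w t) (ξ t))
  have hφt : ∀ t, Continuous (φ t) := fun t =>
    hφ.continuous.comp (continuous_const.prodMk continuous_id)
  obtain ⟨Bφ, hBφ⟩ := hφ.continuous.bounded_above_of_compact_support hφc
  have hφi : ∀ t, Integrable (fun x => φ t (shift (ξ t) x)) μhat := fun t =>
    integrable_of_bound ((hφt t).comp (shift (ξ t)).continuous) fun x => hBφ (t, _)
  have e1 : ∫ x, φ T x ∂μhat.map (shift (ξ T)) = ∫ x, φ T (shift (ξ T) x) ∂μhat :=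
    integral_map (shift (ξ T)).continuous.aemeasurable (hφt T).aestronglyMeasurable
  have e2 : ∀ t ∈ Icc 0 T, ∫ x, (deriv (fun s => φ s x) t + inner ℝ
      (velocity K1 K2 (μhat.map (shift (ξ t))) (evalAt u.1 t) x) (∇ (φ t) x))
        ∂μhat.map (shift (ξ t)) = ∫ x, G t x ∂μhat := by
    intro t ht
    have := (hμ.map_shift (ξ t)).isProbabilityMeasure
    simp only [deriv_add_inner_gradient hφ]
    rw [integral_map (shift (ξ t)).continuous.aemeasurable]
    · simp only [← hwu t ht]
      rfl
    · refine Continuous.aestronglyMeasurable ((hfc.comp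
        (continuous_const.prodMk continuous_id)).clm_apply (continuous_const.prodMk ?_))
      exact (lipschitzWith_interaction h1.blip h2.blip _ _).continuous
  have e3 : ∫ t in (0)..T, (∫ x, G t x ∂μhat) = ∫ x, (∫ t in (0)..T, G t x) ∂μhat := by
    refine intervalIntegral_integral_swap ?_
    have : IsFiniteMeasure ((volume : Measure ℝ).restrict (uIoc 0 T)) := by
      rw [uIoc_of_le hT.le]; infer_instance
    exact integrable_of_bound hGc fun p => hGb p.1 p.2
  have e4 : ∀ x, ∫ t in (0)..T, G t x = φ T (shift (ξ T) x) - φ 0 (shift (ξ 0) x) := fun x =>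
    intervalIntegral.integral_eq_sub_of_hasDerivAt (f := fun s => φ s (shift (ξ s) x))
      (fun t _ => hder t x)
      ((hGc.comp (continuous_id.prodMk continuous_const)).intervalIntegrable _ _)
  have e5 : ∫ t in (0)..T, (∫ x, (deriv (fun s => φ s x) t + inner ℝ
      (velocity K1 K2 (μhat.map (shift (ξ t))) (evalAt u.1 t) x) (∇ (φ t) x))
        ∂μhat.map (shift (ξ t))) = ∫ t in (0)..T, (∫ x, G t x ∂μhat) :=
    intervalIntegral.integral_congr fun t ht => e2 t (by rwa [uIcc_of_le hT.le] at ht)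
  rw [stateResidual, e5, e3, e1]
  simp only [e4]
  rw [integral_sub (hφi T) (hφi 0)]
  simp [hξ0]

end Perturbation

/-! ### Differentiating the cost -/

section Cost

variable {d M L : ℕ} {C : ℝ≥0} {K1 K2 : Sp d → Sp d}

/-- Differentiation at `0` under the integral sign, with a Lipschitz bound relative to `0` only. -/
lemma hasDerivAt_integral_of_lip {X : Type*} [MeasurableSpace X] {μ : Measure X}
    {F : ℝ → X → ℝ} {F' bound : X → ℝ} (hF : ∀ δ, AEStronglyMeasurable (F δ) μ)
    (hF0 : Integrable (F 0) μ) (hF' : AEStronglyMeasurable F' μ)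
    (hlip : ∀ᵐ x ∂μ, ∀ δ, |δ| < 1 → |F δ x - F 0 x| ≤ bound x * |δ|) (hb : Integrable bound μ)
    (hd : ∀ᵐ x ∂μ, HasDerivAt (fun δ => F δ x) (F' x) 0) :
    Integrable F' μ ∧ HasDerivAt (fun δ => ∫ x, F δ x ∂μ) (∫ x, F' x ∂μ) 0 := by
  have h := hasFDerivAt_integral_of_dominated_loc_of_lip' (𝕜 := ℝ) (x₀ := (0 : ℝ)) (F := F)
    (F' := fun x => ContinuousLinearMap.toSpanSingleton ℝ (F' x)) (Metric.ball_mem_nhds 0 one_pos)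
    (fun δ _ => hF δ) hF0
    ((ContinuousLinearMap.toSpanSingletonCLE (𝕜 := ℝ) (E := ℝ)).continuous.comp_aestronglyMeasurable
      hF')
    (hlip.mono fun x hx δ hδ => by
      simpa using hx δ (by simpa using hδ)) hb (hd.mono fun x hx => hx.hasFDerivAt)
  have h3 := h.2.hasDerivAt
  rw [ContinuousLinearMap.integral_apply h.1] at h3
  refine ⟨?_, by simpa using h3⟩
  simpa using h.1.apply_continuousLinearMap (1 : ℝ)

/-- Integrals of functions of quadratic growth depend continuously on a parameter. -/
lemma continuous_integral_of_growth {μ : Measure (Sp d)} (hμ : IsP2 μ) {G : ℝ → Sp d → ℝ}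
    (hG : Continuous (Function.uncurry G)) {c : ℝ → ℝ} (hc : Continuous c)
    (hb : ∀ t x, |G t x| ≤ c t * (1 + ‖x‖) ^ 2) :
    (∀ t, Integrable (G t) μ) ∧ Continuous fun t => ∫ x, G t x ∂μ := by
  have hGt : ∀ t, Continuous (G t) := fun t => hG.comp (continuous_const.prodMk continuous_id)
  refine ⟨fun t => (hμ.integrable_one_add_norm_sq.const_mul (c t)).mono'
    (hGt t).aestronglyMeasurable (Eventually.of_forall (hb t)), ?_⟩
  rw [continuous_iff_continuousAt]
  intro t
  refine continuousAt_of_dominated (bound := fun x => (c t + 1) * (1 + ‖x‖) ^ 2)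
    (Eventually.of_forall fun s => (hGt s).aestronglyMeasurable) ?_
    (hμ.integrable_one_add_norm_sq.const_mul _) (Eventually.of_forall fun x =>
      (hG.comp (continuous_id.prodMk continuous_const)).continuousAt)
  filter_upwards [(hc.tendsto t).eventually (gt_mem_nhds (lt_add_one (c t)))] with s hs
  refine Eventually.of_forall fun x => (hb s x).trans ?_
  gcongr

lemma one_add_norm_shift_le (ζ : Sp d →ᵇ Sp d) (x : Sp d) :
    1 + ‖shift ζ x‖ ≤ (1 + ‖ζ‖) * (1 + ‖x‖) := by
  have h3 := norm_add_le x (ζ x)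
  have h4 := ζ.norm_coe_le_norm x
  rw [shift_apply]
  nlinarith [norm_nonneg ζ, norm_nonneg x]

variable {j : (Fin L → ℝ) → ℝ} {g : Fin L → Sp d → ℝ}

lemma norm_gradient_eq {f : Sp d → ℝ} (x : Sp d) : ‖∇ f x‖ = ‖fderiv ℝ f x‖ := by
  rw [gradient, LinearIsometryEquiv.norm_map]

/-- The mean value inequality for a function whose gradient grows linearly. -/
lemma abs_sub_le_of_growth {f : Sp d → ℝ} (hf : ContDiff ℝ 1 f) {G : ℝ} (hG0 : 0 ≤ G)
    (hG : ∀ x, ‖∇ f x‖ ≤ G * (1 + ‖x‖)) (x y : Sp d) :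
    |f y - f x| ≤ G * (1 + ‖x‖ + ‖y - x‖) * ‖y - x‖ :=
  Convex.norm_image_sub_le_of_norm_hasFDerivWithin_le (s := segment ℝ x y) (f := f)
    (f' := fderiv ℝ f) (fun z _ => (hf.differentiable one_ne_zero z).hasFDerivAt.hasFDerivWithinAt)
    (fun z hz => by
      rw [← norm_gradient_eq]
      refine (hG z).trans ?_
      have h3 : ‖z - x‖ ≤ ‖y - x‖ := by simpa using norm_sub_le_of_mem_segment hz
      have h4 := norm_add_le x (z - x)
      rw [add_sub_cancel] at h4
      exact mul_le_mul_of_nonneg_left (by linarith) hG0)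
    (convex_segment x y) (left_mem_segment ℝ x y) (right_mem_segment ℝ x y)

end Cost

section CostDerivative

variable {d L : ℕ} {j : (Fin L → ℝ) → ℝ} {g : Fin L → Sp d → ℝ}

/-- A single constant bounds the linear growth of the gradients and the quadratic growth of the
functions themselves. -/
lemma IsCylindricalData.exists_growth (hJ : IsCylindricalData j g) :
    ∃ G : ℝ, 0 ≤ G ∧ (∀ l x, ‖∇ (g l) x‖ ≤ G * (1 + ‖x‖)) ∧
      ∀ l x, |g l x| ≤ G * (1 + ‖x‖) ^ 2 := by
  obtain ⟨G, hG⟩ := hJ.growth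
  have hG' : ∀ l x, ‖∇ (g l) x‖ ≤ max G 0 * (1 + ‖x‖) := fun l x =>
    (hG l x).trans (by gcongr; exact le_max_left _ _)
  have hS : 0 ≤ ∑ l, |g l 0| := Finset.sum_nonneg fun l _ => abs_nonneg _
  have hm : 0 ≤ max G 0 := le_max_right _ _
  refine ⟨max G 0 + ∑ l, |g l 0|, by positivity, fun l x => (hG' l x).trans ?_, fun l x => ?_⟩
  · gcongr; linarith
  · have h3 := abs_sub_le_of_growth (hJ.contDiff_inner l) hm (hG' l) 0 x
    simp only [norm_zero, add_zero, sub_zero] at h3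
    have h4 : |g l 0| ≤ ∑ l, |g l 0| :=
      Finset.single_le_sum (f := fun l => |g l 0|) (fun l _ => abs_nonneg _) (Finset.mem_univ l)
    have h5 : |g l x| ≤ |g l x - g l 0| + |g l 0| := by
      simpa using abs_add_le (g l x - g l 0) (g l 0)
    have hx := norm_nonneg x
    have h6 : max G 0 * (1 + ‖x‖) * ‖x‖ ≤ max G 0 * (1 + ‖x‖) ^ 2 := by
      rw [sq, ← mul_assoc]
      exact mul_le_mul_of_nonneg_left (by linarith) (by positivity)
    have h7 : ∑ l, |g l 0| ≤ (∑ l, |g l 0|) * (1 + ‖x‖) ^ 2 :=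
      le_mul_of_one_le_right hS (one_le_pow₀ (by linarith))
    rw [add_mul]
    linarith

lemma continuous_gradient {f : Sp d → ℝ} (hf : ContDiff ℝ 1 f) : Continuous (∇ f) :=
  (InnerProductSpace.toDual ℝ (Sp d)).symm.continuous.comp (hf.continuous_fderiv one_ne_zero)

lemma IsCylindricalData.continuous_cylindricalGrad (hJ : IsCylindricalData j g)
    (μ : Measure (Sp d)) : Continuous (cylindricalGrad j g μ) :=
  continuous_finsetSum _ fun l _ => by
    have := continuous_gradient (hJ.contDiff_inner l)
    fun_prop

/-- The chain rule for a cylindrical function. -/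
lemma integral_inner_cylindricalGrad {μ : Measure (Sp d)} {ζ : Sp d →ᵇ Sp d} {φ : Sp d → Sp d}
    (hg : ∀ l, ContDiff ℝ 1 (g l))
    (hi : ∀ l, Integrable (fun x => inner ℝ (∇ (g l) (shift ζ x)) (φ x)) μ) :
    Integrable (fun x => inner ℝ (cylindricalGrad j g (μ.map (shift ζ)) (shift ζ x)) (φ x)) μ ∧
    fderiv ℝ j (fun l => ∫ x, g l (shift ζ x) ∂μ)
      (fun l => ∫ x, inner ℝ (∇ (g l) (shift ζ x)) (φ x) ∂μ) =
      ∫ x, inner ℝ (cylindricalGrad j g (μ.map (shift ζ)) (shift ζ x)) (φ x) ∂μ := by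
  have e : ∀ l, ∫ y, g l y ∂μ.map (shift ζ) = ∫ x, g l (shift ζ x) ∂μ := fun l =>
    integral_map (shift ζ).continuous.aemeasurable (hg l).continuous.aestronglyMeasurable
  simp only [cylindricalGrad, e, sum_inner, inner_smul_left, RCLike.conj_to_real]
  refine ⟨integrable_finsetSum _ fun l _ => (hi l).const_mul _, ?_⟩
  rw [integral_finsetSum _ fun l _ => (hi l).const_mul _]
  simp only [integral_const_mul]
  set v : Fin L → ℝ := fun l => ∫ x, inner ℝ (∇ (g l) (shift ζ x)) (φ x) ∂μ with hv
  set D := fderiv ℝ j (fun l => ∫ x, g l (shift ζ x) ∂μ)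
  conv_lhs => rw [← Finset.univ_sum_single v, map_sum]
  refine Finset.sum_congr rfl fun l _ => ?_
  have e2 : (Pi.single l (v l) : Fin L → ℝ) = v l • Pi.single l 1 := by
    rw [← Pi.single_smul, smul_eq_mul, mul_one]
  rw [e2, map_smul, smul_eq_mul, mul_comm]

/-- Differentiation of the running cost along a family of displacements `ξ δ` with the uniform
expansion `ξ δ t = ζ t + δ φ t + O(δ²)`. -/
theorem hasDerivAt_integral_cylindrical {T : ℝ} (hT : 0 ≤ T) {μ : Measure (Sp d)} (hμ : IsP2 μ)
    (hJ : IsCylindricalData j g) {ζ φ : ℝ → Sp d →ᵇ Sp d} {ξ : ℝ → ℝ → Sp d →ᵇ Sp d}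
    (hζ : Continuous ζ) (hφ : Continuous φ) (hξ : ∀ δ, Continuous (ξ δ)) {A : ℝ} (hA : 0 ≤ A)
    (h1 : ∀ δ, ∀ t ∈ Icc 0 T, ‖ξ δ t - ζ t‖ ≤ A * |δ|)
    (h2 : ∀ δ, ∀ t ∈ Icc 0 T, ‖ξ δ t - ζ t - δ • φ t‖ ≤ A * δ ^ 2) :
    (∀ t, Integrable (fun x => inner ℝ
      (cylindricalGrad j g (μ.map (shift (ζ t))) (shift (ζ t) x)) (φ t x)) μ) ∧
    Continuous (fun t => ∫ x, inner ℝ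
      (cylindricalGrad j g (μ.map (shift (ζ t))) (shift (ζ t) x)) (φ t x) ∂μ) ∧
    HasDerivAt (fun δ => ∫ t in (0)..T, cylindrical j g (μ.map (shift (ξ δ t))))
      (∫ t in (0)..T, ∫ x, inner ℝ
        (cylindricalGrad j g (μ.map (shift (ζ t))) (shift (ζ t) x)) (φ t x) ∂μ) 0 := by
  have hprob := hμ.isProbabilityMeasure
  obtain ⟨G, hG0, hGg, hGq⟩ := hJ.exists_growth
  have hgc : ∀ l, Continuous (g l) := fun l => (hJ.contDiff_inner l).continuous
  have hgrc : ∀ l, Continuous (∇ (g l)) := fun l => continuous_gradient (hJ.contDiff_inner l)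
  have hsq : ∀ (ζ : Sp d →ᵇ Sp d) x, (1 + ‖shift ζ x‖) ^ 2 ≤ (1 + ‖ζ‖) ^ 2 * (1 + ‖x‖) ^ 2 :=
    fun ζ x => by rw [← mul_pow]; gcongr; exact one_add_norm_shift_le ζ x
  -- continuity in time of the moments and of their derivatives
  have hm : ∀ l (ζ : ℝ → Sp d →ᵇ Sp d), Continuous ζ →
      (∀ t, Integrable (fun x => g l (shift (ζ t) x)) μ) ∧
        Continuous fun t => ∫ x, g l (shift (ζ t) x) ∂μ := by
    intro l ζ hζ
    refine continuous_integral_of_growth hμ (c := fun t => G * (1 + ‖ζ t‖) ^ 2)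
      ((hgc l).comp (continuous_uncurry_shift hζ)) (by fun_prop) fun t x => ?_
    refine (hGq l _).trans ?_
    rw [mul_assoc]
    exact mul_le_mul_of_nonneg_left (hsq _ _) hG0
  have hq : ∀ l, (∀ t, Integrable (fun x => inner ℝ (∇ (g l) (shift (ζ t) x)) (φ t x)) μ) ∧
      Continuous fun t => ∫ x, inner ℝ (∇ (g l) (shift (ζ t) x)) (φ t x) ∂μ := by
    intro l
    have e : Continuous fun p : ℝ × Sp d => φ p.1 p.2 := by fun_prop
    refine continuous_integral_of_growth hμ (c := fun t => G * (1 + ‖ζ t‖) * ‖φ t‖)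
      (((hgrc l).comp (continuous_uncurry_shift hζ)).inner e) (by fun_prop) fun t x => ?_
    have h3 := (hGg l (shift (ζ t) x)).trans
      (mul_le_mul_of_nonneg_left (one_add_norm_shift_le (ζ t) x) hG0)
    have h4 := (φ t).norm_coe_le_norm x
    have h5 : 1 + ‖x‖ ≤ (1 + ‖x‖) ^ 2 :=
      le_self_pow₀ (by linarith [norm_nonneg x]) two_ne_zero
    calc |inner ℝ (∇ (g l) (shift (ζ t) x)) (φ t x)| ≤ _ := abs_real_inner_le_norm _ _
      _ ≤ G * ((1 + ‖ζ t‖) * (1 + ‖x‖)) * ‖φ t‖ := by gcongr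
      _ = G * (1 + ‖ζ t‖) * ‖φ t‖ * (1 + ‖x‖) := by ring
      _ ≤ _ := by gcongr
  have hchain := fun t => integral_inner_cylindricalGrad (j := j) (μ := μ) (ζ := ζ t) (φ := φ t)
    hJ.contDiff_inner fun l => (hq l).1 t
  have hm0 : Continuous fun t (l : Fin L) => ∫ x, g l (shift (ζ t) x) ∂μ :=
    continuous_pi fun l => (hm l ζ hζ).2
  have hq0 : Continuous fun t (l : Fin L) => ∫ x, inner ℝ (∇ (g l) (shift (ζ t) x)) (φ t x) ∂μ :=
    continuous_pi fun l => (hq l).2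
  have hjc : Continuous (fderiv ℝ j) := hJ.contDiff_outer.continuous_fderiv one_ne_zero
  have hD : Continuous fun t => fderiv ℝ j (fun l => ∫ x, g l (shift (ζ t) x) ∂μ)
      (fun l => ∫ x, inner ℝ (∇ (g l) (shift (ζ t) x)) (φ t x) ∂μ) :=
    (hjc.comp hm0).clm_apply hq0
  have hcyl : ∀ ζ : Sp d →ᵇ Sp d, cylindrical j g (μ.map (shift ζ)) =
      j fun l => ∫ x, g l (shift ζ x) ∂μ := fun ζ => by
    unfold cylindrical
    congr 1
    ext1 l
    exact integral_map (shift ζ).continuous.aemeasurable (hgc l).aestronglyMeasurable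
  refine ⟨fun t => (hchain t).1, by simpa only [(hchain _).2] using hD, ?_⟩
  have hξ0 : ∀ t ∈ Icc 0 T, ξ 0 t = ζ t := fun t ht => by
    have := h1 0 t ht
    rw [abs_zero, mul_zero] at this
    exact sub_eq_zero.1 (norm_le_zero_iff.1 this)
  -- differentiation of the moments
  obtain ⟨Z, hZ⟩ := isCompact_Icc.exists_bound_of_continuousOn (s := Icc 0 T) hζ.continuousOn
  let bound : Sp d → ℝ := fun x => G * ((1 + Z) * (1 + ‖x‖) + A) * A
  have hbound : Integrable bound μ := by
    have : Integrable (fun x : Sp d => ‖x‖) μ := (hμ.memLp.integrable (by norm_num)).norm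
    exact ((((integrable_const _).add this).const_mul _).add (integrable_const _)).const_mul _
      |>.mul_const _
  have hlip : ∀ l, ∀ t ∈ Icc 0 T, ∀ x δ, |δ| < 1 →
      |g l (shift (ξ δ t) x) - g l (shift (ζ t) x)| ≤ bound x * |δ| := by
    intro l t ht x δ hδ
    have h3 : ‖shift (ξ δ t) x - shift (ζ t) x‖ ≤ A * |δ| := by
      have e : shift (ξ δ t) x - shift (ζ t) x = (ξ δ t - ζ t) x := by simp
      rw [e]
      exact ((ξ δ t - ζ t).norm_coe_le_norm x).trans (h1 δ t ht)
    have h4 : A * |δ| ≤ A := mul_le_of_le_one_right hA hδ.le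
    have h5 : 1 + ‖shift (ζ t) x‖ ≤ (1 + Z) * (1 + ‖x‖) :=
      (one_add_norm_shift_le _ _).trans (by gcongr; exact hZ t ht)
    refine (abs_sub_le_of_growth (hJ.contDiff_inner l) hG0 (hGg l) _ _).trans ?_
    calc _ ≤ G * ((1 + Z) * (1 + ‖x‖) + A) * (A * |δ|) :=
          mul_le_mul (mul_le_mul_of_nonneg_left (by linarith) hG0) h3 (norm_nonneg _)
            (mul_nonneg hG0 (by linarith [norm_nonneg (shift (ζ t) x)]))
      _ = _ := by simp only [bound]; ring
  have hmd : ∀ l, ∀ t ∈ Icc 0 T, HasDerivAt (fun δ => ∫ x, g l (shift (ξ δ t) x) ∂μ)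
      (∫ x, inner ℝ (∇ (g l) (shift (ζ t) x)) (φ t x) ∂μ) 0 := by
    intro l t ht
    refine (hasDerivAt_integral_of_lip (bound := bound) (F := fun δ x => g l (shift (ξ δ t) x))
      (fun δ => ((hm l _ (hξ δ)).1 t).aestronglyMeasurable) ((hm l _ (hξ 0)).1 t)
      ((hq l).1 t).aestronglyMeasurable (Eventually.of_forall fun x δ hδ => ?_) hbound
      (Eventually.of_forall fun x => ?_)).2
    · rw [hξ0 t ht]
      exact hlip l t ht x δ hδ
    · have h3 : HasDerivAt (fun δ => shift (ξ δ t) x) (φ t x) 0 := by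
        rw [hasDerivAt_iff_isLittleO, hξ0 t ht]
        refine Asymptotics.IsBigO.trans_isLittleO (g := fun δ : ℝ => δ ^ 2) ?_ ?_
        · refine Asymptotics.IsBigO.of_bound A (Eventually.of_forall fun δ => ?_)
          have e : shift (ξ δ t) x - shift (ζ t) x - (δ - 0) • φ t x =
              (ξ δ t - ζ t - δ • φ t) x := by simp
          rw [e, norm_pow, Real.norm_eq_abs, sq_abs]
          exact ((ξ δ t - ζ t - δ • φ t).norm_coe_le_norm x).trans (h2 δ t ht)
        · simpa using Asymptotics.isLittleO_pow_id (𝕜 := ℝ) one_lt_two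
      have h4 := ((hJ.contDiff_inner l).differentiable one_ne_zero
        (shift (ξ 0 t) x)).hasFDerivAt.comp_hasDerivAt (0 : ℝ) h3
      rw [hξ0 t ht] at h4
      have e : inner ℝ (∇ (g l) (shift (ζ t) x)) (φ t x) =
          fderiv ℝ (g l) (shift (ζ t) x) (φ t x) := by
        rw [gradient, InnerProductSpace.toDual_symm_apply]
      rw [e]
      exact h4
  have hml : ∀ t ∈ Icc 0 T, ∀ δ, |δ| < 1 → ‖(fun l => ∫ x, g l (shift (ξ δ t) x) ∂μ) -
      fun l => ∫ x, g l (shift (ζ t) x) ∂μ‖ ≤ (∫ x, bound x ∂μ) * |δ| := by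
    intro t ht δ hδ
    have hB : 0 ≤ (∫ x, bound x ∂μ) * |δ| := by
      refine mul_nonneg (integral_nonneg fun x => ?_) (abs_nonneg _)
      have := (norm_nonneg _).trans (hZ t ht)
      simp only [bound]
      positivity
    refine (pi_norm_le_iff_of_nonneg hB).2 fun l => ?_
    rw [Pi.sub_apply, ← integral_sub ((hm l _ (hξ δ)).1 t) ((hm l _ hζ).1 t), ← integral_mul_const]
    exact norm_integral_le_of_norm_le (hbound.mul_const _)
      (Eventually.of_forall fun x => hlip l t ht x δ hδ)
  -- differentiation of the time integral
  obtain ⟨R, hR⟩ := isCompact_Icc.exists_bound_of_continuousOn (s := Icc 0 T) hm0.continuousOn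
  -- for `|δ| < 1` all moments stay in one closed ball, on which `j` is `N`-Lipschitz
  obtain ⟨N, hN⟩ := (isCompact_closedBall (0 : Fin L → ℝ)
    (R + ∫ x, bound x ∂μ)).exists_bound_of_continuousOn hjc.continuousOn
  have hB0 : 0 ≤ ∫ x, bound x ∂μ := integral_nonneg fun x => by
    have := (norm_nonneg _).trans (hZ 0 ⟨le_rfl, hT⟩)
    simp only [bound, Pi.zero_apply]
    positivity
  have hN0 : 0 ≤ N := (norm_nonneg _).trans (hN 0 (by
    rw [Metric.mem_closedBall, dist_self]
    have := (norm_nonneg _).trans (hR 0 ⟨le_rfl, hT⟩)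
    linarith))
  simp only [hcyl, ← (hchain _).2, intervalIntegral.integral_of_le hT]
  have hFc : ∀ δ, Continuous fun t => j fun l => ∫ x, g l (shift (ξ δ t) x) ∂μ := fun δ =>
    hJ.contDiff_outer.continuous.comp (continuous_pi fun l => (hm l _ (hξ δ)).2)
  have hIoc : ∀ᵐ t ∂(volume.restrict (Ioc 0 T)), t ∈ Icc 0 T :=
    (ae_restrict_mem measurableSet_Ioc).mono fun t ht => Ioc_subset_Icc_self ht
  refine (hasDerivAt_integral_of_lip
    (F := fun δ t => j fun l => ∫ x, g l (shift (ξ δ t) x) ∂μ)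
    (bound := fun _ => N * ∫ x, bound x ∂μ) (fun δ => (hFc δ).aestronglyMeasurable)
    ((hFc 0).integrableOn_Ioc) hD.aestronglyMeasurable ?_ (integrable_const _) ?_).2
  · filter_upwards [hIoc] with t ht δ hδ
    simp only [hξ0 t ht]
    have h3 := hml t ht δ hδ
    have h4 : (∫ x, bound x ∂μ) * |δ| ≤ ∫ x, bound x ∂μ := mul_le_of_le_one_right hB0 hδ.le
    have h5 : (fun l => ∫ x, g l (shift (ζ t) x) ∂μ) ∈
        Metric.closedBall (0 : Fin L → ℝ) (R + ∫ x, bound x ∂μ) := by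
      rw [mem_closedBall_zero_iff]; exact (hR t ht).trans (by linarith)
    have h6 : (fun l => ∫ x, g l (shift (ξ δ t) x) ∂μ) ∈
        Metric.closedBall (0 : Fin L → ℝ) (R + ∫ x, bound x ∂μ) := by
      rw [mem_closedBall_zero_iff]
      have h7 := norm_add_le_of_le h3 (hR t ht)
      rw [sub_add_cancel] at h7
      linarith
    have h8 := (convex_closedBall (0 : Fin L → ℝ)
      (R + ∫ x, bound x ∂μ)).norm_image_sub_le_of_norm_fderiv_le (𝕜 := ℝ)
      (fun y _ => hJ.contDiff_outer.differentiable one_ne_zero y) hN h5 h6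
    rw [Real.norm_eq_abs] at h8
    refine h8.trans ?_
    rw [mul_assoc]
    gcongr
  · filter_upwards [hIoc] with t ht
    have h3 := hasDerivAt_pi.2 fun l => hmd l t ht
    have h4 := (hJ.contDiff_outer.differentiable one_ne_zero
      (fun l => ∫ x, g l (shift (ξ 0 t) x) ∂μ)).hasFDerivAt.comp_hasDerivAt (0 : ℝ) h3
    rw [hξ0 t ht] at h4
    exact h4

end CostDerivative

/-! ### The first-order condition in Lagrangian coordinates -/

section Optimality

variable {d M L : ℕ} {T : ℝ} {C : ℝ≥0} {K1 K2 : Sp d → Sp d} {j : (Fin L → ℝ) → ℝ}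
  {g : Fin L → Sp d → ℝ}

lemma evalAt_add_smul_testToH1 (u : H1 T (Ctrl d M)) (h : 𝓓(timeInterval T, Ctrl d M)) (δ : ℝ)
    {t : ℝ} (ht : t ∈ Icc 0 T) :
    evalAt (u + δ • testToH1 h).1 t = evalAt u.1 t + δ • h t := by
  simp only [evalAt, dif_pos ht]
  rfl

lemma testFunction_eq_zero (h : 𝓓(timeInterval T, Ctrl d M)) {t : ℝ} (ht : t ∉ Ioo 0 T) :
    h t = 0 :=
  image_eq_zero_of_notMem_tsupport fun hx => ht (h.tsupport_subset hx)

/-- First-order optimality in Lagrangian coordinates: the perturbed controls `ubar + δ h` and their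
mean-field flows are admissible, so the cost along them has a critical point at `δ = 0`. -/
theorem IsOptimal.lineDeriv_add_integral_eq_zero (hT : 0 < T) (h1 : IsKernel C K1)
    (h2 : IsKernel C K2) {μhat : Measure (Sp d)} [IsProbabilityMeasure μhat] (hμ : IsP2 μhat)
    {uhat : Ctrl d M} (hJ : IsCylindricalData j g) {J2 : H1 T (Ctrl d M) → ℝ}
    {μbar : ℝ → Measure (Sp d)} {ubar : H1 T (Ctrl d M)}
    (hopt : IsOptimal T K1 K2 μhat uhat j g J2 μbar ubar)
    (hJ2 : GateauxDifferentiableAt J2 ubar) (h : 𝓓(timeInterval T, Ctrl d M))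
    {ζ φ : ℝ → Sp d →ᵇ Sp d} (hζc : Continuous ζ) (hζ0 : ζ 0 = 0)
    (hζ : ∀ t ∈ Icc 0 T,
      HasDerivAt ζ (meanField h1 h2 μhat (evalAt ubar.1 (clamp T t)) (ζ t)) t)
    (hφ0 : φ 0 = 0) (hφ : ∀ t, HasDerivAt φ
      (linMeanField h1 h2 μhat (evalAt ubar.1 (clamp T t)) (h t) (ζ t) (φ t)) t)
    (hμbar : ∀ t ∈ Icc 0 T, μbar t = μhat.map (shift (ζ t))) :
    (∀ t, Integrable (fun x => inner ℝ
      (cylindricalGrad j g (μhat.map (shift (ζ t))) (shift (ζ t) x)) (φ t x)) μhat) ∧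
    Continuous (fun t => ∫ x, inner ℝ
      (cylindricalGrad j g (μhat.map (shift (ζ t))) (shift (ζ t) x)) (φ t x) ∂μhat) ∧
    lineDeriv ℝ J2 ubar (testToH1 h) + ∫ t in (0)..T, (∫ x, inner ℝ
      (cylindricalGrad j g (μhat.map (shift (ζ t))) (shift (ζ t) x)) (φ t x) ∂μhat) = 0 := by
  have huc := continuous_evalAt_clamp hT.le ubar.1
  obtain ⟨H, hH⟩ := h.continuous.bounded_above_of_compact_support h.hasCompactSupport
  obtain ⟨A, hA, hexp⟩ := exists_meanField_expansion h1 h2 μhat hT.le hH hζ0 hζ hφ0 hφ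
  have hwc : ∀ δ : ℝ, Continuous fun t => evalAt ubar.1 (clamp T t) + δ • h t := fun δ =>
    huc.add (h.continuous.const_smul δ)
  choose ξ hξ0 hξ using fun δ => exists_meanField_flow h1 h2 μhat (hwc δ)
  have hξc : ∀ δ, Continuous (ξ δ) := fun δ =>
    continuous_iff_continuousAt.2 fun t => (hξ δ t).continuousAt
  have hφc : Continuous φ := continuous_iff_continuousAt.2 fun t => (hφ t).continuousAt
  obtain ⟨c1, c2, c3⟩ := hasDerivAt_integral_cylindrical hT.le hμ hJ hζc hφc hξc hA
    (fun δ t ht => (hexp δ _ (hξ0 δ) (hξ δ) t ht).1)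
    (fun δ t ht => (hexp δ _ (hξ0 δ) (hξ δ) t ht).2)
  refine ⟨c1, c2, ?_⟩
  have hk0 : evalAt (testToH1 h).1 0 = 0 := by
    have h0 : (0 : ℝ) ∈ Icc 0 T := ⟨le_rfl, hT.le⟩
    simp only [evalAt, dif_pos h0]
    exact testFunction_eq_zero h (by simp)
  have hl : HasDerivAt (fun δ : ℝ => J2 (ubar + δ • testToH1 h))
      (lineDeriv ℝ J2 ubar (testToH1 h)) 0 := (hJ2 _ hk0).hasLineDerivAt
  have hadm : ∀ δ, IsAdmissible T K1 K2 μhat uhat (fun t => μhat.map (shift (ξ δ t)))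
      (ubar + δ • testToH1 h) := by
    intro δ
    have h0 : (0 : ℝ) ∈ Icc 0 T := ⟨le_rfl, hT.le⟩
    refine isAdmissible_of_meanField_flow h1 h2 hT hμ ?_ (hwc δ) (fun t ht => ?_) (hξ0 δ) (hξ δ)
    · change evalAt _ 0 = uhat
      rw [evalAt_add_smul_testToH1 _ _ _ h0, testFunction_eq_zero h (by simp), smul_zero, add_zero]
      exact hopt.admissible.control
    · rw [evalAt_add_smul_testToH1 _ _ _ ht, clamp_of_mem ht]
  have hmin : IsLocalMin (fun δ : ℝ => J2 (ubar + δ • testToH1 h) +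
      ∫ t in (0)..T, cylindrical j g (μhat.map (shift (ξ δ t)))) 0 := by
    refine Eventually.of_forall fun δ => ?_
    have h3 := hopt.minimal _ _ (hadm δ)
    have h4 : ∫ t in (0)..T, cylindrical j g (μbar t) =
        ∫ t in (0)..T, cylindrical j g (μhat.map (shift (ξ 0 t))) := by
      refine intervalIntegral.integral_congr fun t ht => ?_
      rw [uIcc_of_le hT.le] at ht
      have h5 := (hexp 0 _ (hξ0 0) (hξ 0) t ht).1
      rw [abs_zero, mul_zero] at h5
      simp only [hμbar t ht, sub_eq_zero.1 (norm_le_zero_iff.1 h5)]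
    simp only [cost] at h3
    simp only [zero_smul, add_zero]
    rw [h4] at h3
    linarith
  exact hmin.hasDerivAt_eq_zero (hl.add c3)

end Optimality

/-! ### Regularity of the linearized flow -/

section Regularity

variable {d M : ℕ} {C : ℝ≥0} {K K1 K2 : Sp d → Sp d}

/-- The tangent map `(x, v) ↦ DK(x) v`. -/
noncomputable def tangent (K : Sp d → Sp d) (p : Sp d × Sp d) : Sp d := fderiv ℝ K p.1 p.2

lemma IsKernel.contDiff_tangent (h : IsKernel C K) : ContDiff ℝ 1 (tangent K) :=
  (h.contDiff_fderiv.comp contDiff_fst).clm_apply contDiff_snd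

lemma IsKernel.norm_tangent_le (h : IsKernel C K) (p : Sp d × Sp d) :
    ‖tangent K p‖ ≤ C * (1 + ‖p.2‖) :=
  ((fderiv ℝ K p.1).le_of_opNorm_le (h.blip_fderiv.bound _) _).trans (by gcongr; linarith)

lemma IsKernel.norm_fderiv_tangent_le (h : IsKernel C K) (p : Sp d × Sp d) :
    ‖fderiv ℝ (tangent K) p‖ ≤ C * (1 + ‖p.2‖) := by
  have h1 : HasFDerivAt (fun p : Sp d × Sp d => fderiv ℝ K p.1)
      ((fderiv ℝ (fderiv ℝ K) p.1).comp (ContinuousLinearMap.fst ℝ (Sp d) (Sp d))) p :=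
    (h.hasFDerivAt_fderiv p.1).comp p hasFDerivAt_fst
  have h2 := h1.clm_apply (hasFDerivAt_snd (𝕜 := ℝ) (p := p))
  have h3 : HasFDerivAt (tangent K) _ p := h2
  rw [h3.fderiv]
  refine ContinuousLinearMap.opNorm_le_bound _ (by positivity) fun v => ?_
  have e1 : ‖fderiv ℝ K p.1 v.2‖ ≤ C * ‖v‖ :=
    ((fderiv ℝ K p.1).le_of_opNorm_le (h.blip_fderiv.bound _) _).trans
      (by gcongr; exact norm_snd_le v)
  have e2 : ‖fderiv ℝ (fderiv ℝ K) p.1 v.1 p.2‖ ≤ C * ‖v‖ * ‖p.2‖ := by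
    refine ContinuousLinearMap.le_of_opNorm_le _ ?_ _
    exact (ContinuousLinearMap.le_of_opNorm_le _ (h.bound_fderiv₂ _) _).trans
      (by gcongr; exact norm_fst_le v)
  have e3 := norm_add_le_of_le e1 e2
  calc _ ≤ _ := e3
    _ = _ := by ring

variable {F : Type*} [NormedAddCommGroup F]

lemma norm_apply_sub_pair_le {k : Sp d × Sp d → F} (hb : ∀ p, ‖k p‖ ≤ C * (1 + ‖p.2‖))
    (φ : Sp d →ᵇ Sp d) {R S : ℝ} (hR : ‖φ‖ ≤ R) {p : Sp d × Sp d} (hS : ‖p.2‖ ≤ S)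
    (b : Sp d → Sp d) (y : Sp d) : ‖k (p - (b y, φ y))‖ ≤ C * (1 + (S + R)) := by
  refine (hb _).trans ?_
  gcongr
  exact (norm_sub_le _ _).trans (add_le_add hS ((φ.norm_coe_le_norm y).trans hR))

variable [NormedSpace ℝ F]

/-- The interaction between states `p = (x, v)` in the tangent bundle; `linInteraction` is the
case of the kernels `tangent K1` and `tangent K2`. -/
noncomputable def pairInteraction (k1 k2 : Sp d × Sp d → F) (μ : Measure (Sp d))
    (b φ : Sp d → Sp d) (w h : Ctrl d M) (p : Sp d × Sp d) : F :=
  -(∫ y, k1 (p - (b y, φ y)) ∂μ) - ∑ m, k2 (p - (w m, h m))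

lemma continuous_pairInteraction {k1 k2 : Sp d × Sp d → F} (hk1 : Continuous k1)
    (hk2 : Continuous k2) (hb : ∀ p, ‖k1 p‖ ≤ C * (1 + ‖p.2‖)) (μ : Measure (Sp d))
    [IsProbabilityMeasure μ] {ζ φ : ℝ → Sp d →ᵇ Sp d} (hζ : Continuous ζ) (hφ : Continuous φ)
    {w h : ℝ → Ctrl d M} (hw : Continuous w) (hh : Continuous h) :
    Continuous fun z : ℝ × Sp d × Sp d =>
      pairInteraction k1 k2 μ (shift (ζ z.1)) (φ z.1) (w z.1) (h z.1) z.2 := by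
  have hsh := continuous_uncurry_shift hζ
  have hφ' : Continuous fun p : ℝ × Sp d => φ p.1 p.2 := by fun_prop
  refine Continuous.sub (Continuous.neg ?_) (continuous_finsetSum _ fun m _ => hk2.comp ?_)
  · rw [continuous_iff_continuousAt]
    intro z
    refine continuousAt_of_dominated
      (bound := fun _ => C * (1 + ((‖z.2.2‖ + 1) + (‖φ z.1‖ + 1))))
      (Eventually.of_forall fun z => ?_) ?_ (integrable_const _) (Eventually.of_forall fun y => ?_)
    · exact (hk1.comp (continuous_const.sub
        ((shift (ζ z.1)).continuous.prodMk (φ z.1).continuous))).aestronglyMeasurable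
    · have c1 : Continuous fun z : ℝ × Sp d × Sp d => ‖z.2.2‖ := by fun_prop
      have c2 : Continuous fun z : ℝ × Sp d × Sp d => ‖φ z.1‖ := by fun_prop
      filter_upwards [(c1.tendsto z).eventually (gt_mem_nhds (lt_add_one _)),
        (c2.tendsto z).eventually (gt_mem_nhds (lt_add_one _))] with z' h3 h4
      exact Eventually.of_forall fun y => norm_apply_sub_pair_le hb _ h4.le h3.le _ y
    · refine Continuous.continuousAt (hk1.comp (continuous_snd.sub (Continuous.prodMk ?_ ?_)))
      · exact hsh.comp (continuous_fst.prodMk continuous_const)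
      · exact hφ'.comp (continuous_fst.prodMk continuous_const)
  · exact continuous_snd.sub ((((PiLp.continuous_apply 2 _ m).comp hw).comp continuous_fst).prodMk
      (((PiLp.continuous_apply 2 _ m).comp hh).comp continuous_fst))

lemma hasFDerivAt_pairInteraction {k1 k2 : Sp d × Sp d → F}
    (hk1 : ContDiff ℝ 1 k1) (hk2 : ContDiff ℝ 1 k2) (hb : ∀ p, ‖k1 p‖ ≤ C * (1 + ‖p.2‖))
    (hb' : ∀ p, ‖fderiv ℝ k1 p‖ ≤ C * (1 + ‖p.2‖)) (μ : Measure (Sp d)) [IsProbabilityMeasure μ]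
    {b : Sp d → Sp d} (hbc : Continuous b) (φ : Sp d →ᵇ Sp d) (w h : Ctrl d M) (p : Sp d × Sp d) :
    HasFDerivAt (pairInteraction k1 k2 μ b φ w h)
      (pairInteraction (fderiv ℝ k1) (fderiv ℝ k2) μ b φ w h p) p := by
  have hs : ∀ q p : Sp d × Sp d,
      HasFDerivAt (fun p => p - q) (ContinuousLinearMap.id ℝ (Sp d × Sp d)) p :=
    fun q p => (hasFDerivAt_id p).sub_const q
  have hd : ∀ {k : Sp d × Sp d → F}, ContDiff ℝ 1 k → ∀ q p,
      HasFDerivAt (fun p => k (p - q)) (fderiv ℝ k (p - q)) p := fun hk q p => by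
    have := ((hk.differentiable one_ne_zero (p - q)).hasFDerivAt).comp p (hs q p)
    rw [ContinuousLinearMap.comp_id] at this
    exact this
  have hc : Continuous fun y => (b y, φ y) := hbc.prodMk φ.continuous
  refine HasFDerivAt.sub (HasFDerivAt.neg ?_) (HasFDerivAt.fun_sum fun m _ => hd hk2 _ _)
  refine hasFDerivAt_integral_of_dominated_of_fderiv_le (F := fun p y => k1 (p - (b y, φ y)))
    (F' := fun p y => fderiv ℝ k1 (p - (b y, φ y)))
    (bound := fun _ => C * (1 + ((‖p‖ + 1) + ‖φ‖))) (Metric.ball_mem_nhds p one_pos)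
    (Eventually.of_forall fun p =>
      (hk1.continuous.comp (continuous_const.sub hc)).aestronglyMeasurable)
    (integrable_of_bound (hk1.continuous.comp (continuous_const.sub hc)) fun y =>
      norm_apply_sub_pair_le hb φ le_rfl (p := p) le_rfl b y)
    ((hk1.continuous_fderiv one_ne_zero).comp (continuous_const.sub hc)).aestronglyMeasurable
    (Eventually.of_forall fun y q hq => ?_) (integrable_const _)
    (Eventually.of_forall fun y q _ => hd hk1 _ _)
  refine norm_apply_sub_pair_le hb' φ le_rfl ?_ b y
  have h3 : ‖q - p‖ < 1 := mem_ball_iff_norm.1 hq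
  have h4 := norm_snd_le q
  have h5 := norm_add_le (q - p) p
  rw [sub_add_cancel] at h5
  linarith

variable (h1 : IsKernel C K1) (h2 : IsKernel C K2)

/-- The solution of the linearized mean-field equation is jointly `C¹` in time and label, being the
flow of a time-dependent field on the labels and displacements. -/
theorem contDiff_linMeanField_flow {μ : Measure (Sp d)} [IsProbabilityMeasure μ]
    {ζ φ : ℝ → Sp d →ᵇ Sp d} (hζ : Continuous ζ)
    (hZ : ContDiff ℝ 1 fun p : ℝ × Sp d => shift (ζ p.1) p.2) {w h : ℝ → Ctrl d M}
    (hw : Continuous w) (hh : Continuous h) (hφ0 : φ 0 = 0)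
    (hφ : ∀ t, HasDerivAt φ (linMeanField h1 h2 μ (w t) (h t) (ζ t) (φ t)) t) :
    ContDiff ℝ 1 fun p : ℝ × Sp d => φ p.1 p.2 := by
  have hφc : Continuous φ := continuous_iff_continuousAt.2 fun t => (hφ t).continuousAt
  have hφ' : Continuous fun p : ℝ × Sp d => φ p.1 p.2 := by fun_prop
  have hZd : Continuous (fderiv ℝ fun p : ℝ × Sp d => shift (ζ p.1) p.2) :=
    hZ.continuous_fderiv one_ne_zero
  obtain ⟨P, P', hPe, hPc, hP'c, hP⟩ : ∃ (P : ℝ → Sp d × Sp d → Sp d)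
      (P' : ℝ → Sp d × Sp d → Sp d × Sp d →L[ℝ] Sp d),
      (∀ t p, P t p = linInteraction K1 K2 μ (shift (ζ t)) (φ t) (w t) (h t) p.1 p.2) ∧
      Continuous (Function.uncurry P) ∧ Continuous (Function.uncurry P') ∧
      ∀ t p, HasFDerivAt (P t) (P' t p) p :=
    ⟨fun t => pairInteraction (tangent K1) (tangent K2) μ (shift (ζ t)) (φ t) (w t) (h t),
      fun t => pairInteraction (fderiv ℝ (tangent K1)) (fderiv ℝ (tangent K2)) μ (shift (ζ t)) (φ t)
        (w t) (h t), fun t p => rfl,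
      continuous_pairInteraction h1.contDiff_tangent.continuous h2.contDiff_tangent.continuous
        h1.norm_tangent_le μ hζ hφc hw hh,
      continuous_pairInteraction (h1.contDiff_tangent.continuous_fderiv one_ne_zero)
        (h2.contDiff_tangent.continuous_fderiv one_ne_zero) h1.norm_fderiv_tangent_le μ hζ hφc hw hh,
      fun t p => hasFDerivAt_pairInteraction h1.contDiff_tangent h2.contDiff_tangent
        h1.norm_tangent_le h1.norm_fderiv_tangent_le μ (shift (ζ t)).continuous (φ t) (w t) (h t) p⟩
  obtain ⟨DZ, hDZc, hDZ⟩ : ∃ DZ : ℝ → Sp d → Sp d →L[ℝ] Sp d, Continuous (Function.uncurry DZ) ∧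
      ∀ t x, HasFDerivAt (shift (ζ t)) (DZ t x) x :=
    ⟨fun t x => (fderiv ℝ (fun p : ℝ × Sp d => shift (ζ p.1) p.2) (t, x)).comp
      (ContinuousLinearMap.inr ℝ ℝ (Sp d)), hZd.clm_comp continuous_const, fun t x =>
      ((hZ.differentiable one_ne_zero (t, x)).hasFDerivAt).comp x (hasFDerivAt_prodMk_right t x)⟩
  let inl := ContinuousLinearMap.inl ℝ (Sp d) (Sp d)
  let inr := ContinuousLinearMap.inr ℝ (Sp d) (Sp d)
  let fst := ContinuousLinearMap.fst ℝ (Sp d) (Sp d)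
  let snd := ContinuousLinearMap.snd ℝ (Sp d) (Sp d)
  -- the label `x` is constant in time; carrying it as a component of the state moves the dependence on
  -- `x` into the initial value `(x, 0)`, which is affine in `x`
  have key := contDiff_of_flow (V := fun t (z : Sp d × Sp d) => inr (P t (shift (ζ t) z.1, z.2)))
    (V' := fun t z => inr.comp ((P' t (shift (ζ t) z.1, z.2)).comp
      (inl.comp ((DZ t z.1).comp fst) + inr.comp snd)))
    (Y := fun t x => (x, φ t x)) ?_ ?_ ?_ ?_ ?_ inl ?_
  · exact key.snd
  · have e : Continuous fun z : ℝ × Sp d × Sp d => shift (ζ z.1) z.2.1 :=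
      (continuous_uncurry_shift hζ).comp (continuous_fst.prodMk (continuous_fst.comp continuous_snd))
    exact inr.continuous.comp (hPc.comp (continuous_fst.prodMk
      (e.prodMk (continuous_snd.comp continuous_snd))))
  · have e : Continuous fun z : ℝ × Sp d × Sp d => shift (ζ z.1) z.2.1 :=
      (continuous_uncurry_shift hζ).comp (continuous_fst.prodMk (continuous_fst.comp continuous_snd))
    have e2 : Continuous fun z : ℝ × Sp d × Sp d => P' z.1 (shift (ζ z.1) z.2.1, z.2.2) :=
      hP'c.comp (continuous_fst.prodMk (e.prodMk (continuous_snd.comp continuous_snd)))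
    have e3 : Continuous fun z : ℝ × Sp d × Sp d => DZ z.1 z.2.1 :=
      hDZc.comp (continuous_fst.prodMk (continuous_fst.comp continuous_snd))
    exact continuous_const.clm_comp (e2.clm_comp
      ((continuous_const.clm_comp (e3.clm_comp continuous_const)).add continuous_const))
  · intro t z
    have e : HasFDerivAt (fun z : Sp d × Sp d => (shift (ζ t) z.1, z.2))
        (inl.comp ((DZ t z.1).comp fst) + inr.comp snd) z := by
      have e2 := ((hDZ t z.1).comp z hasFDerivAt_fst).prodMk (hasFDerivAt_snd (𝕜 := ℝ) (p := z))
      refine e2.congr_fderiv ?_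
      refine ContinuousLinearMap.ext fun v => Prod.ext ?_ ?_
      · exact (add_zero _).symm
      · exact (zero_add _).symm
    exact inr.hasFDerivAt.comp z ((hP t _).comp z e)
  · exact continuous_snd.prodMk hφ'
  · intro t x
    have e := ((BoundedContinuousFunction.evalCLM ℝ x : (Sp d →ᵇ Sp d) →L[ℝ] Sp d).hasFDerivAt
      (x := φ t)).comp_hasDerivAt t (hφ t)
    refine ((hasDerivAt_const t x).prodMk e).congr_deriv ?_
    rw [hPe]
    rfl
  · intro p p'
    simp [hφ0, inl]

end Regularity

/-! ### The linearized equation in Eulerian coordinates -/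

section Eulerian

variable {d M : ℕ} {C : ℝ≥0} {K1 K2 : Sp d → Sp d} {T : ℝ}

/-- The left-hand side of the linearized equation is a directional derivative in space-time. -/
lemma deriv_add_fderiv_apply {ψ : ℝ → Sp d → Sp d} {t : ℝ} {x : Sp d}
    (h : DifferentiableAt ℝ (Function.uncurry ψ) (t, x)) (v : Sp d) :
    deriv (fun s => ψ s x) t + fderiv ℝ (ψ t) x v = fderiv ℝ (Function.uncurry ψ) (t, x) (1, v) := by
  have e1 : HasDerivAt (fun s => ψ s x) (fderiv ℝ (Function.uncurry ψ) (t, x) (1, 0)) t :=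
    HasFDerivAt.comp_hasDerivAt (l := Function.uncurry ψ) t h.hasFDerivAt
      ((hasDerivAt_id t).prodMk (hasDerivAt_const t x))
  have e2 : HasFDerivAt (ψ t) ((fderiv ℝ (Function.uncurry ψ) (t, x)).comp
      (ContinuousLinearMap.inr ℝ ℝ (Sp d))) x :=
    h.hasFDerivAt.comp x (hasFDerivAt_prodMk_right t x)
  rw [e1.deriv, e2.fderiv, ContinuousLinearMap.comp_apply, ← map_add]
  simp

/-- In Lagrangian coordinates the right-hand side of the linearized equation is the linearized
interaction. -/
lemma linearizedForce_map (h1 : IsKernel C K1) (h2 : IsKernel C K2) (μ : Measure (Sp d))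
    [IsProbabilityMeasure μ] (ζ : Sp d →ᵇ Sp d) {ψ : Sp d → Sp d} (hψ : Continuous ψ)
    (hi : Integrable (fun y => ψ (shift ζ y)) μ) (w h : Ctrl d M) (x : Sp d) :
    linearizedForce K1 K2 (μ.map (shift ζ)) w ψ h x =
      linInteraction K1 K2 μ (shift ζ) (fun y => ψ (shift ζ y)) w h x (ψ x) := by
  have hp := Measure.isProbabilityMeasure_map (μ := μ) (shift ζ).continuous.aemeasurable
  have e1 : fderiv ℝ (velocity K1 K2 (μ.map (shift ζ)) w) x =
      interaction (fderiv ℝ K1) (fderiv ℝ K2) (μ.map (shift ζ)) w x := by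
    rw [velocity_eq_interaction]
    exact (hasFDerivAt_interaction h1.hasFDerivAt h2.hasFDerivAt h1.blip_fderiv.continuous
      h1.blip.bound h1.blip_fderiv.bound _ w x).fderiv
  have hc : Continuous fun y => fderiv ℝ K1 (x - shift ζ y) :=
    h1.blip_fderiv.continuous.comp (continuous_const.sub (shift ζ).continuous)
  have i1 : Integrable (fun y => fderiv ℝ K1 (x - shift ζ y)) μ :=
    integrable_of_bound hc fun y => h1.blip_fderiv.bound _
  have i2 : Integrable (fun y => fderiv ℝ K1 (x - shift ζ y) (ψ (shift ζ y))) μ := by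
    refine (hi.norm.const_mul (C : ℝ)).mono'
      (hc.clm_apply (hψ.comp (shift ζ).continuous)).aestronglyMeasurable
      (Eventually.of_forall fun y => ?_)
    exact (fderiv ℝ K1 _).le_of_opNorm_le (h1.blip_fderiv.bound _) _
  have e2 : ∫ y, fderiv ℝ K1 (x - y) (ψ y) ∂μ.map (shift ζ) =
      ∫ y, fderiv ℝ K1 (x - shift ζ y) (ψ (shift ζ y)) ∂μ :=
    integral_map (shift ζ).continuous.aemeasurable
      ((h1.blip_fderiv.continuous.comp (continuous_const.sub continuous_id)).clm_apply
        hψ).aestronglyMeasurable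
  have i3 : Integrable (fun y => fderiv ℝ K1 (x - shift ζ y) (ψ x)) μ := i1.apply_continuousLinearMap _
  rw [linearizedForce, e1, e2, interaction_map h1.blip_fderiv.continuous μ (shift ζ).continuous,
    linInteraction]
  simp only [map_sub]
  rw [integral_sub i3 i2, sub_apply, neg_apply,
    ContinuousLinearMap.integral_apply i1, sum_apply, Finset.sum_sub_distrib]
  abel

/-- Forward trajectories of a Lipschitz field separate at most exponentially. -/
lemma norm_shift_sub_shift_le {V : ℝ → Sp d → Sp d} {K : ℝ≥0} (hV : ∀ t, LipschitzWith K (V t))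
    {ζ : ℝ → Sp d →ᵇ Sp d} (hζ0 : ζ 0 = 0)
    (hζ : ∀ t x, HasDerivAt (fun t => shift (ζ t) x) (V t (shift (ζ t) x)) t) {t : ℝ}
    (ht : t ∈ Icc 0 T) (x y : Sp d) :
    ‖shift (ζ t) x - shift (ζ t) y‖ ≤ Real.exp (K * T) * ‖x - y‖ := by
  have h3 := norm_le_of_norm_deriv_le (K := K) (ε := 0) K.2 le_rfl
    (fun s _ => (hζ s x).sub (hζ s y)) (fun s _ => by
      simpa using (hV s).norm_sub_le (shift (ζ s) x) (shift (ζ s) y)) ht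
  simp only [hζ0, zero_mul, add_zero, Pi.sub_apply] at h3
  rw [mul_comm]
  simpa using h3

/-- On `[0, T]` the solution of the linearized mean-field equation is bounded, and Lipschitz in time
and label. -/
lemma exists_bound_linMeanField_flow (hT : 0 ≤ T) (h1 : IsKernel C K1) (h2 : IsKernel C K2)
    {μ : Measure (Sp d)} [IsProbabilityMeasure μ] {ζ φ : ℝ → Sp d →ᵇ Sp d} {R : ℝ}
    (hR : ∀ t ∈ Icc 0 T, ∀ x y, ‖shift (ζ t) x - shift (ζ t) y‖ ≤ R * ‖x - y‖)
    {w h : ℝ → Ctrl d M} {H : ℝ} (hH : ∀ t, ‖h t‖ ≤ H) (hφ0 : φ 0 = 0)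
    (hφ : ∀ t, HasDerivAt φ (linMeanField h1 h2 μ (w t) (h t) (ζ t) (φ t)) t) :
    ∃ B : ℝ, 0 ≤ B ∧ (∀ t ∈ Icc 0 T, ‖φ t‖ ≤ B) ∧
      (∀ s ∈ Icc 0 T, ∀ t ∈ Icc 0 T, ‖φ t - φ s‖ ≤ B * |t - s|) ∧
      ∀ t ∈ Icc 0 T, ∀ x y, ‖φ t x - φ t y‖ ≤ B * ‖x - y‖ := by
  have hφc : Continuous φ := continuous_iff_continuousAt.2 fun t => (hφ t).continuousAt
  obtain ⟨N, hN⟩ := isCompact_Icc.exists_bound_of_continuousOn (s := Icc 0 T) hφc.continuousOn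
  have hN0 : 0 ≤ N := (norm_nonneg _).trans (hN 0 ⟨le_rfl, hT⟩)
  have hH0 : 0 ≤ H := (norm_nonneg _).trans (hH 0)
  set k : ℝ := (M + 1) * C with hk
  have hk0 : 0 ≤ k := by positivity
  have hlin : ∀ t ∈ Icc 0 T, ‖linMeanField h1 h2 μ (w t) (h t) (ζ t) (φ t)‖ ≤ k * (N + N + H) := by
    intro t ht
    refine (BoundedContinuousFunction.norm_le (by positivity)).2 fun x => ?_
    refine (norm_linInteraction_le h1 h2 μ (shift (ζ t)).continuous (φ t) (w t) (h t) _ _).trans ?_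
    gcongr
    · exact ((φ t).norm_coe_le_norm x).trans (hN t ht)
    · exact hN t ht
    · exact hH t
  have htime : ∀ s ∈ Icc 0 T, ∀ t ∈ Icc 0 T, ‖φ t - φ s‖ ≤ k * (N + N + H) * |t - s| :=
    fun s hs t ht => Convex.norm_image_sub_le_of_norm_hasDerivWithin_le
      (fun r _ => (hφ r).hasDerivWithinAt) hlin (convex_Icc 0 T) hs ht
  have hspace : ∀ t ∈ Icc 0 T, ∀ x y,
      ‖φ t x - φ t y‖ ≤ k * (|R| * (N + N + H)) * T * Real.exp (k * T) * ‖x - y‖ := by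
    intro t ht x y
    have hd : ∀ x t, HasDerivAt (fun t => φ t x)
        (linMeanField h1 h2 μ (w t) (h t) (ζ t) (φ t) x) t := fun x t =>
      ((BoundedContinuousFunction.evalCLM ℝ x : (Sp d →ᵇ Sp d) →L[ℝ] Sp d).hasFDerivAt
        (x := φ t)).comp_hasDerivAt t (hφ t)
    have h3 := norm_le_of_norm_deriv_le (f := fun t => φ t x - φ t y) (K := k)
      (ε := k * (|R| * ‖x - y‖ * (N + N + H))) hk0 (by positivity)
      (fun s _ => (hd x s).sub (hd y s)) (fun s hs => by
        refine (norm_linInteraction_sub_le h1 h2 μ (shift (ζ s)).continuous (shift (ζ s)).continuous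
          (D := 0) (by simp) (φ s) (φ s) (w s) (w s) (h s) (h s) _ _ _ _).trans ?_
        simp only [sub_self, norm_zero, add_zero]
        rw [← mul_add, add_comm ‖φ s x - φ s y‖]
        have e1 := (hR s hs x y).trans (mul_le_mul_of_nonneg_right (le_abs_self R) (norm_nonneg _))
        have e2 := ((φ s).norm_coe_le_norm y).trans (hN s hs)
        have e3 := hN s hs
        have e4 := hH s
        gcongr) ht
    simp only [hφ0, BoundedContinuousFunction.coe_zero, Pi.zero_apply, sub_self, norm_zero,
      zero_add] at h3
    calc _ ≤ _ := h3
      _ = _ := by ring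
  refine ⟨N + k * (N + N + H) + k * (|R| * (N + N + H)) * T * Real.exp (k * T), by positivity,
    fun t ht => (hN t ht).trans ?_, fun s hs t ht => (htime s hs t ht).trans ?_,
    fun t ht x y => (hspace t ht x y).trans ?_⟩
  · have : 0 ≤ k * (N + N + H) + k * (|R| * (N + N + H)) * T * Real.exp (k * T) := by positivity
    linarith
  · gcongr
    have : 0 ≤ k * (|R| * (N + N + H)) * T * Real.exp (k * T) := by positivity
    linarith
  · gcongr
    have : 0 ≤ N + k * (N + N + H) := by positivity
    linarith

/-- The Lagrangian solution `φ`, read in Eulerian coordinates as `ψ_t = φ_t ∘ Z_t⁻¹`, solves the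
linearized equation and is bounded with bounded derivatives. -/
theorem exists_solvesLinearization (hT : 0 < T) (h1 : IsKernel C K1) (h2 : IsKernel C K2)
    {μhat : Measure (Sp d)} [IsProbabilityMeasure μhat] {μbar : ℝ → Measure (Sp d)}
    {ubar : H1 T (Ctrl d M)} (h : 𝓓(timeInterval T, Ctrl d M)) {V ζ φ : ℝ → Sp d →ᵇ Sp d}
    {inv : ℝ → Sp d → Sp d} {K : ℝ≥0} {B : ℝ} (hV : ∀ t, LipschitzWith K (V t))
    (hVB : ∀ t, ‖V t‖ ≤ B) (hζ : IsFlow V ζ inv)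
    (hVt : ∀ t ∈ Icc 0 T, ∀ x, V t x = velocity K1 K2 (μbar t) (evalAt ubar.1 t) x)
    (hμbar : ∀ t ∈ Icc 0 T, μbar t = μhat.map (shift (ζ t)))
    (hφ0 : φ 0 = 0) (hφ : ∀ t, HasDerivAt φ
      (linMeanField h1 h2 μhat (evalAt ubar.1 (clamp T t)) (h t) (ζ t) (φ t)) t) :
    ∃ ψ, SolvesLinearization K1 K2 μbar ubar h ψ ∧ IsC1Bounded T ψ := by
  obtain ⟨H, hH⟩ := h.continuous.bounded_above_of_compact_support h.hasCompactSupport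
  obtain ⟨N, hN0, hN, hNt, hNx⟩ := exists_bound_linMeanField_flow hT.le h1 h2
    (fun t ht x y => norm_shift_sub_shift_le hV hζ.zero hζ.hasDerivAt_apply ht x y) hH hφ0 hφ
  have hφ1 := contDiff_linMeanField_flow h1 h2 hζ.continuous_disp hζ.contDiff
    (continuous_evalAt_clamp hT.le ubar.1) h.continuous hφ0 hφ
  let ψ : ℝ → Sp d → Sp d := fun t x => φ t (inv t x)
  have hψ : ContDiff ℝ 1 (Function.uncurry ψ) := hφ1.comp (contDiff_fst.prodMk hζ.contDiff_inv)
  have hψt : ∀ t, Continuous (ψ t) := fun t =>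
    hψ.continuous.comp (continuous_const.prodMk continuous_id)
  have hb : ∀ t ∈ Icc 0 T, ∀ x, ‖ψ t x‖ ≤ N := fun t ht x =>
    ((φ t).norm_coe_le_norm _).trans (hN t ht)
  have hIoo : ∀ t ∈ Ioo 0 T, t ∈ Icc 0 T := fun t ht => Ioo_subset_Icc_self ht
  have hB0 : 0 ≤ B := (norm_nonneg _).trans (hVB 0)
  refine ⟨ψ, ⟨hψ.contDiffOn, hψ.continuous.continuousOn, fun x => by simp [ψ, hφ0], ?_, ?_⟩, ?_⟩
  · have e : ∀ t ∈ Ioo 0 T, ∫⁻ x, ‖ψ t x‖ₑ ^ 2 ∂μbar t ≤ ENNReal.ofReal N ^ 2 := by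
      intro t ht
      have hp := Measure.isProbabilityMeasure_map (μ := μhat) (shift (ζ t)).continuous.aemeasurable
      rw [← hμbar t (hIoo t ht)] at hp
      calc _ ≤ ∫⁻ x, ENNReal.ofReal N ^ 2 ∂μbar t := by
            refine lintegral_mono fun x => ?_
            gcongr
            rw [← ofReal_norm]
            exact ENNReal.ofReal_le_ofReal (hb t (hIoo t ht) x)
        _ = _ := by simp
    refine (setLIntegral_mono measurable_const e).trans_lt ?_
    rw [setLIntegral_const]
    exact ENNReal.mul_lt_top (by simp) (by simp)
  · refine (ae_restrict_mem measurableSet_Ioo).mono fun t ht => Eventually.of_forall fun x => ?_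
    have ht' := hIoo t ht
    rw [deriv_add_fderiv_apply (hψ.differentiable one_ne_zero _), hμbar t ht',
      linearizedForce_map h1 h2 μhat (ζ t) (hψt t)
        (integrable_of_bound ((hψt t).comp (shift (ζ t)).continuous) fun y => hb t ht' _),
      ← hμbar t ht', ← hVt t ht']
    -- the derivative of `ψ` along the trajectory through `(t, x)`, computed in two ways
    have e1 : HasDerivAt (fun s => ψ s (shift (ζ s) (inv t x)))
        (fderiv ℝ (Function.uncurry ψ) (t, x) (1, V t x)) t := by
      have e2 := (hasDerivAt_id t).prodMk (hζ.hasDerivAt_apply t (inv t x))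
      rw [hζ.shift_inv] at e2
      refine HasFDerivAt.comp_hasDerivAt (l := Function.uncurry ψ) t ?_ e2
      simp only [id, hζ.shift_inv]
      exact (hψ.differentiable one_ne_zero _).hasFDerivAt
    have e3 : HasDerivAt (fun s => ψ s (shift (ζ s) (inv t x)))
        (linMeanField h1 h2 μhat (evalAt ubar.1 (clamp T t)) (h t) (ζ t) (φ t) (inv t x)) t := by
      simp only [ψ, hζ.inv_shift]
      exact ((BoundedContinuousFunction.evalCLM ℝ (inv t x) :
        (Sp d →ᵇ Sp d) →L[ℝ] Sp d).hasFDerivAt (x := φ t)).comp_hasDerivAt t (hφ t)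
    rw [e1.unique e3]
    change linInteraction K1 K2 μhat _ _ _ _ _ _ = _
    simp only [ψ, hζ.inv_shift, hζ.shift_inv, clamp_of_mem ht']
  · refine ⟨N + N * ((1 + B) * Real.exp (K * T) + 1), fun t ht x =>
      ⟨(hb t (hIoo t ht) x).trans ?_, norm_fderiv_le_of_lip' ℝ (by positivity) ?_⟩⟩
    · have : 0 ≤ N * ((1 + B) * Real.exp (K * T) + 1) := by positivity
      linarith
    · filter_upwards [(isOpen_Ioo.prod isOpen_univ).mem_nhds
        (⟨ht, mem_univ x⟩ : (t, x) ∈ Ioo 0 T ×ˢ univ)] with p hp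
      have hs : p.1 ∈ Icc 0 T := hIoo _ hp.1
      have h3 : |p.1 - t| ≤ ‖p - (t, x)‖ := norm_fst_le (p - (t, x))
      have h4 : ‖p.2 - x‖ ≤ ‖p - (t, x)‖ := norm_snd_le (p - (t, x))
      have h5 := norm_inv_sub_le hζ.hasDerivAt_apply hζ.zero hζ.shift_inv hV hVB (R := T)
        (⟨by linarith [hs.1], hs.2⟩ : p.1 ∈ Icc (-T) T) p.2 x (s := t)
      have h6 := hNx p.1 hs (inv p.1 p.2) (inv t x)
      have h7 := (φ p.1 - φ t).norm_coe_le_norm (inv t x)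
      have h8 := hNt t (hIoo t ht) p.1 hs
      rw [BoundedContinuousFunction.sub_apply] at h7
      have h9 := norm_add_le (φ p.1 (inv p.1 p.2) - φ p.1 (inv t x))
        (φ p.1 (inv t x) - φ t (inv t x))
      rw [sub_add_sub_cancel] at h9
      have h10 : N * ‖inv p.1 p.2 - inv t x‖ ≤
          N * ((‖p - (t, x)‖ + B * ‖p - (t, x)‖) * Real.exp (K * T)) := by
        gcongr
        refine h5.trans ?_
        gcongr
      have h11 : N * |p.1 - t| ≤ N * ‖p - (t, x)‖ := by gcongr
      have h12 : 0 ≤ N * ‖p - (t, x)‖ := by positivity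
      change ‖φ p.1 (inv p.1 p.2) - φ t (inv t x)‖ ≤ _
      linarith

end Eulerian

/-! ### Uniqueness for the linearized equation -/

section Uniqueness

variable {d M : ℕ} {C : ℝ≥0} {K1 K2 : Sp d → Sp d} {T : ℝ}

/-- Grönwall's lemma for an integrable function that is only known to be bounded by a multiple of
its primitive: on a partition into short intervals the primitive vanishes step by step. -/
lemma ae_eq_zero_of_le_lintegral (hT : 0 < T) {n : ℝ → ℝ≥0∞}
    (hn : AEMeasurable n (volume.restrict (Ioo 0 T))) (hfin : ∫⁻ t in Ioo 0 T, n t ≠ ∞) {c : ℝ≥0}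
    (h : ∀ t ∈ Ioo 0 T, n t ≤ c * ∫⁻ s in Ioo 0 t, n s) :
    ∀ᵐ t ∂(volume.restrict (Ioo 0 T)), n t = 0 := by
  -- with `m` steps of length `T / m` one has `c * T / m ≤ 1 / 2`
  obtain ⟨m, hm⟩ := exists_nat_gt (2 * c * T)
  have hm0 : (0 : ℝ) < m := lt_of_le_of_lt (by positivity) hm
  have key : ∀ k : ℕ, k ≤ m → ∫⁻ s in Ioo 0 (k * (T / m)), n s = 0 := by
    intro k
    induction k with
    | zero => simp
    | succ k ih =>
      intro hk
      have ih := ih (by omega)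
      set a := k * (T / m) with ha
      set b := ((k + 1 : ℕ) : ℝ) * (T / m) with hb
      have hab : b - a = T / m := by rw [ha, hb]; push_cast; ring
      have hbT : b ≤ T := by
        calc b ≤ m * (T / m) := by rw [hb]; gcongr
          _ = T := by field_simp
      have hΦ : ∫⁻ s in Ioo 0 b, n s ≠ ∞ :=
        ((lintegral_mono_set (Ioo_subset_Ioo_right hbT)).trans_lt hfin.lt_top).ne
      have hsub : Ioo 0 b ⊆ Ioo 0 a ∪ (Ico a b ∩ Ioo 0 T) := by
        intro s hs
        rcases lt_or_ge s a with hsa | hsa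
        · exact Or.inl ⟨hs.1, hsa⟩
        · exact Or.inr ⟨⟨hsa, hs.2⟩, hs.1, hs.2.trans_le hbT⟩
      have h3 : ∫⁻ s in Ioo 0 b, n s ≤ (1 / 2 : ℝ≥0) * ∫⁻ s in Ioo 0 b, n s := by
        calc ∫⁻ s in Ioo 0 b, n s
            ≤ ∫⁻ s in Ioo 0 a ∪ (Ico a b ∩ Ioo 0 T), n s := lintegral_mono_set hsub
          _ ≤ (∫⁻ s in Ioo 0 a, n s) + ∫⁻ s in Ico a b ∩ Ioo 0 T, n s := lintegral_union_le _ _ _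
          _ = ∫⁻ s in Ico a b ∩ Ioo 0 T, n s := by rw [ih, zero_add]
          _ ≤ ∫⁻ s in Ico a b ∩ Ioo 0 T, c * ∫⁻ s in Ioo 0 b, n s := by
              refine setLIntegral_mono' (measurableSet_Ico.inter measurableSet_Ioo) fun s hs => ?_
              refine (h s hs.2).trans ?_
              gcongr
              exact hs.1.2.le
          _ = c * (∫⁻ s in Ioo 0 b, n s) * volume (Ico a b ∩ Ioo 0 T) := setLIntegral_const _ _
          _ ≤ c * (∫⁻ s in Ioo 0 b, n s) * ENNReal.ofReal (T / m) := by
              gcongr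
              refine (measure_mono inter_subset_left).trans_eq ?_
              rw [Real.volume_Ico, hab]
          _ = (c * ENNReal.ofReal (T / m)) * ∫⁻ s in Ioo 0 b, n s := by ring
          _ ≤ _ := by
              gcongr
              rw [ENNReal.ofReal, ← ENNReal.coe_mul, ENNReal.coe_le_coe, ← NNReal.coe_le_coe]
              have : 0 ≤ T / m := by positivity
              rw [NNReal.coe_mul, Real.coe_toNNReal _ this, ← mul_div_assoc, div_le_iff₀ hm0]
              push_cast
              linarith
      generalize (∫⁻ s in Ioo 0 b, n s) = I at h3 hΦ
      lift I to ℝ≥0 using hΦ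
      rw [← ENNReal.coe_mul, ENNReal.coe_le_coe, ← NNReal.coe_le_coe] at h3
      push_cast at h3
      rw [ENNReal.coe_eq_zero, ← NNReal.coe_eq_zero]
      have := I.2
      linarith
  have h4 := key m le_rfl
  rw [mul_div_cancel₀ _ hm0.ne', lintegral_eq_zero_iff' hn] at h4
  exact h4

/-- Dependence of the linearized interaction on the displacements, in `L¹` of the other particles. -/
lemma norm_linInteraction_sub_le_integral (h1 : IsKernel C K1) (h2 : IsKernel C K2)
    (μ : Measure (Sp d)) [IsProbabilityMeasure μ] {b φ φ' : Sp d → Sp d} (hb : Continuous b)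
    (hφ : Integrable φ μ) (hφ' : Integrable φ' μ) (w h : Ctrl d M) (a q q' : Sp d) :
    ‖linInteraction K1 K2 μ b φ w h a q - linInteraction K1 K2 μ b φ' w h a q'‖ ≤
      (M + 1) * C * (‖q - q'‖ + ∫ y, ‖φ y - φ' y‖ ∂μ) := by
  have hi : ∀ {φ : Sp d → Sp d}, Integrable φ μ → ∀ q,
      Integrable (fun y => fderiv ℝ K1 (a - b y) (q - φ y)) μ := by
    intro φ hφ q
    have hi := (integrable_const q).sub hφ
    refine (hi.norm.const_mul (C : ℝ)).mono' ?_ (Eventually.of_forall fun y =>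
      (fderiv ℝ K1 _).le_of_opNorm_le (h1.blip_fderiv.bound _) _)
    exact (ContinuousLinearMap.apply ℝ (Sp d)).aestronglyMeasurable_comp₂ hi.aestronglyMeasurable
      (h1.blip_fderiv.continuous.comp (continuous_const.sub hb)).aestronglyMeasurable
  have hn : Integrable (fun y => ‖φ y - φ' y‖) μ := (hφ.sub hφ').norm
  have h3 : ‖(∫ y, fderiv ℝ K1 (a - b y) (q - φ y) ∂μ) -
      ∫ y, fderiv ℝ K1 (a - b y) (q' - φ' y) ∂μ‖ ≤ C * (‖q - q'‖ + ∫ y, ‖φ y - φ' y‖ ∂μ) := by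
    rw [← integral_sub (hi hφ q) (hi hφ' q')]
    have e : C * (‖q - q'‖ + ∫ y, ‖φ y - φ' y‖ ∂μ) =
        ∫ y, C * (‖q - q'‖ + ‖φ y - φ' y‖) ∂μ := by
      rw [integral_const_mul, integral_add (integrable_const _) hn]
      simp
    rw [e]
    refine norm_integral_le_of_norm_le
      (((integrable_const _).add hn).const_mul _) (Eventually.of_forall fun y => ?_)
    rw [← map_sub, sub_sub_sub_comm]
    refine ((fderiv ℝ K1 _).le_of_opNorm_le (h1.blip_fderiv.bound _) _).trans ?_
    gcongr
    exact norm_sub_le _ _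
  have h4 : ∀ m, ‖fderiv ℝ K2 (a - w m) (q - h m) - fderiv ℝ K2 (a - w m) (q' - h m)‖ ≤
      C * ‖q - q'‖ := fun m => by
    rw [← map_sub, sub_sub_sub_cancel_right]
    exact (fderiv ℝ K2 _).le_of_opNorm_le (h2.blip_fderiv.bound _) _
  have h5 := norm_sum_le_of_le (Finset.univ : Finset (Fin M)) (fun m _ => h4 m)
  rw [Finset.sum_sub_distrib] at h5
  simp only [Finset.sum_const, Finset.card_univ, Fintype.card_fin, nsmul_eq_mul] at h5
  have e : ∀ I I' S S' : Sp d, -I - S - (-I' - S') = -(I - I') - (S - S') := by intros; abel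
  unfold linInteraction
  rw [e]
  refine (norm_sub_le _ _).trans ?_
  rw [norm_neg]
  have h6 : 0 ≤ M * C * ∫ y, ‖φ y - φ' y‖ ∂μ := by
    have : 0 ≤ ∫ y, ‖φ y - φ' y‖ ∂μ := integral_nonneg fun _ => norm_nonneg _
    positivity
  linarith

/-- The fundamental theorem of calculus as an inequality, for a function that is differentiable on
`(0, T)` and merely continuous at `0`. -/
lemma enorm_le_lintegral_of_hasDerivAt {F : Type*} [NormedAddCommGroup F] [NormedSpace ℝ F]
    [CompleteSpace F] {f f' : ℝ → F} (hf : ∀ t ∈ Ioo 0 T, HasDerivAt f (f' t) t)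
    (hf' : ContinuousOn f' (Ioo 0 T)) (h0 : Tendsto f (𝓝[>] 0) (𝓝 0)) {t : ℝ} (ht : t ∈ Ioo 0 T) :
    ‖f t‖ₑ ≤ ∫⁻ s in Ioo 0 t, ‖f' s‖ₑ := by
  have h1 : ∀ᶠ ε in 𝓝[>] (0 : ℝ), ‖f t - f ε‖ₑ ≤ ∫⁻ s in Ioo 0 t, ‖f' s‖ₑ := by
    filter_upwards [Ioo_mem_nhdsGT ht.1] with ε hε
    have hsub : uIcc ε t ⊆ Ioo 0 T := by
      rw [uIcc_of_le hε.2.le]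
      exact fun s hs => ⟨hε.1.trans_le hs.1, hs.2.trans_lt ht.2⟩
    rw [← intervalIntegral.integral_eq_sub_of_hasDerivAt (fun s hs => hf s (hsub hs))
      (hf'.mono hsub).intervalIntegrable, intervalIntegral.integral_of_le hε.2.le]
    refine (enorm_integral_le_lintegral_enorm _).trans ?_
    rw [← Measure.restrict_congr_set (Ioo_ae_eq_Ioc (μ := volume) (a := ε) (b := t))]
    exact lintegral_mono_set (Ioo_subset_Ioo_left hε.1.le)
  have h2 : Tendsto (fun ε => ‖f t - f ε‖ₑ) (𝓝[>] 0) (𝓝 ‖f t‖ₑ) := by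
    have := (tendsto_const_nhds (x := f t)).sub h0
    rw [sub_zero] at this
    exact this.enorm
  exact le_of_tendsto h2 h1

/-- In Lagrangian coordinates every solution of the linearized equation is the solution of the
linearized mean-field equation: by Tonelli the mean of the distance between the two satisfies an
integral inequality of Grönwall type. -/
theorem SolvesLinearization.ae_eq (hT : 0 < T) (h1 : IsKernel C K1) (h2 : IsKernel C K2)
    {μhat : Measure (Sp d)} [IsProbabilityMeasure μhat] {μbar : ℝ → Measure (Sp d)}
    {ubar : H1 T (Ctrl d M)} {h : 𝓓(timeInterval T, Ctrl d M)} {V ζ φ : ℝ → Sp d →ᵇ Sp d}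
    {inv : ℝ → Sp d → Sp d} (hζ : IsFlow V ζ inv)
    (hVt : ∀ t ∈ Icc 0 T, ∀ x, V t x = velocity K1 K2 (μbar t) (evalAt ubar.1 t) x)
    (hμbar : ∀ t ∈ Icc 0 T, μbar t = μhat.map (shift (ζ t)))
    (hφ0 : φ 0 = 0) (hφ : ∀ t, HasDerivAt φ
      (linMeanField h1 h2 μhat (evalAt ubar.1 (clamp T t)) (h t) (ζ t) (φ t)) t)
    {ψ : ℝ → Sp d → Sp d} (hψ : SolvesLinearization K1 K2 μbar ubar h ψ) :
    ∀ᵐ t ∂(volume.restrict (Ioo 0 T)), ∀ᵐ x ∂μhat, ψ t (shift (ζ t) x) = φ t x := by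
  have hφ1 := contDiff_linMeanField_flow h1 h2 hζ.continuous_disp hζ.contDiff
    (continuous_evalAt_clamp hT.le ubar.1) h.continuous hφ0 hφ
  have hφc : Continuous φ := continuous_iff_continuousAt.2 fun t => (hφ t).continuousAt
  have hopen : IsOpen (Ioo 0 T ×ˢ (univ : Set (Sp d))) := isOpen_Ioo.prod isOpen_univ
  have hIoo : ∀ t ∈ Ioo 0 T, t ∈ Icc 0 T := fun t ht => Ioo_subset_Icc_self ht
  have hψd : ∀ t ∈ Ioo 0 T, ∀ x, DifferentiableAt ℝ (Function.uncurry ψ) (t, x) := fun t ht x =>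
    (hψ.contDiffOn.contDiffAt (hopen.mem_nhds ⟨ht, mem_univ x⟩)).differentiableAt one_ne_zero
  have hψt : ∀ t ∈ Ioo 0 T, Continuous (ψ t) := fun t ht =>
    continuous_iff_continuousAt.2 fun x =>
      (hψd t ht x).continuousAt.comp (Continuous.prodMk_right t).continuousAt
  have hΨ : ContDiffOn ℝ 1 (fun p : ℝ × Sp d => ψ p.1 (shift (ζ p.1) p.2)) (Ioo 0 T ×ˢ univ) :=
    hψ.contDiffOn.comp (contDiff_fst.prodMk hζ.contDiff).contDiffOn
      fun p hp => ⟨hp.1, mem_univ _⟩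
  let W : ℝ → Sp d → Sp d := fun t x => ψ t (shift (ζ t) x) - φ t x
  have hW : ContDiffOn ℝ 1 (Function.uncurry W) (Ioo 0 T ×ˢ univ) := hΨ.sub hφ1.contDiffOn
  let W' : ℝ → Sp d → Sp d := fun t x => fderiv ℝ (Function.uncurry W) (t, x) (1, 0)
  have hWd : ∀ t ∈ Ioo 0 T, ∀ x, HasDerivAt (fun t => W t x) (W' t x) t := fun t ht x =>
    HasFDerivAt.comp_hasDerivAt (l := Function.uncurry W) t
      ((hW.contDiffAt (hopen.mem_nhds ⟨ht, mem_univ x⟩)).differentiableAt one_ne_zero).hasFDerivAt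
      ((hasDerivAt_id t).prodMk (hasDerivAt_const t x))
  have hW'c : ContinuousOn (Function.uncurry W') (Ioo 0 T ×ˢ univ) :=
    (hW.continuousOn_fderiv_of_isOpen hopen le_rfl).clm_apply continuousOn_const
  have hmeas : ∀ {F : ℝ × Sp d → Sp d}, ContinuousOn F (Ioo 0 T ×ˢ univ) → ∀ t ≤ T,
      AEMeasurable (fun p => ‖F p‖ₑ) ((volume.restrict (Ioo 0 t)).prod μhat) := by
    intro F hF t ht
    have e : (volume.restrict (Ioo 0 t)).prod μhat =
        ((volume : Measure ℝ).prod μhat).restrict (Ioo 0 t ×ˢ univ) := by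
      rw [← Measure.prod_restrict, Measure.restrict_univ]
    rw [e]
    exact ((hF.mono (prod_mono (Ioo_subset_Ioo_right ht) subset_rfl)).aemeasurable
      (measurableSet_Ioo.prod MeasurableSet.univ)).enorm
  obtain ⟨N, hN⟩ := isCompact_Icc.exists_bound_of_continuousOn (s := Icc 0 T) hφc.continuousOn
  let n : ℝ → ℝ≥0∞ := fun t => ∫⁻ x, ‖W t x‖ₑ ∂μhat
  have hnm : AEMeasurable n (volume.restrict (Ioo 0 T)) :=
    (hmeas hW.continuousOn T le_rfl).lintegral_prod_right'
  -- integrability of the solution along the flow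
  have hsq : ∫⁻ t in Ioo 0 T, ∫⁻ x, ‖ψ t (shift (ζ t) x)‖ₑ ^ 2 ∂μhat < ∞ := by
    refine (setLIntegral_congr_fun measurableSet_Ioo fun t ht => ?_).trans_lt hψ.square_integrable
    simp only [hμbar t (hIoo t ht)]
    have := hψt t ht
    rw [lintegral_map (by fun_prop) (shift (ζ t)).continuous.measurable]
  have hsqt : ∀ᵐ t ∂(volume.restrict (Ioo 0 T)),
      ∫⁻ x, ‖ψ t (shift (ζ t) x)‖ₑ ^ 2 ∂μhat < ∞ :=
    ae_lt_top' ((hmeas hΨ.continuousOn T le_rfl).pow_const 2).lintegral_prod_right' hsq.ne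
  have hint : ∀ᵐ t ∂(volume.restrict (Ioo 0 T)),
      Integrable (fun x => ψ t (shift (ζ t) x)) μhat := by
    filter_upwards [hsqt, ae_restrict_mem measurableSet_Ioo] with t ht htI
    exact ((memLp_two_iff_lintegral ((hψt t htI).comp
      (shift (ζ t)).continuous).aestronglyMeasurable).2 ht).integrable (by norm_num)
  have hnfin : ∫⁻ t in Ioo 0 T, n t ≠ ∞ := by
    -- square integrability in space-time bounds the first moment
    have e : ∀ a : ℝ≥0∞, a ≤ a ^ 2 + 1 := fun a => by
      rcases le_total a 1 with ha | ha
      · exact ha.trans le_add_self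
      · exact (le_self_pow₀ ha two_ne_zero).trans le_self_add
    have e2 : ∀ t ∈ Ioo 0 T, n t ≤
        (∫⁻ x, ‖ψ t (shift (ζ t) x)‖ₑ ^ 2 ∂μhat) + (1 + ENNReal.ofReal N) := by
      intro t ht
      calc n t ≤ ∫⁻ x, (‖ψ t (shift (ζ t) x)‖ₑ ^ 2 + (1 + ENNReal.ofReal N)) ∂μhat := by
            refine lintegral_mono fun x => (enorm_sub_le).trans ?_
            rw [← add_assoc]
            refine add_le_add (e _) ?_
            rw [← ofReal_norm]
            exact ENNReal.ofReal_le_ofReal (((φ t).norm_coe_le_norm x).trans (hN t (hIoo t ht)))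
        _ = _ := by rw [lintegral_add_right _ measurable_const]; simp
    refine ((setLIntegral_mono' measurableSet_Ioo e2).trans_lt ?_).ne
    rw [lintegral_add_right _ measurable_const, setLIntegral_const]
    exact ENNReal.add_lt_top.2 ⟨hsq, ENNReal.mul_lt_top (by simp) (by simp)⟩
  -- the difference solves a linear equation
  let c : ℝ≥0 := (M + 1) * C
  have hW' : ∀ᵐ t ∂(volume.restrict (Ioo 0 T)), ∀ᵐ x ∂μhat,
      ‖W' t x‖ₑ ≤ c * (‖W t x‖ₑ + n t) := by
    filter_upwards [hint, hψ.equation, ae_restrict_mem measurableSet_Ioo] with t hi heq ht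
    rw [hμbar t (hIoo t ht)] at heq
    filter_upwards [ae_of_ae_map (shift (ζ t)).continuous.aemeasurable heq] with x hx
    have hφi : Integrable (φ t) μhat :=
      integrable_of_bound (φ t).continuous (φ t).norm_coe_le_norm
    have e1 : HasDerivAt (fun s => ψ s (shift (ζ s) x))
        (fderiv ℝ (Function.uncurry ψ) (t, shift (ζ t) x) (1, V t (shift (ζ t) x))) t :=
      HasFDerivAt.comp_hasDerivAt (l := Function.uncurry ψ) t (hψd t ht _).hasFDerivAt
        ((hasDerivAt_id t).prodMk (hζ.hasDerivAt_apply t x))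
    have e2 : HasDerivAt (fun t => φ t x)
        (linMeanField h1 h2 μhat (evalAt ubar.1 (clamp T t)) (h t) (ζ t) (φ t) x) t :=
      ((BoundedContinuousFunction.evalCLM ℝ x : (Sp d →ᵇ Sp d) →L[ℝ] Sp d).hasFDerivAt
        (x := φ t)).comp_hasDerivAt t (hφ t)
    rw [← hμbar t (hIoo t ht), ← hVt t (hIoo t ht), deriv_add_fderiv_apply (hψd t ht _),
      hμbar t (hIoo t ht), linearizedForce_map h1 h2 μhat (ζ t) (hψt t ht) hi] at hx
    rw [hx] at e1
    have e3 := (hWd t ht x).unique (e1.sub e2)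
    have e4 : ‖W' t x‖ ≤ (M + 1) * C * (‖W t x‖ + ∫ y, ‖W t y‖ ∂μhat) := by
      rw [e3]
      change ‖linInteraction _ _ _ _ _ _ _ _ _ - linInteraction _ _ _ _ _ _ _ _ _‖ ≤ _
      rw [clamp_of_mem (hIoo t ht)]
      exact norm_linInteraction_sub_le_integral h1 h2 μhat (shift (ζ t)).continuous hi hφi _ _ _ _ _
    have hWi : Integrable (W t) μhat := hi.sub hφi
    have e5 := ENNReal.ofReal_le_ofReal e4
    rw [ENNReal.ofReal_mul (by positivity), ENNReal.ofReal_add (norm_nonneg _)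
      (integral_nonneg fun _ => norm_nonneg _), ofReal_norm, ofReal_norm,
      ofReal_integral_norm_eq_lintegral_enorm hWi] at e5
    refine e5.trans_eq ?_
    congr 1
    have e6 : ((M + 1) * C : ℝ) = ((c : ℝ≥0) : ℝ) := by simp [c]
    rw [e6, ENNReal.ofReal_coe_nnreal]
  have hW'n : ∀ᵐ t ∂(volume.restrict (Ioo 0 T)), ∫⁻ x, ‖W' t x‖ₑ ∂μhat ≤ (2 * c : ℝ≥0) * n t := by
    filter_upwards [hW'] with t ht
    refine (lintegral_mono_ae ht).trans_eq ?_
    rw [lintegral_const_mul' _ _ ENNReal.coe_ne_top, lintegral_add_right _ measurable_const]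
    simp only [lintegral_const, measure_univ, mul_one]
    change (c : ℝ≥0∞) * (n t + n t) = _
    push_cast
    ring
  have hW0 : ∀ x, Tendsto (fun t => W t x) (𝓝[>] 0) (𝓝 0) := by
    intro x
    have e1 : ContinuousWithinAt (fun t => ψ t (shift (ζ t) x)) (Ico 0 T) 0 := by
      have e : ContinuousWithinAt (Function.uncurry ψ) (Ico 0 T ×ˢ univ) (0, shift (ζ 0) x) :=
        hψ.continuousOn _ ⟨⟨le_rfl, hT⟩, mem_univ _⟩
      refine e.comp (x := (0 : ℝ)) (f := fun t => (t, shift (ζ t) x)) ?_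
        fun t ht => ⟨ht, mem_univ _⟩
      exact (continuous_id.prodMk ((continuous_uncurry_shift hζ.continuous_disp).comp
        (Continuous.prodMk_left x))).continuousWithinAt
    have e2 : ContinuousWithinAt (fun t => W t x) (Ico 0 T) 0 :=
      e1.sub (hφ1.continuous.comp (Continuous.prodMk_left x)).continuousWithinAt
    have e3 : W 0 x = 0 := by simp [W, hψ.initial, hφ0]
    have e4 := e2.tendsto
    rw [e3] at e4
    exact e4.mono_left (nhdsWithin_le_of_mem (mem_of_superset (Ioo_mem_nhdsGT hT)
      Ioo_subset_Ico_self))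
  have hn : ∀ t ∈ Ioo 0 T, n t ≤ (2 * c : ℝ≥0) * ∫⁻ s in Ioo 0 t, n s := by
    intro t ht
    calc n t ≤ ∫⁻ x, (∫⁻ s in Ioo 0 t, ‖W' s x‖ₑ) ∂μhat :=
          lintegral_mono fun x => enorm_le_lintegral_of_hasDerivAt (fun s hs => hWd s hs x)
            (hW'c.comp (Continuous.prodMk_left x).continuousOn fun s hs => ⟨hs, mem_univ _⟩)
            (hW0 x) ht
      _ = ∫⁻ s in Ioo 0 t, ∫⁻ x, ‖W' s x‖ₑ ∂μhat :=
          (lintegral_lintegral_swap (hmeas hW'c t ht.2.le)).symm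
      _ ≤ ∫⁻ s in Ioo 0 t, (2 * c : ℝ≥0) * n s := lintegral_mono_ae
          (ae_mono (Measure.restrict_mono (Ioo_subset_Ioo_right ht.2.le) le_rfl) hW'n)
      _ = _ := lintegral_const_mul' _ _ ENNReal.coe_ne_top
  filter_upwards [ae_eq_zero_of_le_lintegral hT hnm hnfin hn, ae_restrict_mem measurableSet_Ioo]
    with t ht htI
  have hWt : Continuous (W t) :=
    ((hψt t htI).comp (shift (ζ t)).continuous).sub (φ t).continuous
  have e := (lintegral_eq_zero_iff' hWt.aemeasurable.enorm).1 ht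
  filter_upwards [e] with x hx
  exact sub_eq_zero.1 (enorm_eq_zero.1 hx)

end Uniqueness

end MFControl

open MFControl

theorem theorem3p5 {d M L : ℕ} {T : ℝ} (hT : 0 < T)
    {K1 K2 : MFControl.Sp d → MFControl.Sp d}
    (hK1 : MFControl.IsCb 2 K1) (hK2 : MFControl.IsCb 2 K2)
    {μhat : Measure (MFControl.Sp d)} (hμhat : MFControl.IsP2 μhat) (hac : μhat ≪ volume)
    {uhat : MFControl.Ctrl d M}
    {j : (Fin L → ℝ) → ℝ} {g : Fin L → MFControl.Sp d → ℝ}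
    (hJ1 : MFControl.IsCylindricalData j g)
    {J2 : MFControl.H1 T (MFControl.Ctrl d M) → ℝ}
    {μbar : ℝ → Measure (MFControl.Sp d)} {ubar : MFControl.H1 T (MFControl.Ctrl d M)}
    (hopt : MFControl.IsOptimal T K1 K2 μhat uhat j g J2 μbar ubar)
    (hJ2 : MFControl.GateauxDifferentiableAt J2 ubar)
    (h : 𝓓(MFControl.timeInterval T, MFControl.Ctrl d M)) :
    (∃ ψ, MFControl.SolvesLinearization K1 K2 μbar ubar h ψ ∧ MFControl.IsC1Bounded T ψ) ∧
    ∀ ψ, MFControl.SolvesLinearization K1 K2 μbar ubar h ψ →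
      (∀ᵐ t ∂(volume.restrict (Ioo 0 T)),
        Integrable (fun x => inner ℝ (MFControl.cylindricalGrad j g (μbar t) x) (ψ t x))
          (μbar t)) ∧
      IntervalIntegrable
        (fun t => ∫ x, inner ℝ (MFControl.cylindricalGrad j g (μbar t) x) (ψ t x) ∂(μbar t))
        volume 0 T ∧
      lineDeriv ℝ J2 ubar (MFControl.testToH1 h) +
        ∫ t in (0)..T, ∫ x, inner ℝ (MFControl.cylindricalGrad j g (μbar t) x) (ψ t x)
          ∂(μbar t) = 0 := by
  have hprob : IsProbabilityMeasure μhat := hμhat.isProbabilityMeasure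
  obtain ⟨C₁, hC₁⟩ := exists_isKernel hK1
  obtain ⟨C₂, hC₂⟩ := exists_isKernel hK2
  obtain ⟨C, hC, h1, h2⟩ : ∃ C : NNReal, C ≠ 0 ∧ IsKernel C K1 ∧ IsKernel C K2 :=
    ⟨max C₁ C₂ + 1, by positivity, hC₁ _ ((le_max_left _ _).trans le_self_add),
      hC₂ _ ((le_max_right _ _).trans le_self_add)⟩
  have hcurve := hopt.admissible.curve
  have huc := continuous_evalAt_clamp hT.le ubar.1
  obtain ⟨V, ζ, inv, hV, hζ⟩ := exists_isFlow_velocity hT.le hC h1 h2 hcurve huc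
  have hVt : ∀ t ∈ Icc 0 T, ∀ x, V t x = velocity K1 K2 (μbar t) (evalAt ubar.1 t) x :=
    fun t ht x => by rw [hV, clamp_of_mem ht]
  have hμbar : ∀ t ∈ Icc 0 T, μbar t = μhat.map (shift (ζ t)) :=
    fun t ht => hopt.admissible.eq_map hT hC h1 h2 hV hζ ht
  have hVp : ∀ t, IsProbabilityMeasure (μbar (clamp T t)) := fun t =>
    (hcurve.mem_P2 _ (clamp_mem hT.le t)).isProbabilityMeasure
  have hVl : ∀ t, LipschitzWith ((M + 1) * C) (V t) := fun t => by
    have := lipschitzWith_interaction h1.blip h2.blip (μbar (clamp T t)) (evalAt ubar.1 (clamp T t))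
    exact (funext (hV t) : ⇑(V t) = _) ▸ this
  have hVB : ∀ t, ‖V t‖ ≤ (M + 1) * C := fun t => by
    refine (BoundedContinuousFunction.norm_le (by positivity)).2 fun x => ?_
    rw [hV]
    exact norm_interaction_le h1.blip.bound h2.blip.bound _ _ _
  -- since `μbar_t` is transported by the flow, on `[0, T]` that flow solves the mean-field equation
  have hζm : ∀ t ∈ Icc 0 T,
      HasDerivAt ζ (meanField h1 h2 μhat (evalAt ubar.1 (clamp T t)) (ζ t)) t := fun t ht => by
    refine (hζ.hasDerivAt t).congr_deriv (BoundedContinuousFunction.ext fun x => ?_)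
    change V t (shift (ζ t) x) = velocity K1 K2 (μhat.map (shift (ζ t))) _ (shift (ζ t) x)
    rw [hV, clamp_of_mem ht, hμbar t ht]
  obtain ⟨H, hH⟩ := h.continuous.bounded_above_of_compact_support h.hasCompactSupport
  obtain ⟨φ, hφ0, hφ⟩ := exists_linMeanField_flow h1 h2 μhat huc h.continuous hH
    hζ.continuous_disp
  obtain ⟨c1, c2, c3⟩ := hopt.lineDeriv_add_integral_eq_zero hT h1 h2 hμhat hJ1 hJ2 h
    hζ.continuous_disp hζ.zero hζm hφ0 hφ hμbar
  refine ⟨exists_solvesLinearization hT h1 h2 h hVl hVB hζ hVt hμbar hφ0 hφ, fun ψ hψ => ?_⟩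
  have hae := hψ.ae_eq hT h1 h2 hζ hVt hμbar hφ0 hφ
  -- the change of variables `x ↦ Z_t x`, under which `ψ_t` becomes `φ_t`
  have key : ∀ᵐ t ∂(volume.restrict (Ioo 0 T)),
      Integrable (fun x => inner ℝ (cylindricalGrad j g (μbar t) x) (ψ t x)) (μbar t) ∧
      ∫ x, inner ℝ (cylindricalGrad j g (μbar t) x) (ψ t x) ∂(μbar t) = ∫ x, inner ℝ
        (cylindricalGrad j g (μhat.map (shift (ζ t))) (shift (ζ t) x)) (φ t x) ∂μhat := by
    filter_upwards [hae, ae_restrict_mem measurableSet_Ioo] with t ht htI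
    have hψt : Continuous (ψ t) := continuous_iff_continuousAt.2 fun x =>
      ((hψ.contDiffOn.continuousOn.continuousAt ((isOpen_Ioo.prod isOpen_univ).mem_nhds
        ⟨htI, mem_univ x⟩))).comp (f := fun x => (t, x)) (Continuous.prodMk_right t).continuousAt
    have hm := (hJ1.continuous_cylindricalGrad (μbar t)).inner (𝕜 := ℝ) hψt
    rw [hμbar t (Ioo_subset_Icc_self htI)] at hm ⊢
    have e : (fun x => inner ℝ (cylindricalGrad j g (μhat.map (shift (ζ t))) (shift (ζ t) x))
        (ψ t (shift (ζ t) x))) =ᵐ[μhat] fun x => inner ℝ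
        (cylindricalGrad j g (μhat.map (shift (ζ t))) (shift (ζ t) x)) (φ t x) :=
      ht.mono fun x hx => by simp only [hx]
    rw [integral_map (shift (ζ t)).continuous.aemeasurable hm.aestronglyMeasurable,
      integrable_map_measure hm.aestronglyMeasurable (shift (ζ t)).continuous.aemeasurable]
    exact ⟨(c1 t).congr e.symm, integral_congr_ae e⟩
  have key2 : ∀ᵐ t ∂(volume.restrict (uIoc 0 T)),
      ∫ x, inner ℝ (cylindricalGrad j g (μbar t) x) (ψ t x) ∂(μbar t) = ∫ x, inner ℝ
        (cylindricalGrad j g (μhat.map (shift (ζ t))) (shift (ζ t) x)) (φ t x) ∂μhat := by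
    rw [uIoc_of_le hT.le, ← Measure.restrict_congr_set (Ioo_ae_eq_Ioc (μ := volume))]
    exact key.mono fun t ht => ht.2
  refine ⟨key.mono fun t ht => ht.1, (c2.intervalIntegrable 0 T).congr_ae
    (key2.mono fun t ht => ht.symm), ?_⟩
  rw [intervalIntegral.integral_congr_ae_restrict key2]
  exact c3
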